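/- Let $T>0$, let $H$ and $U$ be separable real Hilbert spaces, and let $V$ be a reflexive real Banach space that is continuously, densely and compactly embedded in $H$. Identifying $H$ with its dual gives the Gelfand triple $V\subseteq H\subseteq V^*$, with duality pairing $\langle\cdot,\cdot\rangle$ between $V^*$ and $V$ satisfying $\langle u,v\rangle=(u,v)_H$ for $u\in H$, $v\in V$. Let $L_2(U,H)$ be the space of Hilbert–Schmidt operators from $U$ to $H$, with norm $\|\cdot\|_{L_2}$, and let $A:[0,T]\times V\to V^*$ and $B:[0,T]\times V\to L_2(U,H)$ be measurable. Let $f\in L^1([0,T],\mathbb R_+)$ and $\alpha\in(1,\infty)$. Consider the following conditions. - (H1) For a.e. $t\in[0,T]$, the map $\lambda\in\mathbb R\mapsto\langle A(t,u+\lambda v),x\rangle$ is continuous for all $u,v,x\in V$. - (H2) There are constants $\gamma,C\ge 0$ and measurable functions $\rho,\eta:V\to\mathbb R$ such that $|\rho(u)|+|\eta(u)|\le C(1+\|u\|_V^\alpha)(1+\|u\|_H^\gamma)$ for all $u\in V$ and, for a.e. $t\in[0,T]$ and all $u,v\in V$, $$2\langle A(t,u)-A(t,v),u-v\rangle+\|B(t,u)-B(t,v)\|_{L_2}^2\le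 [f(t)+\rho(u)+\eta(v)]\,\|u-v\|_H^2 .$$ - (H2') For every $R>0$ there is $K_R\in L^1([0,T],\mathbb R_+)$ such that for a.e. $t\in[0,T]$ and all $u,v\in V$ with $\max(\|u\|_V,\|v\|_V)\le R$, $\ \langle A(t,u)-A(t,v),u-v\rangle\le K_R(t)\|u-v\|_H^2$. - (H3) There is $c>0$ such that for a.e. $t\in[0,T]$ and all $u\in V$, $\ 2\langle A(t,u),u\rangle+\|B(t,u)\|_{L_2}^2\le f(t)(1+\|u\|_H^2)-c\|u\|_V^\alpha$. - (H4) There are constants $\beta,C\ge0$ such that for a.e. $t\in[0,T]$ and all $u\in V$, $\ \|A(t,u)\|_{V^*}^{\alpha/(\alpha-1)}\le (f(t)+C\|u\|_V^\alpha)(1+\|u\|_H^\beta)$. - (H5) For a.e. $t\in[0,T]$: whenever $u_n,u\in V$ and $u_n\to u$ in $H$, then $\|B(t,u_n)-B(t,u)\|_{L_2}\to0$. Moreover there is $g\in L^1([0,T],\mathbb R_+)$ such that for a.e. $t\in[0,T]$ and all $u\in V$, $\ \|B(t,u)\|_{L_2}^2\le g(t)(1+\|u\|_H^2)$. For $h\in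 L^2([0,T],U)$ and $x\in H$, a solution of the skeleton equation $$dY_t=A(t,Y_t)\,dt+B(t,Y_t)h(t)\,dt,\quad t\in(0,T],\qquad Y_0=x,$$ is an element $Y\in C([0,T],H)\cap L^\alpha([0,T],V)$ such that for all $t\in[0,T]$ the identity $Y_t=x+\int_0^tA(s,Y_s)\,ds+\int_0^tB(s,Y_s)h(s)\,ds$ holds in $V^*$. Assume (H1), (H2'), (H3), (H4) and (H5). Then for every $h\in L^2([0,T],U)$ and every $x\in H$ the skeleton equation has a solution $Y\in C([0,T],H)\cap L^\alpha([0,T],V)$. If in addition (H2) holds, then for every such $h$ and $x$ this solution is unique in $C([0,T],H)\cap L^\alpha([0,T],V)$. -/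

import Mathlib

open MeasureTheory Filter Topology
open scoped ENNReal

noncomputable section

namespace Skeleton

section HilbertSchmidt

variable (U H : Type*) [NormedAddCommGroup U] [InnerProductSpace ℝ U] [CompleteSpace U]
  [NormedAddCommGroup H] [InnerProductSpace ℝ H]

/-- The index set of a fixed orthonormal (Hilbert) basis of `U`. -/
def basisSet : Set U := (exists_hilbertBasis ℝ U).choose

/-- A fixed orthonormal (Hilbert) basis of `U`. -/
def basis : HilbertBasis (basisSet U) ℝ U := (exists_hilbertBasis ℝ U).choose_spec.choose

/-- The subspace of the bounded operators `T : U → H` with `∑ ‖T eᵢ‖² < ∞`. -/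
def hsSubmodule : Submodule ℝ (U →L[ℝ] H) where
  carrier := {T | Memℓp (fun i : basisSet U => T (basis U i)) 2}
  add_mem' {S T} hS hT := by
    have h := Memℓp.add hS hT
    exact h
  zero_mem' := zero_memℓp (E := fun _ : basisSet U => H)
  smul_mem' c T hT := by
    have h := Memℓp.const_smul (𝕜 := ℝ) hT c
    exact h

/-- The space `L₂(U, H)` of Hilbert-Schmidt operators. It is a type of its own, so that it carries
the Hilbert-Schmidt norm and not the operator norm. -/
def HilbertSchmidt : Type _ := hsSubmodule U H

instance : AddCommGroup (HilbertSchmidt U H) := inferInstanceAs (AddCommGroup (hsSubmodule U H))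

instance : Module ℝ (HilbertSchmidt U H) := inferInstanceAs (Module ℝ (hsSubmodule U H))

variable {U H}

/-- A Hilbert-Schmidt operator as a bounded operator. -/
def HilbertSchmidt.toCLM : HilbertSchmidt U H →ₗ[ℝ] (U →L[ℝ] H) := (hsSubmodule U H).subtype

/-- The linear map `T ↦ (T eᵢ)ᵢ` into `ℓ²(H)`. -/
def HilbertSchmidt.toLp : HilbertSchmidt U H →ₗ[ℝ] lp (fun _ : basisSet U => H) 2 where
  toFun T := ⟨fun i => HilbertSchmidt.toCLM T (basis U i), T.2⟩
  map_add' S T := by ext i; simp; rfl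
  map_smul' c T := by ext i; simp

theorem HilbertSchmidt.toLp_injective :
    Function.Injective (HilbertSchmidt.toLp : HilbertSchmidt U H → _) := by
  intro S T h
  apply Subtype.ext
  have hd : Dense (Submodule.span ℝ (Set.range (basis U)) : Set U) := by
    have := (basis U).dense_span
    rwa [Submodule.dense_iff_topologicalClosure_eq_top]
  refine ContinuousLinearMap.ext_on hd ?_
  rintro _ ⟨i, rfl⟩
  exact congrFun (congrArg Subtype.val h) i

/-- The Hilbert-Schmidt norm `‖T‖ = (∑ ‖T eᵢ‖²)^(1/2)`, pulled back from `ℓ²(H)`. -/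
instance : NormedAddCommGroup (HilbertSchmidt U H) :=
  NormedAddCommGroup.induced _ _ HilbertSchmidt.toLp HilbertSchmidt.toLp_injective

instance : NormedSpace ℝ (HilbertSchmidt U H) :=
  NormedSpace.induced ℝ _ _ (HilbertSchmidt.toLp : HilbertSchmidt U H →ₗ[ℝ] _)

instance : MeasurableSpace (HilbertSchmidt U H) := borel _

instance : BorelSpace (HilbertSchmidt U H) := ⟨rfl⟩

/-- Parseval's identity. -/
theorem tsum_enorm_inner_sq {E κ : Type*} [NormedAddCommGroup E] [InnerProductSpace ℝ E]
    (b : HilbertBasis κ ℝ E) (y : E) : ∑' k, ‖inner ℝ (b k) y‖ₑ ^ 2 = ‖y‖ₑ ^ 2 := by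
  have h := b.hasSum_inner_mul_inner y y
  have e : ∀ k, inner ℝ y (b k) * inner ℝ (b k) y = ‖inner ℝ (b k) y‖ ^ 2 := fun k => by
    rw [real_inner_comm y (b k), Real.norm_eq_abs, sq_abs, sq]
  simp only [e, real_inner_self_eq_norm_sq] at h
  simp only [← ofReal_norm, ← ENNReal.ofReal_pow (norm_nonneg _)]
  rw [← ENNReal.ofReal_tsum_of_nonneg (fun _ => by positivity) h.summable, h.tsum_eq]

theorem tsum_enorm_sq_eq_adjoint [CompleteSpace H] {κ ν : Type*} (b : HilbertBasis κ ℝ U)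
    (d : HilbertBasis ν ℝ H) (T : U →L[ℝ] H) :
    ∑' i, ‖T (b i)‖ₑ ^ 2 = ∑' k, ‖ContinuousLinearMap.adjoint T (d k)‖ₑ ^ 2 := by
  simp_rw [← tsum_enorm_inner_sq d (T _), ← tsum_enorm_inner_sq b]
  rw [ENNReal.tsum_comm]
  refine tsum_congr fun k => tsum_congr fun i => ?_
  rw [ContinuousLinearMap.adjoint_inner_right, real_inner_comm]

/-- The sum `∑ ‖T eᵢ‖²` does not depend on the orthonormal basis. -/
theorem tsum_enorm_sq_basis_indep [CompleteSpace H] {κ ν : Type*} (b : HilbertBasis κ ℝ U)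
    (c : HilbertBasis ν ℝ U) (T : U →L[ℝ] H) : ∑' i, ‖T (b i)‖ₑ ^ 2 = ∑' j, ‖T (c j)‖ₑ ^ 2 := by
  rw [tsum_enorm_sq_eq_adjoint b (basis H) T, tsum_enorm_sq_eq_adjoint c (basis H) T]

end HilbertSchmidt

section Setting

/-- A normed space is reflexive if the canonical map into its bidual is onto. -/
def IsReflexive (V : Type*) [NormedAddCommGroup V] [NormedSpace ℝ V] : Prop :=
  Function.Surjective (NormedSpace.inclusionInDoubleDual ℝ V)

variable {V H U : Type*} [NormedAddCommGroup V] [NormedSpace ℝ V]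
  [NormedAddCommGroup H] [InnerProductSpace ℝ H]
  [NormedAddCommGroup U] [InnerProductSpace ℝ U] [CompleteSpace U]

/-- `V` is continuously (`ι` is a bounded operator), densely and compactly embedded in `H`. -/
structure IsCompactDenseEmbedding (ι : V →L[ℝ] H) : Prop where
  injective : Function.Injective ι
  denseRange : DenseRange ι
  compact : IsCompactOperator ι

/-- The embedding `H ⊆ V*` of the Gelfand triple, `y ↦ (v ↦ (y, ι v))`. -/
def toDual (ι : V →L[ℝ] H) (y : H) : StrongDual ℝ V := (innerSL ℝ y).comp ι

/-- Lebesgue measure on `[0, T]`. -/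
def timeMeasure (T : ℝ) : Measure ℝ := volume.restrict (Set.Icc 0 T)

/-- `f ∈ L¹([0, T], ℝ₊)`. -/
def IsL1Nonneg (T : ℝ) (f : ℝ → ℝ) : Prop :=
  Integrable f (timeMeasure T) ∧ ∀ᵐ t ∂timeMeasure T, 0 ≤ f t

/-- (H1) -/
def Hemicontinuity (T : ℝ) (A : ℝ → V → StrongDual ℝ V) : Prop :=
  ∀ᵐ t ∂timeMeasure T, ∀ u v x : V, Continuous fun r : ℝ => A t (u + r • v) x

/-- (H2) -/
def LocalMonotonicity [MeasurableSpace V] (ι : V →L[ℝ] H) (T α : ℝ) (f : ℝ → ℝ)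
    (A : ℝ → V → StrongDual ℝ V) (B : ℝ → V → HilbertSchmidt U H) : Prop :=
  ∃ (γ C : ℝ) (ρ η : V → ℝ), 0 ≤ γ ∧ 0 ≤ C ∧ Measurable ρ ∧ Measurable η ∧
    (∀ᵐ t ∂timeMeasure T, ∀ u v : V,
      2 * (A t u - A t v) (u - v) + ‖B t u - B t v‖ ^ 2 ≤
        (f t + ρ u + η v) * ‖ι (u - v)‖ ^ 2) ∧
    ∀ u : V, |ρ u| + |η u| ≤ C * (1 + ‖u‖ ^ α) * (1 + ‖ι u‖ ^ γ)

/-- (H2') -/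
def GeneralizedLocalMonotonicity (ι : V →L[ℝ] H) (T : ℝ) (A : ℝ → V → StrongDual ℝ V) : Prop :=
  ∀ R : ℝ, 0 < R → ∃ K : ℝ → ℝ, IsL1Nonneg T K ∧
    ∀ᵐ t ∂timeMeasure T, ∀ u v : V, max ‖u‖ ‖v‖ ≤ R →
      (A t u - A t v) (u - v) ≤ K t * ‖ι (u - v)‖ ^ 2

/-- (H3) -/
def Coercivity (ι : V →L[ℝ] H) (T α : ℝ) (f : ℝ → ℝ)
    (A : ℝ → V → StrongDual ℝ V) (B : ℝ → V → HilbertSchmidt U H) : Prop :=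
  ∃ c : ℝ, 0 < c ∧ ∀ᵐ t ∂timeMeasure T, ∀ u : V,
    2 * A t u u + ‖B t u‖ ^ 2 ≤ f t * (1 + ‖ι u‖ ^ 2) - c * ‖u‖ ^ α

/-- (H4) -/
def Growth (ι : V →L[ℝ] H) (T α : ℝ) (f : ℝ → ℝ) (A : ℝ → V → StrongDual ℝ V) : Prop :=
  ∃ β C : ℝ, 0 ≤ β ∧ 0 ≤ C ∧ ∀ᵐ t ∂timeMeasure T, ∀ u : V,
    ‖A t u‖ ^ (α / (α - 1)) ≤ (f t + C * ‖u‖ ^ α) * (1 + ‖ι u‖ ^ β)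

/-- (H5) -/
def DiffusionContinuity (ι : V →L[ℝ] H) (T : ℝ) (B : ℝ → V → HilbertSchmidt U H) : Prop :=
  (∀ᵐ t ∂timeMeasure T, ∀ (w : ℕ → V) (u : V),
    Tendsto (fun n => ι (w n)) atTop (𝓝 (ι u)) →
      Tendsto (fun n => ‖B t (w n) - B t u‖) atTop (𝓝 0)) ∧
  ∃ g : ℝ → ℝ, IsL1Nonneg T g ∧
    ∀ᵐ t ∂timeMeasure T, ∀ u : V, ‖B t u‖ ^ 2 ≤ g t * (1 + ‖ι u‖ ^ 2)

/-- `Y ∈ C([0, T], H) ∩ L^α([0, T], V)` solves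
`Y t = x + ∫₀ᵗ A(s, Y s) ds + ∫₀ᵗ B(s, Y s) h(s) ds` in `V*` for all `t ∈ [0, T]`.
The function `Z` is the `V`-valued version of `Y`, which the injectivity of `ι` makes unique almost
everywhere. Only the values of `Y` on `[0, T]` matter. -/
def IsSolution (ι : V →L[ℝ] H) (T α : ℝ) (A : ℝ → V → StrongDual ℝ V)
    (B : ℝ → V → HilbertSchmidt U H) (h : ℝ → U) (x : H) (Y : ℝ → H) : Prop :=
  ContinuousOn Y (Set.Icc 0 T) ∧
  ∃ Z : ℝ → V, MemLp Z (ENNReal.ofReal α) (timeMeasure T) ∧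
    (∀ᵐ t ∂timeMeasure T, ι (Z t) = Y t) ∧
    Integrable (fun s => A s (Z s)) (timeMeasure T) ∧
    Integrable (fun s => toDual ι ((B s (Z s)).toCLM (h s))) (timeMeasure T) ∧
    ∀ t ∈ Set.Icc 0 T, toDual ι (Y t) =
      toDual ι x + (∫ s in (0 : ℝ)..t, A s (Z s)) +
        ∫ s in (0 : ℝ)..t, toDual ι ((B s (Z s)).toCLM (h s))

end Setting

end Skeleton

end

noncomputable section

/-! Existence is a Galerkin argument with pointwise-in-time Minty monotonicity. In a
finite-dimensional subspace the equation is an ordinary differential equation with measurable time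
dependence, solved by Carathéodory's theorem. Coercivity and Grönwall bound its solutions `Z n` in
`C([0,T], H)` and `L^α(0,T; V)` independently of the subspace (`exists_galerkin`), and growth bounds
the drifts in `L^q(0,T; V*)`, `q = α/(α-1)`. The inner products with a dense sequence are
equicontinuous, so a subsequence converges weakly in `H` at every time, to some `Y`. Fatou's lemma
and reflexivity give a `V`-valued version `W` of `Y` in `L^α`. Ehrling's inequality, which is where
compactness enters, improves the convergence to `L¹(0,T; H)`, hence to a.e. convergence along a
subsequence. The diffusion term then converges by its continuity in `H`.

The drift is the difficulty: the constant in the monotonicity condition depends on the radius in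
`V`, so monotonicity cannot be integrated in time along the approximations. Consider instead the
scalar functions `φₙ(s) = ⟨A(s, Zₙ), Zₙ - W⟩`. For a.e. `s` their upper limit is at most `0`:
coercivity handles the indices with `‖Zₙ(s)‖` large, monotonicity on a ball the others
(`eventually_apply_sub_le`). In the mean their lower limit is at least `0`, by comparison of the
Galerkin energy balance with an upper energy bound for `∫⟨A(s, Zₙ), W⟩`
(`eventually_integral_apply_le`). Hence `φₙ → 0` in `L¹` (`tendsto_integral_abs_drift_sub`). Along a
dominated subsequence, coercivity bounds `Zₙ(s)` in `V` for a.e. fixed `s`, and Minty's argument at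
that `s` identifies the limit of `A(s, Zₙ)` as `A(s, W)`.

The upper energy bound comes from approximating `W` by step functions of its own left-endpoint
values. Applied also in reversed time, it yields the energy identity, which gives continuity of `Y`
in `H`. Uniqueness is the energy identity for the difference of two solutions, the stronger
monotonicity condition, and Grönwall. -/

namespace Skeleton

/-! ### Functional analysis of the Gelfand triple: density, separability, weak limits, Ehrling's
inequality. -/

section GelfandTriple

/-- A subspace whose annihilator is trivial is dense. -/
theorem dense_of_forall_dual_eq_zero {E : Type*} [NormedAddCommGroup E] [NormedSpace ℝ E]
    (p : Submodule ℝ E) (h : ∀ ξ : StrongDual ℝ E, (∀ x ∈ p, ξ x = 0) → ξ = 0) :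
    Dense (p : Set E) := by
  intro x
  by_contra hx
  have hx' : x ∉ p.topologicalClosure := hx
  obtain ⟨ξ, u, hu, hux⟩ := geometric_hahn_banach_closed_point
    (s := (p.topologicalClosure : Set E)) p.topologicalClosure.convex
    p.isClosed_topologicalClosure hx'
  have h0 : 0 < u := by simpa using hu 0 (Submodule.zero_mem _)
  have hz : ξ = 0 := by
    refine h ξ fun y hy => ?_
    by_contra hne
    -- A functional bounded above on a subspace vanishes there: this multiple of `y` would attain
    -- the strict bound `u`.
    have := hu ((u / ξ y) • y)
      (Submodule.smul_mem _ _ (p.le_topologicalClosure hy))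
    rw [map_smul, smul_eq_mul, div_mul_cancel₀ _ hne] at this
    exact lt_irrefl _ this
  rw [hz] at hux
  simp at hux
  linarith

/-- The bound makes `l` a bounded functional on the range of `Φ`, and Hahn–Banach extends it without
increasing the norm. With `Φ` the embedding of `H` in `V*`, this produces elements of the bidual of
`V`. -/
theorem exists_dual_extension {E F : Type*} [NormedAddCommGroup E] [NormedSpace ℝ E]
    [AddCommGroup F] [Module ℝ F] (Φ : F →ₗ[ℝ] E) (hΦ : Function.Injective Φ) (l : F →ₗ[ℝ] ℝ)
    {M : ℝ} (hM : 0 ≤ M) (hl : ∀ z, |l z| ≤ M * ‖Φ z‖) :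
    ∃ G : StrongDual ℝ E, (∀ z, G (Φ z) = l z) ∧ ‖G‖ ≤ M := by
  let e := LinearEquiv.ofInjective Φ hΦ
  let L : LinearMap.range Φ →ₗ[ℝ] ℝ := l.comp e.symm.toLinearMap
  have hL : ∀ z, L (e z) = l z := fun z => by simp [L]
  have hLb : ∀ ξ : LinearMap.range Φ, ‖L ξ‖ ≤ M * ‖ξ‖ := fun ξ => by
    obtain ⟨z, rfl⟩ := e.surjective ξ
    rw [hL]
    exact hl z
  obtain ⟨G, hG, hGn⟩ := exists_extension_norm_eq (LinearMap.range Φ) (L.mkContinuous M hLb)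
  refine ⟨G, fun z => ?_, ?_⟩
  · exact (hG (e z)).trans (hL z)
  · rw [hGn]
    exact LinearMap.mkContinuous_norm_le L hM hLb

variable {V H : Type*} [NormedAddCommGroup V] [NormedSpace ℝ V]
  [NormedAddCommGroup H] [InnerProductSpace ℝ H]

theorem toDual_apply (ι : V →L[ℝ] H) (y : H) (v : V) : toDual ι y v = inner ℝ y (ι v) := rfl

/-- The embedding `H ⊆ V*` as a bounded linear operator. -/
def toDualCLM (ι : V →L[ℝ] H) : H →L[ℝ] StrongDual ℝ V :=
  ((ContinuousLinearMap.compL ℝ V H ℝ).flip ι).comp (innerSL ℝ)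

theorem toDualCLM_apply (ι : V →L[ℝ] H) (y : H) : toDualCLM ι y = toDual ι y := rfl

/-- By reflexivity a functional annihilating `H` in `V*` is evaluation at some `u` in `V`; testing
it with the image of `u` itself gives `‖ι u‖² = 0`. -/
theorem denseRange_toDual (hV : IsReflexive V) {ι : V →L[ℝ] H} (hι : Function.Injective ι) :
    DenseRange (toDual ι) := by
  have := dense_of_forall_dual_eq_zero (LinearMap.range (toDualCLM ι).toLinearMap) (by
    intro ξ hξ
    obtain ⟨u, rfl⟩ := hV ξ
    have h0 : ι u = 0 := by
      have h1 := hξ (toDual ι (ι u)) ⟨ι u, rfl⟩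
      rw [NormedSpace.dual_def, toDual_apply] at h1
      exact inner_self_eq_zero.1 h1
    have : u = 0 := hι (by rw [h0, map_zero])
    rw [this, map_zero])
  exact this

/-- A functional is small on elements that are bounded in `V` and small in `H`. -/
theorem exists_abs_apply_le (hV : IsReflexive V) {ι : V →L[ℝ] H} (hι : Function.Injective ι)
    (ξ : StrongDual ℝ V) {M ε : ℝ} (hM : 0 ≤ M) (hε : 0 < ε) :
    ∃ y : H, ∀ v : V, ‖v‖ ≤ M → |ξ v| ≤ ε + ‖y‖ * ‖ι v‖ := by
  -- The functional is approximated by an element of `H`; an error below `ε / (M + 1)` in `V*` costs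
  -- at most `ε` on the ball of radius `M`.
  obtain ⟨_, hmem, ⟨y, rfl⟩⟩ := Metric.dense_iff.1 (denseRange_toDual hV hι) ξ (ε / (M + 1))
    (by positivity)
  refine ⟨y, fun v hv => ?_⟩
  have h1 : ‖ξ - toDual ι y‖ ≤ ε / (M + 1) := by
    rw [Metric.mem_ball, dist_eq_norm, norm_sub_rev] at hmem
    exact hmem.le
  have h2 : |(ξ - toDual ι y) v| ≤ ε := by
    calc |(ξ - toDual ι y) v| ≤ ‖ξ - toDual ι y‖ * ‖v‖ := (ξ - toDual ι y).le_opNorm v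
      _ ≤ ε / (M + 1) * M := by gcongr
      _ ≤ ε := by rw [div_mul_eq_mul_div, div_le_iff₀ (by positivity)]; nlinarith
  have h3 : |toDual ι y v| ≤ ‖y‖ * ‖ι v‖ := abs_real_inner_le_norm _ _
  have h4 : ξ v = (ξ - toDual ι y) v + toDual ι y v := by simp
  rw [h4]
  exact (abs_add_le _ _).trans (add_le_add h2 h3)

/-- Convergence in `H` of a sequence that is bounded in `V` implies weak convergence in `V`. -/
theorem tendsto_apply_of_tendsto_of_bounded (hV : IsReflexive V) {ι : V →L[ℝ] H}
    (hι : Function.Injective ι) {w : ℕ → V} {u : V} {M : ℝ} (hM : ∀ᶠ n in atTop, ‖w n‖ ≤ M)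
    (hw : Tendsto (fun n => ι (w n)) atTop (𝓝 (ι u))) (ξ : StrongDual ℝ V) :
    Tendsto (fun n => ξ (w n)) atTop (𝓝 (ξ u)) := by
  have hM0 : 0 ≤ M := by
    obtain ⟨n, hn⟩ := hM.exists
    exact (norm_nonneg _).trans hn
  rw [Metric.tendsto_atTop']
  intro ε hε
  obtain ⟨y, hy⟩ := exists_abs_apply_le hV hι ξ (M := M + ‖u‖) (ε := ε / 2) (by positivity)
    (by positivity)
  have h1 : Tendsto (fun n => ‖y‖ * ‖ι (w n) - ι u‖) atTop (𝓝 0) := by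
    have := (tendsto_iff_norm_sub_tendsto_zero.1 hw).const_mul ‖y‖
    simpa using this
  have h2 := (hM.and (h1.eventually (gt_mem_nhds (show (0:ℝ) < ε / 2 by positivity))))
  obtain ⟨N, hN⟩ := eventually_atTop.1 h2
  refine ⟨N, fun n hn => ?_⟩
  obtain ⟨ha, hb⟩ := hN n hn.le
  have h3 := hy (w n - u) ((norm_sub_le _ _).trans (by gcongr))
  rw [map_sub, map_sub] at h3
  rw [Real.dist_eq]
  linarith

/-- Each ball of `V`, viewed in `H`, has a countable subset dense for the norm of `H`. Limits in `H`
of `V`-bounded sequences are weak limits in `V`, so a functional vanishing on all these countable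
sets vanishes, and their span is dense. -/
theorem separableSpace_of_denseRange_of_isReflexive [TopologicalSpace.SeparableSpace H]
    (hV : IsReflexive V) {ι : V →L[ℝ] H} (hι : Function.Injective ι) :
    TopologicalSpace.SeparableSpace V := by
  have hsec : SecondCountableTopology H := UniformSpace.secondCountable_of_separable H
  have hsep : ∀ n : ℕ, ∃ D : Set V, D.Countable ∧ D ⊆ Metric.closedBall 0 n ∧
      ι '' Metric.closedBall 0 n ⊆ closure (ι '' D) := by
    intro n
    obtain ⟨t, hts, htc, hcl⟩ := TopologicalSpace.IsSeparable.exists_countable_dense_subset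
      (TopologicalSpace.IsSeparable.of_separableSpace (ι '' Metric.closedBall (0 : V) n))
    obtain ⟨D, hD, hDt⟩ := Set.subset_image_iff.1 hts
    refine ⟨D, ?_, hD, ?_⟩
    · exact Set.countable_of_injective_of_countable_image hι.injOn (hDt ▸ htc)
    · rw [hDt]; exact hcl
  choose D hDc hDb hDd using hsep
  have hdense := dense_of_forall_dual_eq_zero (Submodule.span ℝ (⋃ n, D n)) (by
    intro ξ hξ
    ext u
    obtain ⟨n, hn⟩ := exists_nat_ge ‖u‖
    have hu : ι u ∈ closure (ι '' D n) := hDd n ⟨u, by simpa using hn, rfl⟩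
    obtain ⟨y, hy, hlim⟩ := mem_closure_iff_seq_limit.1 hu
    choose w hw hwy using hy
    have h1 := tendsto_apply_of_tendsto_of_bounded hV hι (w := w) (u := u) (M := n)
      (Eventually.of_forall fun k => by simpa using hDb n (hw k)) (by simpa only [hwy] using hlim) ξ
    have h2 : ∀ k, ξ (w k) = 0 := fun k =>
      hξ _ (Submodule.subset_span (Set.mem_iUnion_of_mem n (hw k)))
    simp only [h2] at h1
    exact tendsto_nhds_unique h1 tendsto_const_nhds)
  have hs : TopologicalSpace.IsSeparable (Submodule.span ℝ (⋃ n, D n) : Set V) :=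
    (TopologicalSpace.IsSeparable.span (Set.countable_iUnion hDc).isSeparable)
  have h3 := hs.closure
  rw [hdense.closure_eq] at h3
  exact TopologicalSpace.isSeparable_univ_iff.1 h3

theorem separableSpace_dual [TopologicalSpace.SeparableSpace H]
    (hV : IsReflexive V) {ι : V →L[ℝ] H} (hι : Function.Injective ι) :
    TopologicalSpace.SeparableSpace (StrongDual ℝ V) :=
  (denseRange_toDual hV hι).separableSpace (toDualCLM ι).continuous

/-- A point of `H` that is a weak limit of a sequence, bounded in `V`, of elements of `V`
belongs to `V`. -/
theorem exists_eq_of_weak_limit (hV : IsReflexive V) {ι : V →L[ℝ] H} (hι : DenseRange ι)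
    {w : ℕ → V} {y : H} {M : ℝ} (hM0 : 0 ≤ M) (hM : ∃ᶠ n in atTop, ‖w n‖ ≤ M)
    (hw : ∀ z : H, Tendsto (fun n => inner ℝ z (ι (w n))) atTop (𝓝 (inner ℝ z y))) :
    ∃ u : V, ι u = y ∧ ‖u‖ ≤ M := by
  -- This makes `z ↦ (z, y)` bounded by `M` for the norm of `V*`, so it extends to the bidual and is
  -- represented by an element of `V`. Since the inner products converge along the whole sequence, a
  -- bound for infinitely many `n` is enough.
  have hbound : ∀ z : H, |inner ℝ z y| ≤ M * ‖toDual ι z‖ := by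
    intro z
    by_contra! hlt
    have h1 := (hw z).abs.eventually (lt_mem_nhds hlt)
    obtain ⟨n, hn, hn'⟩ := (hM.and_eventually h1).exists
    have h2 : |toDual ι z (w n)| ≤ ‖toDual ι z‖ * ‖w n‖ := (toDual ι z).le_opNorm _
    rw [toDual_apply] at h2
    have h3 : ‖toDual ι z‖ * ‖w n‖ ≤ ‖toDual ι z‖ * M := by gcongr
    linarith
  have hinj : Function.Injective (toDualCLM ι).toLinearMap := by
    rw [← LinearMap.ker_eq_bot, LinearMap.ker_eq_bot']
    intro z hz
    have h0 : ∀ v, inner ℝ z (ι v) = 0 := fun v => by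
      have : toDual ι z v = 0 := by
        change (toDualCLM ι).toLinearMap z v = 0
        rw [hz]; rfl
      exact this
    exact hι.eq_zero_of_inner_left ℝ h0
  obtain ⟨G, hG, hGn⟩ := exists_dual_extension (toDualCLM ι).toLinearMap hinj
    (innerSL ℝ y).toLinearMap hM0 (fun z => by
      simpa [real_inner_comm, toDualCLM_apply] using hbound z)
  obtain ⟨u, hu⟩ := hV G
  have hGz : ∀ z, toDual ι z u = inner ℝ z y := fun z => by
    have h1 := hG z
    rw [← hu] at h1
    exact h1.trans (real_inner_comm _ _)
  refine ⟨u, ?_, ?_⟩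
  · refine ext_inner_left ℝ fun z => ?_
    exact hGz z
  · rw [← hu] at hGn
    exact ((NormedSpace.inclusionInDoubleDualLi ℝ).norm_map u).symm.trans_le hGn

/-- Ehrling's inequality: the norm of `H` is controlled by a small multiple of the norm of `V` and
finitely many functionals. -/
theorem ehrling {ι : V →L[ℝ] H} (hι : IsCompactOperator ι) {d : ℕ → H} (hd : DenseRange d)
    {ε : ℝ} (hε : 0 < ε) :
    ∃ N : ℕ, ∀ u : V, ‖ι u‖ ≤ ε * ‖u‖ + N * ∑ j ∈ Finset.range N, |inner ℝ (d j) (ι u)| := by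
  by_contra! hcon
  choose u hu using hcon
  have hu0 : ∀ n, 0 < ‖u n‖ := fun n => norm_pos_iff.2 fun h0 => by
    have := hu n
    simp [h0] at this
  -- Counterexamples are normalised in `V`, so compactness gives a limit in `H` of norm at least
  -- `ε`. The growing factor in front of the sum forces that limit to be orthogonal to every `d j`.
  let w : ℕ → V := fun n => ‖u n‖⁻¹ • u n
  have hw1 : ∀ n, ‖w n‖ = 1 := fun n => by
    simp [w, norm_smul, (hu0 n).ne']
  have hw : ∀ n, ε + n * ∑ j ∈ Finset.range n, |inner ℝ (d j) (ι (w n))| < ‖ι (w n)‖ := by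
    intro n
    have hpos := hu0 n
    have e1 : ∀ j, |inner ℝ (d j) (ι (w n))| = ‖u n‖⁻¹ * |inner ℝ (d j) (ι (u n))| := fun j => by
      simp only [w, map_smul, inner_smul_right, abs_mul, abs_inv, abs_norm]
    have e2 : ‖ι (w n)‖ = ‖u n‖⁻¹ * ‖ι (u n)‖ := by
      simp [w, norm_smul]
    simp only [e1, e2, ← Finset.mul_sum]
    have h1 := mul_lt_mul_of_pos_left (hu n) (inv_pos.2 hpos)
    have h2 : ‖u n‖⁻¹ * (ε * ‖u n‖ + n * ∑ j ∈ Finset.range n, |inner ℝ (d j) (ι (u n))|)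
        = ε + n * (‖u n‖⁻¹ * ∑ j ∈ Finset.range n, |inner ℝ (d j) (ι (u n))|) := by
      field_simp
    linarith
  obtain ⟨y, -, φ, hφ, hlim⟩ := (hι.isCompact_closure_image_closedBall 1).tendsto_subseq
    (x := fun n => ι (w n)) (fun n => subset_closure ⟨w n, by simp [hw1], rfl⟩)
  have hy : ε ≤ ‖y‖ := by
    refine ge_of_tendsto' hlim.norm fun n => ?_
    have h1 := hw (φ n)
    have h2 : 0 ≤ (φ n : ℝ) * ∑ j ∈ Finset.range (φ n), |inner ℝ (d j) (ι (w (φ n)))| := by positivity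
    simp only [Function.comp_apply]
    linarith
  have hy0 : y = 0 := by
    refine hd.eq_zero_of_inner_right ℝ fun j => ?_
    have h1 : Tendsto (fun n => inner ℝ (d j) (ι (w (φ n)))) atTop (𝓝 (inner ℝ (d j) y)) :=
      tendsto_const_nhds.inner hlim
    refine tendsto_nhds_unique h1 ?_
    have h2 : Tendsto (fun n => ‖ι‖ / (φ n : ℝ)) atTop (𝓝 0) :=
      tendsto_const_nhds.div_atTop (tendsto_natCast_atTop_atTop.comp hφ.tendsto_atTop)
    refine squeeze_zero_norm' ?_ h2
    filter_upwards [hφ.tendsto_atTop.eventually_gt_atTop j] with n hn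
    have hpos : (0 : ℝ) < φ n := by exact_mod_cast (Nat.zero_le j).trans_lt hn
    rw [le_div_iff₀ hpos, mul_comm, Real.norm_eq_abs]
    have h3 := hw (φ n)
    have h4 : |inner ℝ (d j) (ι (w (φ n)))| ≤
        ∑ j ∈ Finset.range (φ n), |inner ℝ (d j) (ι (w (φ n)))| :=
      Finset.single_le_sum (f := fun j => |inner ℝ (d j) (ι (w (φ n)))|)
        (fun _ _ => abs_nonneg _) (Finset.mem_range.2 hn)
    have h5 : ‖ι (w (φ n))‖ ≤ ‖ι‖ := by simpa [hw1] using ι.le_opNorm (w (φ n))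
    have h6 := mul_le_mul_of_nonneg_left h4 hpos.le
    linarith
  rw [hy0, norm_zero] at hy
  linarith

/-- A bounded sequence of a Hilbert space whose inner products with a dense set converge is
weakly convergent. -/
theorem exists_weak_limit [CompleteSpace H] {J : Type*} {d : J → H} (hd : DenseRange d) {y : ℕ → H}
    {M : ℝ} (hM : ∀ n, ‖y n‖ ≤ M)
    (hy : ∀ j, ∃ l, Tendsto (fun n => inner ℝ (d j) (y n)) atTop (𝓝 l)) :
    ∃ w : H, ∀ z : H, Tendsto (fun n => inner ℝ z (y n)) atTop (𝓝 (inner ℝ z w)) := by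
  have hM0 : 0 ≤ M := (norm_nonneg _).trans (hM 0)
  have hc : ∀ z, ∃ l, Tendsto (fun n => inner ℝ z (y n)) atTop (𝓝 l) := by
    intro z
    refine cauchySeq_tendsto_of_complete (Metric.cauchySeq_iff'.2 fun ε hε => ?_)
    obtain ⟨_, hb, ⟨j, rfl⟩⟩ := Metric.dense_iff.1 hd z (ε / (3 * (M + 1))) (by positivity)
    obtain ⟨l, hl⟩ := hy j
    obtain ⟨N, hN⟩ := Metric.cauchySeq_iff'.1 hl.cauchySeq (ε / 3) (by positivity)
    refine ⟨N, fun n hn => ?_⟩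
    have h1 := hN n hn
    rw [Real.dist_eq] at h1 ⊢
    have h2 : ∀ k, |inner ℝ z (y k) - inner ℝ (d j) (y k)| ≤ ε / 3 := fun k => by
      rw [← inner_sub_left]
      calc |inner ℝ (z - d j) (y k)| ≤ ‖z - d j‖ * ‖y k‖ := abs_real_inner_le_norm _ _
        _ ≤ ε / (3 * (M + 1)) * M := by
          gcongr
          · rw [← dist_eq_norm, dist_comm]; exact (Metric.mem_ball.1 hb).le
          · exact hM k
        _ ≤ ε / 3 := by
          rw [div_mul_eq_mul_div, div_le_div_iff₀ (by positivity) (by positivity)]; nlinarith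
    have h3 := abs_le.1 (h2 n)
    have h4 := abs_le.1 (h2 N)
    have h5 := abs_lt.1 h1
    rw [abs_lt]
    constructor <;> linarith
  choose l hl using hc
  let L : H →ₗ[ℝ] ℝ :=
    { toFun := l
      map_add' := fun a b => tendsto_nhds_unique (hl (a + b)) (by
        simpa only [inner_add_left] using (hl a).add (hl b))
      map_smul' := fun c a => tendsto_nhds_unique (hl (c • a)) (by
        simpa only [inner_smul_left, RCLike.conj_to_real, RingHom.id_apply, smul_eq_mul] using
          (hl a).const_mul c) }
  have hL : ∀ z, ‖L z‖ ≤ M * ‖z‖ := fun z => by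
    refine le_of_tendsto' (hl z).norm fun n => ?_
    calc ‖inner ℝ z (y n)‖ ≤ ‖z‖ * ‖y n‖ := norm_inner_le_norm _ _
      _ ≤ ‖z‖ * M := by gcongr; exact hM n
      _ = M * ‖z‖ := mul_comm _ _
  refine ⟨(InnerProductSpace.toDual ℝ H).symm (L.mkContinuous M hL), fun z => ?_⟩
  rw [real_inner_comm, InnerProductSpace.toDual_symm_apply]
  exact hl z

theorem norm_le_of_weak_limit {l : Filter ℕ} [l.NeBot] {y : ℕ → H} {w : H} {M : ℝ}
    (hM : ∃ᶠ n in l, ‖y n‖ ≤ M) (hM0 : 0 ≤ M)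
    (hw : ∀ z : H, Tendsto (fun n => inner ℝ z (y n)) l (𝓝 (inner ℝ z w))) : ‖w‖ ≤ M := by
  by_contra! hlt
  have hpos : 0 < ‖w‖ := hM0.trans_lt hlt
  have h1 : M * ‖w‖ < inner ℝ w w := by
    rw [real_inner_self_eq_norm_sq]; nlinarith
  obtain ⟨n, hn, hn'⟩ := (hM.and_eventually ((hw w).eventually (lt_mem_nhds h1))).exists
  have h2 := real_inner_le_norm w (y n)
  nlinarith

end GelfandTriple

/-! ### Measurability of paths, and Hilbert–Schmidt operators applied to paths. -/

section Measurability

variable {H U : Type*}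
  [NormedAddCommGroup H] [InnerProductSpace ℝ H]
  [NormedAddCommGroup U] [InnerProductSpace ℝ U] [CompleteSpace U]

theorem HilbertSchmidt.enorm_sq (S : HilbertSchmidt U H) :
    ‖S‖ₑ ^ 2 = ∑' i, ‖S.toCLM (basis U i)‖ₑ ^ 2 := by
  have h0 : ‖S‖ = ‖HilbertSchmidt.toLp S‖ := rfl
  have h1 := lp.hasSum_norm (p := 2) (by norm_num) (HilbertSchmidt.toLp S)
  simp only [ENNReal.toReal_ofNat, Real.rpow_ofNat] at h1
  rw [← ofReal_norm, ← ENNReal.ofReal_pow (norm_nonneg _), h0, ← h1.tsum_eq,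
    ENNReal.ofReal_tsum_of_nonneg (fun _ => by positivity) h1.summable]
  refine tsum_congr fun i => ?_
  rw [← ofReal_norm, ← ENNReal.ofReal_pow (norm_nonneg _)]
  rfl

/-- The unit vector `u / ‖u‖` is completed to a Hilbert basis. The Hilbert–Schmidt sum is the same
in that basis, and the square of the norm of the image of this vector is one of its terms. -/
theorem HilbertSchmidt.norm_toCLM_apply_le [CompleteSpace H] (S : HilbertSchmidt U H) (u : U) :
    ‖S.toCLM u‖ ≤ ‖S‖ * ‖u‖ := by
  rcases eq_or_ne u 0 with rfl | hu
  · simp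
  have hpos : 0 < ‖u‖ := norm_pos_iff.2 hu
  let e : U := ‖u‖⁻¹ • u
  have he : ‖e‖ = 1 := by simp [e, norm_smul, hpos.ne']
  have ho : Orthonormal ℝ ((↑) : ({e} : Set U) → U) := by
    rw [orthonormal_iff_ite]
    rintro ⟨a, rfl⟩ ⟨b, rfl⟩
    simp [he]
  obtain ⟨w, c, hw, hc⟩ := ho.exists_hilbertBasis_extension
  have h1 : ‖S.toCLM e‖ₑ ^ 2 ≤ ‖S‖ₑ ^ 2 := by
    rw [S.enorm_sq, tsum_enorm_sq_basis_indep (basis U) c]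
    have := ENNReal.le_tsum (f := fun j => ‖S.toCLM (c j)‖ₑ ^ 2) ⟨e, hw rfl⟩
    simpa only [hc] using this
  have h2 : ‖S.toCLM e‖ ≤ ‖S‖ := by
    have h3 := (ENNReal.pow_le_pow_left_iff (n := 2) two_ne_zero).1 h1
    exact enorm_le_iff_norm_le.1 h3
  have h4 : S.toCLM e = ‖u‖⁻¹ • S.toCLM u := by simp [e]
  rw [h4, norm_smul, norm_inv, norm_norm, inv_mul_le_iff₀ hpos] at h2
  linarith

theorem measurable_hilbertSchmidt_apply [CompleteSpace H] [MeasurableSpace H] [BorelSpace H]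
    (u : U) : Measurable fun S : HilbertSchmidt U H => S.toCLM u := by
  let L : HilbertSchmidt U H →ₗ[ℝ] H :=
    { toFun := fun S => S.toCLM u
      map_add' := fun S S' => by simp
      map_smul' := fun c S => by simp }
  have : Continuous L := (L.mkContinuous ‖u‖ fun S => by
    rw [mul_comm]; exact S.norm_toCLM_apply_le u).continuous
  exact this.measurable

/-- Orthonormal vectors are at distance `√2`, so the balls of radius `1/2` around them are disjoint
open sets in a separable space. -/
theorem countable_basisSet [TopologicalSpace.SeparableSpace U] : Countable (basisSet U) := by
  refine Pairwise.countable_of_isOpen_disjoint (s := fun i => Metric.ball (basis U i) (1 / 2))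
    (fun i j hij => ?_) (fun i => Metric.isOpen_ball)
    (fun i => ⟨_, Metric.mem_ball_self (by norm_num)⟩)
  refine Metric.ball_disjoint_ball ?_
  have h1 := (basis U).orthonormal
  have h2 : ‖basis U i - basis U j‖ ^ 2 = 2 := by
    rw [norm_sub_sq_real, h1.2 hij, h1.1 i, h1.1 j]; norm_num
  rw [dist_eq_norm]
  nlinarith [norm_nonneg (basis U i - basis U j)]

/-- Expanding `h s` in the basis reduces the claim to evaluation of `S s` at fixed vectors, which is
continuous for the Hilbert–Schmidt norm. -/
theorem aestronglyMeasurable_hilbertSchmidt_apply [CompleteSpace H]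
    [TopologicalSpace.SeparableSpace H] [TopologicalSpace.SeparableSpace U]
    {μ : Measure ℝ} {S : ℝ → HilbertSchmidt U H} (hS : AEMeasurable S μ) {h : ℝ → U}
    (hh : AEStronglyMeasurable h μ) :
    AEStronglyMeasurable (fun s => (S s).toCLM (h s)) μ := by
  borelize H
  have : SecondCountableTopology H := UniformSpace.secondCountable_of_separable H
  have := countable_basisSet (U := U)
  refine aestronglyMeasurable_of_tendsto_ae (atTop : Filter (Finset (basisSet U)))
    (f := fun F s => ∑ i ∈ F, (basis U).repr (h s) i • (S s).toCLM (basis U i)) ?_ ?_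
  · intro F
    refine Finset.aestronglyMeasurable_fun_sum _ fun i _ => ?_
    refine AEStronglyMeasurable.smul ?_ ?_
    · simp only [HilbertBasis.repr_apply_apply]
      exact (aestronglyMeasurable_const.inner hh)
    · exact ((measurable_hilbertSchmidt_apply _).comp_aemeasurable hS).aestronglyMeasurable
  · refine Eventually.of_forall fun s => ?_
    have h1 := ((basis U).hasSum_repr (h s)).mapL (S s).toCLM
    simp only [map_smul] at h1
    exact h1

/-- A weakly measurable function into a separable Hilbert space is strongly measurable. -/
theorem aestronglyMeasurable_of_inner [CompleteSpace H] [TopologicalSpace.SeparableSpace H]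
    {μ : Measure ℝ} {Y : ℝ → H} (hY : ∀ z, AEStronglyMeasurable (fun s => inner ℝ z (Y s)) μ) :
    AEStronglyMeasurable Y μ := by
  have := countable_basisSet (U := H)
  refine aestronglyMeasurable_of_tendsto_ae (atTop : Filter (Finset (basisSet H)))
    (f := fun F s => ∑ i ∈ F, (basis H).repr (Y s) i • (basis H i)) ?_ ?_
  · intro F
    refine Finset.aestronglyMeasurable_fun_sum _ fun i _ => ?_
    refine AEStronglyMeasurable.smul_const ?_ _
    simp only [HilbertBasis.repr_apply_apply]
    exact hY _
  · exact Eventually.of_forall fun s => (basis H).hasSum_repr (Y s)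

/-- Composition of a function, measurable on `[0, T] × V`, with a measurable path. -/
theorem aemeasurable_comp_path {X W : Type*} [MeasurableSpace W] [MeasurableSpace X]
    {T : ℝ}
    (hT : 0 < T) {A : ℝ → X → W} (hA : Measurable fun p : Set.Icc (0 : ℝ) T × X => A p.1 p.2)
    {Z : ℝ → X} (hZ : AEMeasurable Z (timeMeasure T)) :
    AEMeasurable (fun s => A s (Z s)) (timeMeasure T) := by
  -- Joint measurability is known only for times in `[0, T]`, so time is first projected to that
  -- interval.
  have h1 : AEMeasurable (fun s => A (Set.projIcc 0 T hT.le s) (Z s)) (timeMeasure T) :=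
    hA.comp_aemeasurable
      (((continuous_projIcc (h := hT.le)).measurable.aemeasurable).prodMk hZ)
  refine h1.congr ?_
  refine (ae_restrict_iff' measurableSet_Icc).2 (Eventually.of_forall fun s hs => ?_)
  simp only [Set.projIcc_of_mem hT.le hs]

end Measurability

/-! ### Approximation in `L^α` by step functions with sampled values. -/

section Step

variable {V : Type*} [NormedAddCommGroup V]

/-- Translation is continuous in `L^α(ℝ; V)`. -/
theorem tendsto_lintegral_translate {α : ℝ} (hα : 1 < α) {Z : ℝ → V}
    (hZ : MemLp Z (ENNReal.ofReal α) volume) :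
    Tendsto (fun r : ℝ => ∫⁻ t, ‖Z (t + r) - Z t‖ₑ ^ α) (𝓝 0) (𝓝 0) := by
  have hα0 : 0 < α := one_pos.trans hα
  have hp1 : (1 : ℝ≥0∞) ≤ ENNReal.ofReal α := by
    rw [← ENNReal.ofReal_one]; exact ENNReal.ofReal_le_ofReal hα.le
  have : Fact (1 ≤ ENNReal.ofReal α) := ⟨hp1⟩
  let c : C(ℝ, C(ℝ, ℝ)) := (ContinuousMap.mk (fun a : ℝ × ℝ => a.2 + a.1) (by fun_prop)).curry
  have hc : ∀ r, MeasurePreserving (c r) (volume : Measure ℝ) volume := fun r =>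
    measurePreserving_add_right volume r
  have h1 : Tendsto (fun r => Lp.compMeasurePreserving (c r) (hc r) (hZ.toLp Z)) (𝓝 0)
      (𝓝 (Lp.compMeasurePreserving (c 0) (hc 0) (hZ.toLp Z))) :=
    tendsto_const_nhds.compMeasurePreservingLp (c.continuous.tendsto 0) hc (hc 0)
      ENNReal.ofReal_ne_top
  have h2 := tendsto_iff_edist_tendsto_0.1 h1
  have h3 : ∀ r, edist (Lp.compMeasurePreserving (c r) (hc r) (hZ.toLp Z))
      (Lp.compMeasurePreserving (c 0) (hc 0) (hZ.toLp Z)) =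
      (∫⁻ t, ‖Z (t + r) - Z t‖ₑ ^ α) ^ (1 / α) := by
    intro r
    have e : ∀ r, Lp.compMeasurePreserving (c r) (hc r) (hZ.toLp Z)
        =ᵐ[volume] fun t => Z (t + r) := fun r =>
      (Lp.coeFn_compMeasurePreserving _ (hc r)).trans
        ((hc r).quasiMeasurePreserving.ae_eq_comp hZ.coeFn_toLp)
    rw [Lp.edist_def, eLpNorm_congr_ae ((e r).sub (e 0)),
      eLpNorm_eq_lintegral_rpow_enorm_toReal (by simpa using hα0) ENNReal.ofReal_ne_top,
      ENNReal.toReal_ofReal hα0.le]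
    simp
  simp only [h3] at h2
  have h4 := (ENNReal.continuous_rpow_const (y := α)).tendsto 0 |>.comp h2
  simpa [Function.comp_def, ← ENNReal.rpow_mul, hα0.ne', hα0] using h4

/-- The step function with the value `Z (τ + k δ)` on `(τ + k δ, τ + (k + 1) δ]` for `k ≤ j`, and
the value `0` elsewhere. -/
def stepFun (Z : ℝ → V) (δ : ℝ) (j : ℕ) (τ : ℝ) (s : ℝ) : V :=
  ∑ k ∈ Finset.range (j + 1),
    (Set.Ioc (τ + k * δ) (τ + (k + 1) * δ)).indicator (fun _ => Z (τ + k * δ)) s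

theorem stepFun_eq {Z : ℝ → V} {δ : ℝ} (hδ : 0 < δ) {j k : ℕ} (hk : k ≤ j) {τ s : ℝ}
    (hs : s ∈ Set.Ioc (τ + k * δ) (τ + (k + 1) * δ)) : stepFun Z δ j τ s = Z (τ + k * δ) := by
  rw [stepFun, Finset.sum_eq_single k, Set.indicator_of_mem hs]
  · intro i _ hik
    refine Set.indicator_of_notMem (fun hi => ?_) _
    rcases lt_or_gt_of_ne hik with h | h
    · have h' : (i : ℝ) + 1 ≤ k := by exact_mod_cast h
      have := mul_le_mul_of_nonneg_right h' hδ.le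
      linarith [hi.2, hs.1]
    · have h' : (k : ℝ) + 1 ≤ i := by exact_mod_cast h
      have := mul_le_mul_of_nonneg_right h' hδ.le
      linarith [hi.1, hs.2]
  · intro h
    exact absurd (Finset.mem_range.2 (by omega)) h

theorem stepFun_eq_zero {Z : ℝ → V} {δ : ℝ} (hδ : 0 < δ) {j : ℕ} {τ s : ℝ} (hs : s ≤ τ) :
    stepFun Z δ j τ s = 0 := by
  refine Finset.sum_eq_zero fun k _ => Set.indicator_of_notMem (fun hk => ?_) _
  have : 0 ≤ (k : ℝ) * δ := by positivity
  linarith [hk.1]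

/-- For `τ` in `(0, δ]`, the points `τ + (k - 1) δ` sweep the disjoint intervals `((k - 1) δ, k δ]`.
Starting at `-δ` accounts for the piece to the left of the first node. -/
theorem sum_lintegral_translate_le (g : ℝ → ℝ≥0∞) {δ : ℝ} (hδ : 0 < δ) (n : ℕ) :
    ∑ k ∈ Finset.range n, ∫⁻ τ in Set.Ioc 0 δ, g (τ + ((k : ℝ) - 1) * δ) ≤ ∫⁻ t, g t := by
  have h1 : ∀ k : ℕ, ∫⁻ τ in Set.Ioc 0 δ, g (τ + ((k : ℝ) - 1) * δ) =
      ∫⁻ t in Set.Ioc (((k : ℝ) - 1) * δ) (k * δ), g t := fun k => by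
    have h2 := (measurePreserving_add_right volume (((k : ℝ) - 1) * δ)).setLIntegral_comp_preimage_emb
      (measurableEmbedding_addRight _) g (Set.Ioc (((k : ℝ) - 1) * δ) (k * δ))
    rw [← h2]
    congr 2
    ext x
    simp only [Set.mem_preimage, Set.mem_Ioc]
    constructor <;> rintro ⟨ha, hb⟩ <;> constructor <;> linarith
  simp only [h1]
  have hd : Set.PairwiseDisjoint (↑(Finset.range n))
      (fun k : ℕ => Set.Ioc (((k : ℝ) - 1) * δ) (k * δ)) := by
    intro k _ i _ hki
    refine Set.disjoint_left.2 fun x hx hi => ?_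
    rcases lt_or_gt_of_ne hki with h | h
    · have h' : (k : ℝ) + 1 ≤ i := by exact_mod_cast h
      have := mul_le_mul_of_nonneg_right h' hδ.le
      linarith [hi.1, hx.2]
    · have h' : (i : ℝ) + 1 ≤ k := by exact_mod_cast h
      have := mul_le_mul_of_nonneg_right h' hδ.le
      linarith [hi.2, hx.1]
  rw [← lintegral_biUnion_finset hd (fun k _ => measurableSet_Ioc)]
  exact setLIntegral_le_lintegral _ _

/-- Averaging over the offset `τ`: after Fubini, the mean of the sum over `(0, δ]` is at most a mean
of translation errors, each bounded by `η`. Some offset outside a given null set does not exceed the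
mean. -/
theorem exists_step_offset {α δ : ℝ} (hδ : 0 < δ) {Z : ℝ → V}
    (hZ : StronglyMeasurable Z) {η : ℝ≥0∞}
    (hη : ∀ r ∈ Set.Ioc 0 δ, ∫⁻ t, ‖Z (t + r) - Z t‖ₑ ^ α ≤ η) (n : ℕ) {P : ℝ → Prop}
    (hP : ∀ᵐ τ, P τ) :
    ∃ τ ∈ Set.Ioo 0 δ, P τ ∧ ∑ k ∈ Finset.range n, ∫⁻ r in Set.Ioc 0 δ,
      ‖Z (τ + ((k : ℝ) - 1) * δ + r) - Z (τ + ((k : ℝ) - 1) * δ)‖ₑ ^ α ≤ η := by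
  let g : ℝ → ℝ → ℝ≥0∞ := fun r t => ‖Z (t + r) - Z t‖ₑ ^ α
  have hg : Measurable (Function.uncurry g) :=
    (((hZ.comp_measurable (measurable_snd.add measurable_fst)).sub
      (hZ.comp_measurable measurable_snd)).enorm).pow_const α
  have hg' : ∀ a : ℝ, Measurable (Function.uncurry fun τ r => g r (τ + a)) := fun a =>
    hg.comp (measurable_snd.prodMk (measurable_fst.add_const a))
  let G : ℝ → ℝ≥0∞ := fun τ =>
    ∑ k ∈ Finset.range n, ∫⁻ r in Set.Ioc 0 δ, g r (τ + ((k : ℝ) - 1) * δ)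
  have hGm : Measurable G := by
    refine Finset.measurable_sum _ fun k _ => ?_
    exact (hg' _).lintegral_prod_right'
  have hGint : ∫⁻ τ in Set.Ioc 0 δ, G τ ≤ ENNReal.ofReal δ * η := by
    calc ∫⁻ τ in Set.Ioc 0 δ, G τ
        = ∑ k ∈ Finset.range n, ∫⁻ τ in Set.Ioc 0 δ, ∫⁻ r in Set.Ioc 0 δ,
            g r (τ + ((k : ℝ) - 1) * δ) :=
          lintegral_finsetSum _ fun k _ => (hg' _).lintegral_prod_right'
      _ = ∑ k ∈ Finset.range n, ∫⁻ r in Set.Ioc 0 δ, ∫⁻ τ in Set.Ioc 0 δ,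
            g r (τ + ((k : ℝ) - 1) * δ) :=
          Finset.sum_congr rfl fun k _ => lintegral_lintegral_swap (hg' _).aemeasurable
      _ = ∫⁻ r in Set.Ioc 0 δ, ∑ k ∈ Finset.range n, ∫⁻ τ in Set.Ioc 0 δ,
            g r (τ + ((k : ℝ) - 1) * δ) :=
          (lintegral_finsetSum _ fun k _ => (hg' _).lintegral_prod_left').symm
      _ ≤ ∫⁻ r in Set.Ioc 0 δ, η :=
          setLIntegral_mono measurable_const fun r hr =>
            (sum_lintegral_translate_le (g r) hδ n).trans (hη r hr)
      _ = ENNReal.ofReal δ * η := by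
          rw [setLIntegral_const, Real.volume_Ioc, sub_zero, mul_comm]
  have hne : (volume.restrict (Set.Ioc 0 δ) : Measure ℝ) ≠ 0 := by
    rw [Ne, Measure.restrict_eq_zero, Real.volume_Ioc]
    simpa using hδ
  have hN : (volume.restrict (Set.Ioc 0 δ) : Measure ℝ) {τ | ¬ (τ ∈ Set.Ioo 0 δ ∧ P τ)} = 0 := by
    have h1 : ∀ᵐ τ ∂(volume.restrict (Set.Ioc 0 δ) : Measure ℝ), τ ∈ Set.Ioo 0 δ ∧ P τ := by
      rw [← restrict_Ioo_eq_restrict_Ioc]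
      filter_upwards [ae_restrict_mem measurableSet_Ioo, ae_restrict_of_ae hP] with τ h1 h2
      exact ⟨h1, h2⟩
    exact h1
  obtain ⟨τ, hτ, hle⟩ := exists_notMem_null_le_laverage hne hGm.aemeasurable hN
  rw [Set.mem_ofPred_eq, not_not] at hτ
  refine ⟨τ, hτ.1, hτ.2, hle.trans ?_⟩
  rw [setLAverage_eq, Real.volume_Ioc, sub_zero]
  refine ENNReal.div_le_of_le_mul ?_
  rwa [mul_comm]

/-- A function of `L^α(0, T; V)` is approximated by the step functions of its values at the left
endpoints of suitable partitions, whose points avoid a given null set. -/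
theorem exists_stepFun_tendsto {α T : ℝ} (hα : 1 < α) (hT : 0 < T) {Z : ℝ → V}
    (hZ : MemLp Z (ENNReal.ofReal α) (timeMeasure T)) {P : ℝ → Prop}
    (hP : ∀ᵐ t ∂timeMeasure T, P t) :
    ∃ τ : ℕ → ℝ, (∀ j : ℕ, τ j ∈ Set.Ioo 0 (T / (j + 1))) ∧
      (∀ j k : ℕ, k ≤ j → P (τ j + k * (T / (j + 1)))) ∧
      Tendsto (fun j : ℕ => ∫⁻ s, ‖Z s - stepFun Z (T / (j + 1)) j (τ j) s‖ₑ ^ α ∂timeMeasure T)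
        atTop (𝓝 0) := by
  -- A measurable version, extended by zero to the line so that translations make sense. Its zero
  -- values at negative times agree with the zero value of the step function before its first node.
  set Z' : ℝ → V := (Set.Icc 0 T).indicator (hZ.1.mk Z) with hZ'
  have hZ'm : StronglyMeasurable Z' := hZ.1.stronglyMeasurable_mk.indicator measurableSet_Icc
  have hZ'L : MemLp Z' (ENNReal.ofReal α) volume := by
    rw [hZ', memLp_indicator_iff_restrict measurableSet_Icc]
    exact (memLp_congr_ae hZ.1.ae_eq_mk).1 hZ
  have hae : ∀ᵐ t, t ∈ Set.Icc 0 T → P t ∧ Z t = Z' t := by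
    rw [← ae_restrict_iff' measurableSet_Icc]
    filter_upwards [hP, hZ.1.ae_eq_mk, ae_restrict_mem measurableSet_Icc] with t h1 h2 h3
    exact ⟨h1, by rw [hZ', Set.indicator_of_mem h3, h2]⟩
  let Q : ℝ → Prop := fun t => t ∈ Set.Icc 0 T → P t ∧ Z t = Z' t
  have htr := tendsto_lintegral_translate hα hZ'L
  have hδ : ∀ j : ℕ, 0 < T / ((j : ℝ) + 1) := fun j => by positivity
  let η : ℕ → ℝ≥0∞ := fun j =>
    ⨆ r ∈ Set.Ioc 0 (T / ((j : ℝ) + 1)), ∫⁻ t, ‖Z' (t + r) - Z' t‖ₑ ^ α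
  have hη : Tendsto η atTop (𝓝 0) := by
    rw [ENNReal.tendsto_nhds_zero]
    intro ε hε
    obtain ⟨ρ, hρ, hball⟩ := Metric.eventually_nhds_iff.1 (ENNReal.tendsto_nhds_zero.1 htr ε hε)
    have hlim : Tendsto (fun j : ℕ => T / ((j : ℝ) + 1)) atTop (𝓝 0) :=
      tendsto_const_nhds.div_atTop (tendsto_atTop_add_const_right _ _ tendsto_natCast_atTop_atTop)
    filter_upwards [hlim.eventually (gt_mem_nhds hρ)] with j hj
    refine iSup₂_le fun r hr => hball ?_
    rw [dist_zero_right, Real.norm_of_nonneg hr.1.le]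
    exact hr.2.trans_lt hj
  have hQ : ∀ j : ℕ, ∀ᵐ τ : ℝ, ∀ k : ℕ, Q (τ + k * (T / ((j : ℝ) + 1))) := fun j => by
    rw [ae_all_iff]
    intro k
    exact (measurePreserving_add_right volume
      ((k : ℝ) * (T / ((j : ℝ) + 1)))).quasiMeasurePreserving.ae hae
  -- There are `j + 2` blocks: the `j + 1` steps, and the block ending at the first node, where the
  -- step function vanishes.
  have hex := fun j : ℕ => exists_step_offset (α := α) (hδ j) hZ'm (η := η j)
    (fun r hr => le_iSup₂_of_le r hr le_rfl) (j + 2) (hQ j)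
  choose τ hτ hτQ hτη using hex
  have hmem : ∀ j k : ℕ, k ≤ j → τ j + k * (T / (j + 1)) ∈ Set.Icc 0 T := by
    intro j k hk
    have h1 : (k : ℝ) * (T / (j + 1)) ≤ j * (T / (j + 1)) := by
      gcongr
    have h2 : (j : ℝ) * (T / (j + 1)) + T / (j + 1) = T := by field_simp
    have h3 : 0 ≤ (k : ℝ) * (T / (j + 1)) := by positivity
    exact ⟨by linarith [(hτ j).1], by linarith [(hτ j).2]⟩
  refine ⟨τ, hτ, fun j k hk => (hτQ j k (hmem j k hk)).1, ?_⟩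
  refine tendsto_of_tendsto_of_tendsto_of_le_of_le tendsto_const_nhds hη (fun _ => zero_le) ?_
  intro j
  refine le_trans ?_ (hτη j)
  set δ := T / ((j : ℝ) + 1) with hδdef
  have hδj : 0 < δ := hδ j
  have hTδ : ((j : ℝ) + 1) * δ = T := by rw [hδdef]; field_simp
  -- The block with index `0` starts at the negative time `τ j - δ`; the block with index `k + 1` is
  -- the step with index `k`.
  let S : ℕ → Set ℝ := fun k =>
    Set.Ioc (τ j + ((k : ℝ) - 1) * δ) (τ j + ((k : ℝ) - 1) * δ + δ)
  have hcover : Set.Icc 0 T ⊆ ⋃ k ∈ Finset.range (j + 2), S k := by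
    intro s hs
    have hx : 0 < (s - τ j) / δ + 1 := by
      have : -1 < (s - τ j) / δ := by
        rw [lt_div_iff₀ hδj]; linarith [hs.1, (hτ j).2]
      linarith
    obtain ⟨m, hm⟩ : ∃ m : ℕ, ⌈(s - τ j) / δ + 1⌉₊ = m + 1 :=
      ⟨_, (Nat.succ_pred_eq_of_pos (Nat.ceil_pos.2 hx)).symm⟩
    have h1 : (s - τ j) / δ + 1 ≤ m + 1 := by
      have := Nat.le_ceil ((s - τ j) / δ + 1)
      rw [hm] at this
      exact_mod_cast this
    have h2 : (m : ℝ) < (s - τ j) / δ + 1 := by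
      have := Nat.ceil_lt_add_one hx.le
      rw [hm] at this
      push_cast at this
      linarith
    have h1' : s - τ j ≤ m * δ := by
      rw [← div_le_iff₀ hδj]; linarith
    have h2' : ((m : ℝ) - 1) * δ < s - τ j := by
      rw [← lt_div_iff₀ hδj]; linarith
    simp only [Set.mem_iUnion, Finset.mem_range]
    refine ⟨m, ?_, by linarith, by linarith⟩
    by_contra! hlt
    have h3 : ((j : ℝ) + 1) ≤ m - 1 := by
      have : ((j + 2 : ℕ) : ℝ) ≤ m := by exact_mod_cast hlt
      push_cast at this
      linarith
    have h4 := mul_le_mul_of_nonneg_right h3 hδj.le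
    linarith [hs.2, (hτ j).1]
  have hpt : ∀ᵐ s, s ∈ Set.Icc 0 T → ∀ k ∈ Finset.range (j + 2), s ∈ S k →
      ‖Z s - stepFun Z δ j (τ j) s‖ₑ ^ α = ‖Z' s - Z' (τ j + ((k : ℝ) - 1) * δ)‖ₑ ^ α := by
    filter_upwards [hae] with s hs hsT k hk hsk
    rw [(hs hsT).2]
    rcases k with _ | k
    · have h1 : s ≤ τ j := by
        have := hsk.2
        push_cast at this
        linarith
      rw [stepFun_eq_zero hδj h1, hZ', Set.indicator_of_notMem (a := τ j + _)]
      rintro ⟨h, -⟩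
      push_cast at h
      linarith [(hτ j).2]
    · have hk' : k ≤ j := by have := Finset.mem_range.1 hk; omega
      have e : (((k + 1 : ℕ) : ℝ) - 1) = k := by push_cast; ring
      simp only [S, e] at hsk
      rw [stepFun_eq hδj hk' ⟨hsk.1, by linarith [hsk.2]⟩, e, (hτQ j k (hmem j k hk')).2]
  have hpt' : ∀ᵐ s ∂timeMeasure T, ‖Z s - stepFun Z δ j (τ j) s‖ₑ ^ α ≤
      ∑ k ∈ Finset.range (j + 2),
        (S k).indicator (fun s => ‖Z' s - Z' (τ j + ((k : ℝ) - 1) * δ)‖ₑ ^ α) s := by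
    refine (ae_restrict_iff' measurableSet_Icc).2 ?_
    filter_upwards [hpt] with s hs hsT
    obtain ⟨k, hk⟩ := Set.mem_iUnion.1 (hcover hsT)
    obtain ⟨hk, hsk⟩ := Set.mem_iUnion.1 hk
    rw [hs hsT k hk hsk]
    refine le_trans ?_ (Finset.single_le_sum (f := fun k => (S k).indicator
      (fun s => ‖Z' s - Z' (τ j + ((k : ℝ) - 1) * δ)‖ₑ ^ α) s) (fun _ _ => zero_le) hk)
    rw [Set.indicator_of_mem hsk]
  have hm : ∀ k : ℕ, Measurable fun s => ‖Z' s - Z' (τ j + ((k : ℝ) - 1) * δ)‖ₑ ^ α := fun k =>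
    ((hZ'm.sub stronglyMeasurable_const).enorm).pow_const α
  calc ∫⁻ s, ‖Z s - stepFun Z δ j (τ j) s‖ₑ ^ α ∂timeMeasure T
      ≤ ∫⁻ s, ∑ k ∈ Finset.range (j + 2),
        (S k).indicator (fun s => ‖Z' s - Z' (τ j + ((k : ℝ) - 1) * δ)‖ₑ ^ α) s ∂timeMeasure T :=
        lintegral_mono_ae hpt'
    _ ≤ ∫⁻ s, ∑ k ∈ Finset.range (j + 2),
        (S k).indicator (fun s => ‖Z' s - Z' (τ j + ((k : ℝ) - 1) * δ)‖ₑ ^ α) s :=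
        setLIntegral_le_lintegral _ _
    _ = ∑ k ∈ Finset.range (j + 2), ∫⁻ s,
        (S k).indicator (fun s => ‖Z' s - Z' (τ j + ((k : ℝ) - 1) * δ)‖ₑ ^ α) s :=
        lintegral_finsetSum _ fun k _ => (hm k).indicator measurableSet_Ioc
    _ = ∑ k ∈ Finset.range (j + 2), ∫⁻ r in Set.Ioc 0 δ,
      ‖Z' (τ j + ((k : ℝ) - 1) * δ + r) - Z' (τ j + ((k : ℝ) - 1) * δ)‖ₑ ^ α := by
        refine Finset.sum_congr rfl fun k _ => ?_
        rw [lintegral_indicator measurableSet_Ioc]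
        have h2 := (measurePreserving_add_left volume
          (τ j + ((k : ℝ) - 1) * δ)).setLIntegral_comp_preimage_emb
          (measurableEmbedding_addLeft _)
          (fun s => ‖Z' s - Z' (τ j + ((k : ℝ) - 1) * δ)‖ₑ ^ α) (S k)
        rw [← h2]
        congr 2
        ext x
        simp only [S, Set.mem_preimage, Set.mem_Ioc]
        constructor <;> rintro ⟨ha, hb⟩ <;> constructor <;> linarith

theorem stronglyMeasurable_stepFun (Z : ℝ → V) (δ : ℝ) (j : ℕ) (τ : ℝ) :
    StronglyMeasurable (stepFun Z δ j τ) := by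
  unfold stepFun
  exact Finset.stronglyMeasurable_fun_sum _ fun k _ =>
    stronglyMeasurable_const.indicator measurableSet_Ioc

theorem memLp_stepFun (Z : ℝ → V) (δ : ℝ) (j : ℕ) (τ T : ℝ) (p : ℝ≥0∞) :
    MemLp (stepFun Z δ j τ) p (timeMeasure T) := by
  have : IsFiniteMeasure (timeMeasure T) := by unfold timeMeasure; infer_instance
  unfold stepFun
  exact memLp_finsetSum _ fun k _ => (memLp_const _).indicator measurableSet_Ioc

theorem exists_mem_Ioc_step {δ τ s T : ℝ} (hδ : 0 < δ) {j : ℕ} (hτ : 0 < τ)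
    (hT : (j + 1) * δ = T) (hs : s ∈ Set.Ioc τ T) :
    ∃ k ≤ j, s ∈ Set.Ioc (τ + k * δ) (τ + (k + 1) * δ) := by
  have hx : 0 < (s - τ) / δ := div_pos (by linarith [hs.1]) hδ
  obtain ⟨m, hm⟩ : ∃ m : ℕ, ⌈(s - τ) / δ⌉₊ = m + 1 :=
    ⟨_, (Nat.succ_pred_eq_of_pos (Nat.ceil_pos.2 hx)).symm⟩
  have h1 : (s - τ) / δ ≤ m + 1 := by
    have := Nat.le_ceil ((s - τ) / δ)
    rw [hm] at this
    exact_mod_cast this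
  have h2 : (m : ℝ) < (s - τ) / δ := by
    have := Nat.ceil_lt_add_one hx.le
    rw [hm] at this
    push_cast at this
    linarith
  rw [div_le_iff₀ hδ] at h1
  rw [lt_div_iff₀ hδ] at h2
  refine ⟨m, ?_, by linarith, by linarith⟩
  by_contra! hlt
  have h3 : ((j : ℝ) + 1) ≤ m := by exact_mod_cast hlt
  have h4 := mul_le_mul_of_nonneg_right h3 hδ.le
  linarith [hs.2]

end Step

/-! ### Pairings of functionals with paths, and their integrals. -/

section Energy

theorem integral_timeMeasure {E : Type*} [NormedAddCommGroup E] [NormedSpace ℝ E] {T : ℝ}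
    (hT : 0 ≤ T) (g : ℝ → E) : ∫ s, g s ∂timeMeasure T = ∫ s in (0 : ℝ)..T, g s := by
  rw [intervalIntegral.integral_of_le hT, timeMeasure, integral_Icc_eq_integral_Ioc]

theorem intervalIntegrable_of_timeMeasure {E : Type*} [NormedAddCommGroup E] {T : ℝ} {g : ℝ → E}
    (hg : Integrable g (timeMeasure T)) {r t : ℝ} (hr : r ∈ Set.Icc 0 T) (ht : t ∈ Set.Icc 0 T) :
    IntervalIntegrable g volume r t := by
  have h1 : IntegrableOn g (Set.Icc 0 T) volume := hg
  exact (h1.mono_set (Set.uIcc_subset_Icc hr ht)).intervalIntegrable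

theorem ae_timeMeasure_iff {T : ℝ} {P : ℝ → Prop} :
    (∀ᵐ t ∂timeMeasure T, P t) ↔ ∀ᵐ t, t ∈ Set.Icc 0 T → P t :=
  ae_restrict_iff' measurableSet_Icc

variable {V H : Type*} [NormedAddCommGroup V] [NormedSpace ℝ V]
  [NormedAddCommGroup H] [InnerProductSpace ℝ H]

theorem aestronglyMeasurable_dual_apply {μ : Measure ℝ} {a : ℝ → StrongDual ℝ V} {Z : ℝ → V}
    (ha : AEStronglyMeasurable a μ) (hZ : AEStronglyMeasurable Z μ) :
    AEStronglyMeasurable (fun s => a s (Z s)) μ :=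
  (isBoundedBilinearMap_apply (𝕜 := ℝ) (E := V) (F := ℝ)).continuous.comp_aestronglyMeasurable
    (ha.prodMk hZ)

/-- Hölder's inequality for the duality pairing. -/
theorem lintegral_dual_apply_le {μ : Measure ℝ} {α q : ℝ} (hq : q.HolderConjugate α)
    {a : ℝ → StrongDual ℝ V} {Z : ℝ → V} (ha : AEStronglyMeasurable a μ)
    (hZ : AEStronglyMeasurable Z μ) :
    ∫⁻ s, ‖a s (Z s)‖ₑ ∂μ ≤
      (∫⁻ s, ‖a s‖ₑ ^ q ∂μ) ^ (1 / q) * (∫⁻ s, ‖Z s‖ₑ ^ α ∂μ) ^ (1 / α) := by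
  refine le_trans (lintegral_mono fun s => ?_)
    (ENNReal.lintegral_mul_le_Lp_mul_Lq μ hq ha.enorm hZ.enorm)
  exact (a s).le_opENorm (Z s)

theorem lintegral_rpow_lt_top_of_memLp {μ : Measure ℝ} {α : ℝ} (hα : 0 < α) {E : Type*}
    [NormedAddCommGroup E] {Z : ℝ → E} (hZ : MemLp Z (ENNReal.ofReal α) μ) :
    ∫⁻ s, ‖Z s‖ₑ ^ α ∂μ < ∞ := by
  have := lintegral_rpow_enorm_lt_top_of_eLpNorm_lt_top (by simpa using hα) ENNReal.ofReal_ne_top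
    hZ.2
  rwa [ENNReal.toReal_ofReal hα.le] at this

theorem integrable_dual_apply {μ : Measure ℝ} {α q : ℝ} (hq : q.HolderConjugate α)
    {a : ℝ → StrongDual ℝ V} {Z : ℝ → V} (ha : AEStronglyMeasurable a μ)
    (haq : ∫⁻ s, ‖a s‖ₑ ^ q ∂μ < ∞) (hZ : MemLp Z (ENNReal.ofReal α) μ) :
    Integrable (fun s => a s (Z s)) μ := by
  refine ⟨aestronglyMeasurable_dual_apply ha hZ.1, ?_⟩
  refine (lintegral_dual_apply_le hq ha hZ.1).trans_lt (ENNReal.mul_lt_top ?_ ?_)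
  · exact ENNReal.rpow_lt_top_of_nonneg (one_div_nonneg.2 hq.nonneg) haq.ne
  · exact ENNReal.rpow_lt_top_of_nonneg (one_div_nonneg.2 hq.symm.nonneg)
      (lintegral_rpow_lt_top_of_memLp hq.symm.pos hZ).ne

/-- The integral of a functional against a step function. -/
theorem integral_apply_stepFun {T : ℝ} (hT : 0 < T) (j : ℕ) {τ : ℝ}
    (hτ : τ ∈ Set.Ioo 0 (T / (j + 1))) (Z : ℝ → V) {c : ℝ → StrongDual ℝ V}
    (hc : ∀ v, Integrable (fun s => c s v) (timeMeasure T)) :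
    ∫ s in (0 : ℝ)..T, c s (stepFun Z (T / (j + 1)) j τ s) =
      ∑ k ∈ Finset.range (j + 1), ∫ s in (min (τ + k * (T / (j + 1))) T)..
        (min (τ + (k + 1 : ℕ) * (T / (j + 1))) T), c s (Z (τ + k * (T / (j + 1)))) := by
  set δ := T / ((j : ℝ) + 1) with hδdef
  have hδ : 0 < δ := by positivity
  have hTδ : ((j : ℝ) + 1) * δ = T := by rw [hδdef]; field_simp
  -- The last step would overshoot `T`; truncation makes the final node exactly `T` and leaves the
  -- nodes with index at most `j` unchanged.
  let p : ℕ → ℝ := fun k => min (τ + k * δ) T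
  have hp0 : p 0 = τ := by
    simp only [p, Nat.cast_zero, zero_mul, add_zero]
    refine min_eq_left (hτ.2.le.trans ?_)
    have : 0 ≤ (j : ℝ) * δ := by positivity
    linarith
  have hpj : p (j + 1) = T := by
    simp only [p]
    refine min_eq_right ?_
    push_cast
    linarith [hτ.1]
  have hpmem : ∀ k, p k ∈ Set.Icc 0 T := fun k => by
    have : 0 ≤ (k : ℝ) * δ := by positivity
    exact ⟨le_min (by linarith [hτ.1]) hT.le, min_le_right _ _⟩
  have hpk : ∀ k ≤ j, p k = τ + k * δ := fun k hk => by
    refine min_eq_left ?_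
    have h1 : (k : ℝ) * δ ≤ j * δ := by gcongr
    linarith [hτ.2]
  have hpm : Monotone p := fun k i hki => by
    simp only [p]
    gcongr
  have hstep : ∀ k ≤ j, ∀ s ∈ Set.Ioc (p k) (p (k + 1)), stepFun Z δ j τ s = Z (τ + k * δ) := by
    intro k hk s hs
    refine stepFun_eq hδ hk ⟨(hpk k hk).symm.trans_lt hs.1, hs.2.trans ((min_le_left _ _).trans ?_)⟩
    push_cast
    linarith
  have hci : ∀ v, ∀ r ∈ Set.Icc 0 T, ∀ t ∈ Set.Icc 0 T,
      IntervalIntegrable (fun s => c s v) volume r t := fun v r hr t ht =>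
    intervalIntegrable_of_timeMeasure (hc v) hr ht
  have hii : ∀ k < j + 1, IntervalIntegrable (fun s => c s (stepFun Z δ j τ s)) volume (p k)
      (p (k + 1)) := by
    intro k hk
    refine (hci (Z (τ + k * δ)) _ (hpmem k) _ (hpmem (k + 1))).congr ?_
    rw [Set.uIoc_of_le (hpm k.le_succ)]
    refine fun s hs => ?_
    simp only [hstep k (by omega) s hs]
  have h0 : Set.EqOn (fun s => c s (stepFun Z δ j τ s)) (fun _ => (0 : ℝ)) (Set.uIcc 0 τ) := by
    intro s hs
    rw [Set.uIcc_of_le hτ.1.le] at hs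
    simp only [stepFun_eq_zero hδ hs.2, map_zero]
  have hsum := intervalIntegral.sum_integral_adjacent_intervals (a := p) (n := j + 1) hii
  rw [hp0, hpj] at hsum
  have hi0 : IntervalIntegrable (fun s => c s (stepFun Z δ j τ s)) volume 0 τ :=
    (intervalIntegrable_const (c := (0 : ℝ))).congr (fun s hs => (h0 (Set.uIoc_subset_uIcc hs)).symm)
  have hi1 : IntervalIntegrable (fun s => c s (stepFun Z δ j τ s)) volume τ T := by
    have := IntervalIntegrable.trans_iterate hii
    rwa [hp0, hpj] at this
  rw [← intervalIntegral.integral_add_adjacent_intervals hi0 hi1,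
    intervalIntegral.integral_congr h0, intervalIntegral.integral_zero, zero_add, ← hsum]
  refine Finset.sum_congr rfl fun k hk => ?_
  refine intervalIntegral.integral_congr_ae (Eventually.of_forall fun s hs => ?_)
  rw [Set.uIoc_of_le (hpm k.le_succ)] at hs
  rw [hstep k (by have := Finset.mem_range.1 hk; omega) s hs]

end Energy

/-! ### The upper energy bound for weakly converging derivatives. -/

section Energy

variable {V H : Type*} [NormedAddCommGroup V] [NormedSpace ℝ V]
  [NormedAddCommGroup H] [InnerProductSpace ℝ H]

/-- The two sides differ by `½ ‖y - x‖²`. Telescoped over a partition, this is the source of the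
one-sided energy bound, and the reason for sampling at left endpoints. -/
theorem inner_sub_le_half_sq (x y : H) :
    inner ℝ (y - x) x ≤ 1 / 2 * (‖y‖ ^ 2 - ‖x‖ ^ 2) := by
  have h := norm_sub_sq_real y x
  rw [inner_sub_left, real_inner_self_eq_norm_sq]
  nlinarith [sq_nonneg ‖y - x‖]

theorem tendsto_step_size (T : ℝ) : Tendsto (fun j : ℕ => T / ((j : ℝ) + 1)) atTop (𝓝 0) :=
  tendsto_const_nhds.div_atTop (tendsto_atTop_add_const_right _ _ tendsto_natCast_atTop_atTop)

/-- At each `s > 0` the step function eventually takes the value of `X` at a node tending to `s`.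
Paired with the fixed vector `b s`, weak continuity of `X` suffices, and `‖b s‖ M` dominates. -/
theorem tendsto_integral_inner_stepFun {ι : V →L[ℝ] H} {T : ℝ} (hT : 0 < T) {X : ℝ → H} {Z : ℝ → V}
    {M : ℝ} (hM : ∀ t ∈ Set.Icc 0 T, ‖X t‖ ≤ M)
    (hXc : ∀ z : H, ContinuousOn (fun t => inner ℝ z (X t)) (Set.Icc 0 T))
    {b : ℝ → H} (hb : Integrable b (timeMeasure T)) {τ : ℕ → ℝ}
    (hτ : ∀ j : ℕ, τ j ∈ Set.Ioo 0 (T / (j + 1)))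
    (hZX : ∀ j k : ℕ, k ≤ j → ι (Z (τ j + k * (T / (j + 1)))) = X (τ j + k * (T / (j + 1)))) :
    Tendsto (fun j : ℕ => ∫ s in (0 : ℝ)..T, inner ℝ (b s) (ι (stepFun Z (T / (j + 1)) j (τ j) s)))
      atTop (𝓝 (∫ s in (0 : ℝ)..T, inner ℝ (b s) (X s))) := by
  have hM0 : 0 ≤ M := (norm_nonneg _).trans (hM 0 ⟨le_rfl, hT.le⟩)
  have hTδ : ∀ j : ℕ, ((j : ℝ) + 1) * (T / (j + 1)) = T := fun j => by field_simp
  have hδ : ∀ j : ℕ, 0 < T / ((j : ℝ) + 1) := fun j => by positivity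
  have hval : ∀ j : ℕ, ∀ s ∈ Set.Ioc (τ j) T, ∃ t ∈ Set.Icc 0 T, |t - s| ≤ T / (j + 1) ∧
      ι (stepFun Z (T / (j + 1)) j (τ j) s) = X t := by
    intro j s hs
    obtain ⟨k, hk, hsk⟩ := exists_mem_Ioc_step (hδ j) (hτ j).1 (hTδ j) hs
    have h0 : 0 ≤ (k : ℝ) * (T / (j + 1)) := by positivity
    refine ⟨τ j + k * (T / (j + 1)), ⟨by linarith [(hτ j).1], hsk.1.le.trans hs.2⟩, ?_, ?_⟩
    · rw [abs_le]; constructor <;> linarith [hsk.1, hsk.2, hδ j]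
    · rw [stepFun_eq (hδ j) hk hsk, hZX j k hk]
  simp only [← integral_timeMeasure hT.le]
  refine tendsto_integral_of_dominated_convergence (fun s => ‖b s‖ * M) ?_ (hb.norm.mul_const M)
    ?_ ?_
  · intro j
    exact hb.1.inner (ι.continuous.comp_stronglyMeasurable
      (stronglyMeasurable_stepFun Z _ j (τ j))).aestronglyMeasurable
  · intro j
    refine ae_timeMeasure_iff.2 (Eventually.of_forall fun s hs => ?_)
    refine (norm_inner_le_norm _ _).trans (mul_le_mul_of_nonneg_left ?_ (norm_nonneg _))
    rcases le_or_gt s (τ j) with h | h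
    · rw [stepFun_eq_zero (hδ j) h, map_zero, norm_zero]; exact hM0
    · obtain ⟨t, ht, -, he⟩ := hval j s ⟨h, hs.2⟩
      rw [he]; exact hM t ht
  · have hne : ∀ᵐ s : ℝ, s ≠ 0 := by simp [ae_iff]
    refine ae_timeMeasure_iff.2 ?_
    filter_upwards [hne] with s hs0 hs
    have hspos : 0 < s := lt_of_le_of_ne hs.1 hs0.symm
    rw [Metric.tendsto_atTop']
    intro ε hε
    obtain ⟨ρ, hρ, hball⟩ := Metric.continuousOn_iff.1 (hXc (b s)) s hs ε hε
    have hev := (tendsto_step_size T).eventually (gt_mem_nhds (lt_min hρ hspos))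
    obtain ⟨N, hN⟩ := eventually_atTop.1 hev
    refine ⟨N, fun j hj => ?_⟩
    have hj' := hN j hj.le
    obtain ⟨t, ht, hts, he⟩ := hval j s
      ⟨(hτ j).2.trans (hj'.trans_le (min_le_right _ _)), hs.2⟩
    rw [he]
    refine hball t ht ?_
    rw [Real.dist_eq]
    exact hts.trans_lt (hj'.trans_le (min_le_left _ _))

/-- If the functionals `aₙ`, bounded in `L^q(0, T; V*)`, converge in the weak sense to the
derivative of `X` up to an integrable perturbation `b`, then the limit of the pairings with `X` is
bounded by the increment of the energy. -/
theorem eventually_integral_apply_le {ι : V →L[ℝ] H} {T α q : ℝ} (hT : 0 < T)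
    (hq : q.HolderConjugate α) {X : ℝ → H} {Z : ℝ → V}
    (hZ : MemLp Z (ENNReal.ofReal α) (timeMeasure T)) (hZX : ∀ᵐ t ∂timeMeasure T, ι (Z t) = X t)
    {M : ℝ} (hM : ∀ t ∈ Set.Icc 0 T, ‖X t‖ ≤ M)
    (hXc : ∀ z : H, ContinuousOn (fun t => inner ℝ z (X t)) (Set.Icc 0 T))
    {b : ℝ → H} (hb : Integrable b (timeMeasure T)) {a : ℕ → ℝ → StrongDual ℝ V}
    (ham : ∀ n, AEStronglyMeasurable (a n) (timeMeasure T)) {C : ℝ≥0∞} (hC : C ≠ ∞)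
    (haC : ∀ n, ∫⁻ s, ‖a n s‖ₑ ^ q ∂timeMeasure T ≤ C)
    (hlim : ∀ v, ∀ r ∈ Set.Icc 0 T, ∀ t ∈ Set.Icc 0 T, r ≤ t →
      Tendsto (fun n => ∫ s in r..t, a n s v) atTop
        (𝓝 (inner ℝ (X t - X r) (ι v) - ∫ s in r..t, inner ℝ (b s) (ι v))))
    {ε : ℝ} (hε : 0 < ε) :
    ∀ᶠ n in atTop, ∫ s in (0 : ℝ)..T, a n s (Z s) ≤
      1 / 2 * (‖X T‖ ^ 2 - ‖X 0‖ ^ 2) - (∫ s in (0 : ℝ)..T, inner ℝ (b s) (X s)) + ε := by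
  have hα : 1 < α := hq.symm.lt
  have hα0 : 0 < α := hq.symm.pos
  obtain ⟨τ, hτ, hτP, hstep⟩ := exists_stepFun_tendsto hα hT hZ hZX
  have h0T : (0 : ℝ) ∈ Set.Icc 0 T := ⟨le_rfl, hT.le⟩
  have hτT : ∀ j, τ j ∈ Set.Icc 0 T := fun j => ⟨(hτ j).1.le, (hτ j).2.le.trans (by
    rw [div_le_iff₀ (by positivity)]
    have : 0 ≤ T * j := by positivity
    linarith)⟩
  have hτ0 : Tendsto τ atTop (𝓝[Set.Icc 0 T] 0) := by
    refine tendsto_nhdsWithin_iff.2 ⟨?_, Eventually.of_forall hτT⟩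
    exact squeeze_zero (fun j => (hτ j).1.le) (fun j => (hτ j).2.le) (tendsto_step_size T)
  have hac : ∀ n v, Integrable (fun s => a n s v) (timeMeasure T) := fun n v => by
    have : IsFiniteMeasure (timeMeasure T) := by unfold timeMeasure; infer_instance
    exact integrable_dual_apply hq (ham n) ((haC n).trans_lt hC.lt_top) (memLp_const v)
  have hbc : ∀ v, Integrable (fun s => toDual ι (b s) v) (timeMeasure T) := fun v =>
    hb.inner_const (ι v)
  -- the error of the step approximation
  have hE : Tendsto (fun j : ℕ => C ^ (1 / q) * (∫⁻ s, ‖Z s - stepFun Z (T / (j + 1)) j (τ j) s‖ₑ ^ α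
      ∂timeMeasure T) ^ (1 / α)) atTop (𝓝 0) := by
    have h1 := ((ENNReal.continuous_rpow_const (y := 1 / α)).tendsto 0).comp hstep
    rw [ENNReal.zero_rpow_of_pos (by positivity)] at h1
    have h2 := ENNReal.Tendsto.const_mul h1 (a := C ^ (1 / q))
      (Or.inr (ENNReal.rpow_ne_top_of_nonneg (one_div_nonneg.2 hq.nonneg) hC))
    simpa [Function.comp_def] using h2
  have hE' := ENNReal.tendsto_nhds_zero.1 hE (ENNReal.ofReal (ε / 4))
    (ENNReal.ofReal_pos.2 (by positivity))
  -- the limit of the perturbation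
  have hB := (tendsto_integral_inner_stepFun hT hM hXc hb hτ hτP).eventually
    (lt_mem_nhds (show (∫ s in (0 : ℝ)..T, inner ℝ (b s) (X s)) - ε / 4 < _ by linarith))
  -- lower semicontinuity at the initial time
  have hX0 : ∀ᶠ j in atTop, ‖X 0‖ ^ 2 - ε / 4 < ‖X (τ j)‖ ^ 2 := by
    have h1 : Tendsto (fun j => inner ℝ (X 0) (X (τ j))) atTop (𝓝 (inner ℝ (X 0) (X 0))) :=
      (hXc (X 0) 0 h0T).tendsto.comp hτ0
    rw [real_inner_self_eq_norm_sq] at h1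
    filter_upwards [h1.eventually (lt_mem_nhds (show ‖X 0‖ ^ 2 - ε / 8 < ‖X 0‖ ^ 2 by linarith))]
      with j hj
    have h2 := norm_sub_sq_real (X 0) (X (τ j))
    nlinarith [sq_nonneg ‖X 0 - X (τ j)‖]
  -- One partition with all three errors within `ε / 4` is fixed before `n` tends to infinity. The
  -- error of the step approximation is uniform in `n`, so the limit of `a n` is needed only against
  -- fixed vectors between fixed times.
  obtain ⟨j, hjE, hjB, hjX⟩ := (hE'.and (hB.and hX0)).exists
  set δ := T / ((j : ℝ) + 1) with hδdef
  have hδ : 0 < δ := by positivity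
  have hTδ : ((j : ℝ) + 1) * δ = T := by rw [hδdef]; field_simp
  set L := stepFun Z δ j (τ j) with hL
  let p : ℕ → ℝ := fun k => min (τ j + k * δ) T
  have hp0 : p 0 = τ j := by simp [p, (hτT j).2]
  have hpj : p (j + 1) = T := by
    simp only [p]
    refine min_eq_right ?_
    push_cast
    linarith [(hτ j).1]
  have hpmem : ∀ k, p k ∈ Set.Icc 0 T := fun k => by
    have : 0 ≤ (k : ℝ) * δ := by positivity
    exact ⟨le_min (by linarith [(hτ j).1]) hT.le, min_le_right _ _⟩
  have hpm : Monotone p := fun k i hki => by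
    simp only [p]
    gcongr
  have hpk : ∀ k ≤ j, p k = τ j + k * δ := fun k hk => by
    refine min_eq_left ?_
    have h1 : (k : ℝ) * δ ≤ j * δ := by gcongr
    linarith [(hτ j).2]
  have hb_step := integral_apply_stepFun hT j (hτ j) Z (c := fun s => toDual ι (b s)) hbc
  have hlimL : Tendsto (fun n => ∫ s in (0 : ℝ)..T, a n s (L s)) atTop
      (𝓝 ((∑ k ∈ Finset.range (j + 1), inner ℝ (X (p (k + 1)) - X (p k)) (X (p k))) -
        ∫ s in (0 : ℝ)..T, inner ℝ (b s) (ι (L s)))) := by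
    have e1 : ∫ s in (0 : ℝ)..T, inner ℝ (b s) (ι (L s)) = _ := hb_step
    rw [e1, ← Finset.sum_sub_distrib]
    refine Tendsto.congr (fun n => (integral_apply_stepFun hT j (hτ j) Z (hac n)).symm) ?_
    refine tendsto_finsetSum _ fun k hk => ?_
    have hk' : k ≤ j := by have := Finset.mem_range.1 hk; omega
    have h1 := hlim (Z (τ j + k * δ)) (p k) (hpmem k) (p (k + 1)) (hpmem (k + 1)) (hpm k.le_succ)
    have e2 : ι (Z (τ j + k * δ)) = X (p k) := by rw [hpk k hk']; exact hτP j k hk'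
    simp only [← e2] at h1 ⊢
    exact h1
  have hsum : ∑ k ∈ Finset.range (j + 1), inner ℝ (X (p (k + 1)) - X (p k)) (X (p k)) ≤
      1 / 2 * (‖X T‖ ^ 2 - ‖X (τ j)‖ ^ 2) := by
    calc _ ≤ ∑ k ∈ Finset.range (j + 1), 1 / 2 * (‖X (p (k + 1))‖ ^ 2 - ‖X (p k)‖ ^ 2) :=
          Finset.sum_le_sum fun k _ => inner_sub_le_half_sq _ _
      _ = _ := by
          rw [← Finset.mul_sum, Finset.sum_range_sub (fun k => ‖X (p k)‖ ^ 2), hp0, hpj]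
  filter_upwards [hlimL.eventually (gt_mem_nhds (lt_add_of_pos_right _
    (show 0 < ε / 4 by positivity)))] with n hn
  have hLp : MemLp L (ENNReal.ofReal α) (timeMeasure T) := memLp_stepFun _ _ _ _ _ _
  have haq := (haC n).trans_lt hC.lt_top
  have hi1 := integrable_dual_apply hq (ham n) haq hLp
  have hi2 := integrable_dual_apply hq (ham n) haq (hZ.sub hLp)
  have hsplit : ∫ s in (0 : ℝ)..T, a n s (Z s) =
      (∫ s in (0 : ℝ)..T, a n s (L s)) + ∫ s in (0 : ℝ)..T, a n s ((Z - L) s) := by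
    simp only [← integral_timeMeasure hT.le]
    rw [← integral_add hi1 hi2]
    simp
  have herr : ∫ s in (0 : ℝ)..T, a n s ((Z - L) s) ≤ ε / 4 := by
    rw [← integral_timeMeasure hT.le]
    refine (le_abs_self _).trans ?_
    rw [← Real.norm_eq_abs, ← toReal_enorm]
    refine ENNReal.toReal_le_of_le_ofReal (by positivity) ?_
    refine (enorm_integral_le_lintegral_enorm _).trans ?_
    refine (lintegral_dual_apply_le hq (ham n) (hZ.sub hLp).1).trans (le_trans ?_ hjE)
    gcongr
    · exact one_div_nonneg.2 hq.nonneg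
    · exact haC n
    · rfl
  rw [hsplit]
  linarith

end Energy

/-! ### The energy identity and Grönwall's inequality. -/

section EnergyIdentity

variable {V H : Type*} [NormedAddCommGroup V] [NormedSpace ℝ V]
  [NormedAddCommGroup H] [InnerProductSpace ℝ H]

theorem timeMeasure_mono {t T : ℝ} (h : t ≤ T) : timeMeasure t ≤ timeMeasure T :=
  Measure.restrict_mono (Set.Icc_subset_Icc_right h) le_rfl

theorem continuousOn_primitive_timeMeasure {E : Type*} [NormedAddCommGroup E] [NormedSpace ℝ E]
    {T : ℝ} {g : ℝ → E} (hg : Integrable g (timeMeasure T)) :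
    ContinuousOn (fun t => ∫ s in (0 : ℝ)..t, g s) (Set.Icc 0 T) := by
  have h : IntegrableOn g (Set.Icc 0 T) volume := hg
  refine (intervalIntegral.continuousOn_primitive h).congr fun t ht => ?_
  exact intervalIntegral.integral_of_le ht.1

theorem measurePreserving_reverse (t : ℝ) :
    MeasurePreserving (fun s => t - s) (timeMeasure t) (timeMeasure t) := by
  have h := ((volume : Measure ℝ).measurePreserving_sub_left t).restrict_preimage
    (s := Set.Icc 0 t) measurableSet_Icc
  have e : (fun s => t - s) ⁻¹' Set.Icc 0 t = Set.Icc 0 t := by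
    ext s
    simp only [Set.mem_preimage, Set.mem_Icc]
    constructor <;> rintro ⟨h1, h2⟩ <;> constructor <;> linarith
  rw [e] at h
  exact h

/-- A bounded function whose inner products with a dense subspace are continuous is weakly
continuous. -/
theorem continuousOn_inner_of_denseRange {J : Type*} {d : J → H} (hd : DenseRange d) {S : Set ℝ}
    {X : ℝ → H} {M : ℝ} (hM : ∀ t ∈ S, ‖X t‖ ≤ M)
    (hX : ∀ v, ContinuousOn (fun t => inner ℝ (d v) (X t)) S) (z : H) :
    ContinuousOn (fun t => inner ℝ z (X t)) S := by
  rcases S.eq_empty_or_nonempty with rfl | ⟨t₀, ht₀⟩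
  · exact continuousOn_empty _
  have hM0 : 0 ≤ M := (norm_nonneg _).trans (hM t₀ ht₀)
  refine continuousOn_of_uniform_approx_of_continuousOn fun u hu => ?_
  obtain ⟨ε, hε, hεu⟩ := Metric.mem_uniformity_dist.1 hu
  obtain ⟨_, hb, ⟨v, rfl⟩⟩ := Metric.dense_iff.1 hd z (ε / (M + 1)) (by positivity)
  refine ⟨_, hX v, fun t ht => hεu ?_⟩
  rw [Real.dist_eq, ← inner_sub_left]
  calc |inner ℝ (z - d v) (X t)| ≤ ‖z - d v‖ * ‖X t‖ := abs_real_inner_le_norm _ _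
    _ ≤ ‖z - d v‖ * M := by gcongr; exact hM t ht
    _ ≤ ε / (M + 1) * M := by
      gcongr
      rw [← dist_eq_norm, dist_comm]; exact (Metric.mem_ball.1 hb).le
    _ < ε := by rw [div_mul_eq_mul_div, div_lt_iff₀ (by positivity)]; nlinarith

theorem integral_apply_le_energy {ι : V →L[ℝ] H} {T α q : ℝ} (hT : 0 < T)
    (hq : q.HolderConjugate α) {X : ℝ → H} {Z : ℝ → V}
    (hZ : MemLp Z (ENNReal.ofReal α) (timeMeasure T)) (hZX : ∀ᵐ t ∂timeMeasure T, ι (Z t) = X t)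
    {M : ℝ} (hM : ∀ t ∈ Set.Icc 0 T, ‖X t‖ ≤ M)
    (hXc : ∀ z : H, ContinuousOn (fun t => inner ℝ z (X t)) (Set.Icc 0 T))
    {b : ℝ → H} (hb : Integrable b (timeMeasure T)) {a : ℝ → StrongDual ℝ V}
    (ham : AEStronglyMeasurable a (timeMeasure T)) (haq : ∫⁻ s, ‖a s‖ₑ ^ q ∂timeMeasure T < ∞)
    (heq : ∀ v, ∀ r ∈ Set.Icc 0 T, ∀ t ∈ Set.Icc 0 T, r ≤ t →
      inner ℝ (X t - X r) (ι v) = (∫ s in r..t, a s v) + ∫ s in r..t, inner ℝ (b s) (ι v)) :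
    ∫ s in (0 : ℝ)..T, a s (Z s) ≤
      1 / 2 * (‖X T‖ ^ 2 - ‖X 0‖ ^ 2) - ∫ s in (0 : ℝ)..T, inner ℝ (b s) (X s) := by
  refine le_of_forall_pos_le_add fun ε hε => ?_
  obtain ⟨n, hn⟩ := (eventually_integral_apply_le hT hq hZ hZX hM hXc hb (a := fun _ => a)
    (fun _ => ham) haq.ne (fun _ => le_rfl) (fun v r hr t ht hrt => by
      rw [heq v r hr t ht hrt, add_sub_cancel_right]
      exact tendsto_const_nhds) hε).exists
  exact hn

/-- The upper bound for `∫⟨a, Z⟩` gives one inequality. The reversed path `X (T - s)` solves the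
equation with the signs of `a` and `b` changed, and the same bound for it is the opposite
inequality. -/
theorem energy_identity_aux {ι : V →L[ℝ] H} {T α q : ℝ} (hT : 0 < T)
    (hq : q.HolderConjugate α) {X : ℝ → H} {Z : ℝ → V}
    (hZ : MemLp Z (ENNReal.ofReal α) (timeMeasure T)) (hZX : ∀ᵐ t ∂timeMeasure T, ι (Z t) = X t)
    {M : ℝ} (hM : ∀ t ∈ Set.Icc 0 T, ‖X t‖ ≤ M)
    (hXc : ∀ z : H, ContinuousOn (fun t => inner ℝ z (X t)) (Set.Icc 0 T))
    {b : ℝ → H} (hb : Integrable b (timeMeasure T)) {a : ℝ → StrongDual ℝ V}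
    (ham : AEStronglyMeasurable a (timeMeasure T)) (haq : ∫⁻ s, ‖a s‖ₑ ^ q ∂timeMeasure T < ∞)
    (heq : ∀ v, ∀ r ∈ Set.Icc 0 T, ∀ t ∈ Set.Icc 0 T, r ≤ t →
      inner ℝ (X t - X r) (ι v) = (∫ s in r..t, a s v) + ∫ s in r..t, inner ℝ (b s) (ι v)) :
    ‖X T‖ ^ 2 = ‖X 0‖ ^ 2 + 2 * (∫ s in (0 : ℝ)..T, a s (Z s)) +
      2 * ∫ s in (0 : ℝ)..T, inner ℝ (b s) (X s) := by
  have h1 := integral_apply_le_energy hT hq hZ hZX hM hXc hb ham haq heq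
  have hmp := measurePreserving_reverse T
  have hmap : Set.MapsTo (fun s => T - s) (Set.Icc 0 T) (Set.Icc 0 T) := fun s hs =>
    ⟨by linarith [hs.2], by linarith [hs.1]⟩
  have hemb : MeasurableEmbedding fun s : ℝ => T - s :=
    (MeasurableEquiv.subLeft T).measurableEmbedding
  have h2 := integral_apply_le_energy (X := fun s => X (T - s)) (Z := fun s => Z (T - s))
    (b := fun s => - b (T - s)) (a := fun s => - a (T - s)) hT hq (hZ.comp_measurePreserving hmp)
    (hmp.quasiMeasurePreserving.ae hZX) (fun t ht => hM _ (hmap ht))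
    (fun z => (hXc z).comp (by fun_prop) hmap)
    (hmp.integrable_comp_of_integrable hb).neg
    (ham.comp_measurePreserving hmp).neg
    (by
      simp only [enorm_neg]
      rwa [hmp.lintegral_comp_emb hemb (fun s => ‖a s‖ₑ ^ q)])
    (by
      intro v r hr t ht hrt
      have h3 := heq v (T - t) (hmap ht) (T - r) (hmap hr) (by linarith)
      have e1 := intervalIntegral.integral_comp_sub_left (fun s => a s v) (a := r) (b := t) T
      have e2 := intervalIntegral.integral_comp_sub_left (fun s => inner ℝ (b s) (ι v))
        (a := r) (b := t) T
      simp only [neg_apply, inner_neg_left, intervalIntegral.integral_neg]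
      rw [e1, e2, ← neg_add, ← h3, ← inner_neg_left, neg_sub])
  have e1 := intervalIntegral.integral_comp_sub_left (fun s => a s (Z s)) (a := 0) (b := T) T
  have e2 := intervalIntegral.integral_comp_sub_left (fun s => inner ℝ (b s) (X s))
    (a := 0) (b := T) T
  simp only [neg_apply, inner_neg_left, intervalIntegral.integral_neg, sub_self,
    sub_zero] at h2 e1 e2
  rw [e1, e2] at h2
  linarith

/-- The energy identity for `X' = a + b` with `a ∈ L^q(0, T; V*)` and `b ∈ L¹(0, T; H)`. -/
theorem energy_identity {ι : V →L[ℝ] H} (hι : DenseRange ι) {T α q : ℝ}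
    (hq : q.HolderConjugate α) {X : ℝ → H} {Z : ℝ → V}
    (hZ : MemLp Z (ENNReal.ofReal α) (timeMeasure T)) (hZX : ∀ᵐ t ∂timeMeasure T, ι (Z t) = X t)
    {M : ℝ} (hM : ∀ t ∈ Set.Icc 0 T, ‖X t‖ ≤ M)
    {b : ℝ → H} (hb : Integrable b (timeMeasure T)) {a : ℝ → StrongDual ℝ V}
    (ham : AEStronglyMeasurable a (timeMeasure T)) (haq : ∫⁻ s, ‖a s‖ₑ ^ q ∂timeMeasure T < ∞)
    (heq : ∀ v, ∀ t ∈ Set.Icc 0 T, inner ℝ (X t) (ι v) = inner ℝ (X 0) (ι v) +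
      (∫ s in (0 : ℝ)..t, a s v) + ∫ s in (0 : ℝ)..t, inner ℝ (b s) (ι v)) :
    (∀ z : H, ContinuousOn (fun t => inner ℝ z (X t)) (Set.Icc 0 T)) ∧
    ∀ t ∈ Set.Icc 0 T, ‖X t‖ ^ 2 = ‖X 0‖ ^ 2 + 2 * (∫ s in (0 : ℝ)..t, a s (Z s)) +
      2 * ∫ s in (0 : ℝ)..t, inner ℝ (b s) (X s) := by
  have hac : ∀ v, Integrable (fun s => a s v) (timeMeasure T) := fun v => by
    have : IsFiniteMeasure (timeMeasure T) := by unfold timeMeasure; infer_instance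
    exact integrable_dual_apply hq ham haq (memLp_const v)
  have hbc : ∀ v, Integrable (fun s => inner ℝ (b s) (ι v)) (timeMeasure T) := fun v =>
    hb.inner_const (ι v)
  have hprim : ∀ g : ℝ → ℝ, Integrable g (timeMeasure T) →
      ContinuousOn (fun t => ∫ s in (0 : ℝ)..t, g s) (Set.Icc 0 T) := fun g hg =>
    continuousOn_primitive_timeMeasure hg
  have hXc := continuousOn_inner_of_denseRange hι hM (fun v => by
    have h1 := (continuousOn_const (c := inner ℝ (X 0) (ι v))).add (hprim _ (hac v)) |>.add
      (hprim _ (hbc v))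
    refine h1.congr fun t ht => ?_
    rw [real_inner_comm]
    exact heq v t ht)
  refine ⟨hXc, fun t ht => ?_⟩
  rcases ht.1.eq_or_lt with rfl | htpos
  · simp
  have hsub : Set.Icc 0 t ⊆ Set.Icc 0 T := Set.Icc_subset_Icc_right ht.2
  have hmono := timeMeasure_mono ht.2
  have hac' := timeMeasure_mono ht.2
  refine energy_identity_aux htpos hq (hZ.mono_measure hmono) (ae_mono hmono hZX)
    (fun s hs => hM s (hsub hs)) (fun z => (hXc z).mono hsub) (hb.mono_measure hmono)
    (ham.mono_measure hmono) ((lintegral_mono' hmono le_rfl).trans_lt haq) ?_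
  intro v r hr s hs hrs
  have h0 : (0 : ℝ) ∈ Set.Icc 0 T := ⟨le_rfl, ht.1.trans ht.2⟩
  rw [inner_sub_left, heq v r (hsub hr), heq v s (hsub hs),
    ← intervalIntegral.integral_add_adjacent_intervals
      (intervalIntegrable_of_timeMeasure (hac v) h0 (hsub hr))
      (intervalIntegrable_of_timeMeasure (hac v) (hsub hr) (hsub hs)),
    ← intervalIntegral.integral_add_adjacent_intervals
      (intervalIntegrable_of_timeMeasure (hbc v) h0 (hsub hr))
      (intervalIntegrable_of_timeMeasure (hbc v) (hsub hr) (hsub hs))]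
  ring

theorem integrable_mul_continuousOn {T : ℝ} {k u : ℝ → ℝ} (hk : Integrable k (timeMeasure T))
    (hu : ContinuousOn u (Set.Icc 0 T)) : Integrable (fun s => k s * u s) (timeMeasure T) :=
  IntegrableOn.mul_continuousOn hk hu isCompact_Icc

/-- Grönwall's inequality with an integrable coefficient. -/
theorem gronwall_integrable {T : ℝ} {k : ℝ → ℝ} (hk : IsL1Nonneg T k) :
    ∃ C : ℝ, 0 ≤ C ∧ ∀ (a : ℝ) (u : ℝ → ℝ), 0 ≤ a → ContinuousOn u (Set.Icc 0 T) →
      (∀ t ∈ Set.Icc 0 T, u t ≤ a + ∫ s in (0 : ℝ)..t, k s * u s) →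
      ∀ t ∈ Set.Icc 0 T, u t ≤ C * a := by
  rcases lt_or_ge T 0 with hT | hT
  · exact ⟨0, le_rfl, fun a u _ _ _ t ht => absurd (ht.1.trans ht.2) (not_le.2 hT)⟩
  have h0 : (0 : ℝ) ∈ Set.Icc 0 T := ⟨le_rfl, hT⟩
  have hki : ∀ r ∈ Set.Icc 0 T, ∀ t ∈ Set.Icc 0 T, IntervalIntegrable k volume r t :=
    fun r hr t ht => intervalIntegrable_of_timeMeasure hk.1 hr ht
  have hknn : ∀ᵐ s, s ∈ Set.Icc 0 T → 0 ≤ k s := ae_timeMeasure_iff.1 hk.2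
  let K : ℝ → ℝ := fun t => ∫ s in (0 : ℝ)..t, k s
  have hKc : ContinuousOn K (Set.Icc 0 T) := continuousOn_primitive_timeMeasure hk.1
  have hmul : ∀ u : ℝ → ℝ, ContinuousOn u (Set.Icc 0 T) → ∀ m : ℝ, 0 ≤ m →
      ∀ r ∈ Set.Icc 0 T, ∀ t ∈ Set.Icc 0 T, r ≤ t → (∀ s ∈ Set.Icc r t, u s ≤ m) →
      ∫ s in r..t, k s * u s ≤ (K t - K r) * m := by
    intro u hu m hm r hr t ht hrt hum
    have e : K t - K r = ∫ s in r..t, k s := by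
      simp only [K]
      rw [intervalIntegral.integral_interval_sub_left (hki 0 h0 t ht) (hki 0 h0 r hr)]
    rw [e, ← intervalIntegral.integral_mul_const]
    refine intervalIntegral.integral_mono_ae_restrict hrt
      (intervalIntegrable_of_timeMeasure (integrable_mul_continuousOn hk.1 hu) hr ht)
      ((hki r hr t ht).mul_const m) ?_
    refine (ae_restrict_iff' measurableSet_Icc).2 ?_
    filter_upwards [hknn] with s hs hsr
    exact mul_le_mul_of_nonneg_left (hum s hsr) (hs ⟨hr.1.trans hsr.1, hsr.2.trans ht.2⟩)
  have hKmono : ∀ r ∈ Set.Icc 0 T, ∀ t ∈ Set.Icc 0 T, r ≤ t → K r ≤ K t := by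
    intro r hr t ht hrt
    have e : K t - K r = ∫ s in r..t, k s := by
      simp only [K]
      rw [intervalIntegral.integral_interval_sub_left (hki 0 h0 t ht) (hki 0 h0 r hr)]
    have : 0 ≤ ∫ s in r..t, k s := by
      refine intervalIntegral.integral_nonneg_of_ae_restrict hrt ?_
      refine (ae_restrict_iff' measurableSet_Icc).2 ?_
      filter_upwards [hknn] with s hs hsr
      exact hs ⟨hr.1.trans hsr.1, hsr.2.trans ht.2⟩
    linarith
  have hK0 : K 0 = 0 := by simp [K]
  -- On intervals shorter than `δ` the integral of `k` is at most `1/2`, so half of the maximum of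
  -- `u` can be absorbed. The estimate is then propagated in steps of length `δ / 2`.
  obtain ⟨δ, hδ, hδK⟩ := Metric.uniformContinuousOn_iff.1
    (isCompact_Icc.uniformContinuousOn_of_continuous hKc) (1 / 2) (by norm_num)
  have hstep : ∀ n : ℕ, ∃ C : ℝ, 0 ≤ C ∧ ∀ (a : ℝ) (u : ℝ → ℝ), 0 ≤ a →
      ContinuousOn u (Set.Icc 0 T) →
      (∀ t ∈ Set.Icc 0 T, u t ≤ a + ∫ s in (0 : ℝ)..t, k s * u s) →
      ∀ t ∈ Set.Icc 0 T, t ≤ n * (δ / 2) → u t ≤ C * a := by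
    intro n
    induction n with
    | zero =>
      refine ⟨1, zero_le_one, fun a u ha hu hle t ht ht0 => ?_⟩
      have : t = 0 := le_antisymm (by simpa using ht0) ht.1
      subst this
      simpa using hle 0 ht
    | succ n ih =>
      obtain ⟨C, hC, hCu⟩ := ih
      have hKT : 0 ≤ K T := hK0 ▸ hKmono 0 h0 T ⟨hT, le_rfl⟩ hT
      -- At a maximum `x` of `u` on the new interval, `u x ≤ a + K T * (C * a) + u x / 2`; solving
      -- for `u x` gives the second summand, and the first keeps the constant valid on the earlier
      -- times.
      refine ⟨C + 2 * (1 + C * K T), by positivity, fun a u ha hu hle t ht htn => ?_⟩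
      have hCa : C * a ≤ (C + 2 * (1 + C * K T)) * a := by
        have : 0 ≤ 2 * (1 + C * K T) * a := by positivity
        nlinarith
      rcases le_or_gt t (n * (δ / 2)) with htn' | htn'
      · exact (hCu a u ha hu hle t ht htn').trans hCa
      set r := (n : ℝ) * (δ / 2) with hr
      have hrmem : r ∈ Set.Icc 0 T := ⟨by positivity, htn'.le.trans ht.2⟩
      have hsub : Set.Icc r t ⊆ Set.Icc 0 T := Set.Icc_subset_Icc hrmem.1 ht.2
      obtain ⟨x, hx, hmax⟩ := isCompact_Icc.exists_isMaxOn (Set.nonempty_Icc.2 htn'.le)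
        (hu.mono hsub)
      have hut : u t ≤ u x := hmax ⟨htn'.le, le_rfl⟩
      rcases le_or_gt (u x) 0 with hux | hux
      · exact (hut.trans hux).trans (by positivity)
      have h1 := hle x (hsub hx)
      have hii := fun r hr t ht => intervalIntegrable_of_timeMeasure (r := r) (t := t)
        (integrable_mul_continuousOn hk.1 hu) hr ht
      rw [← intervalIntegral.integral_add_adjacent_intervals (hii 0 h0 r hrmem)
        (hii r hrmem x (hsub hx))] at h1
      have h2 := hmul u hu (C * a) (by positivity) 0 h0 r hrmem hrmem.1 (fun s hs =>
        hCu a u ha hu hle s ⟨hs.1, hs.2.trans hrmem.2⟩ hs.2)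
      have h3 := hmul u hu (u x) hux.le r hrmem x (hsub hx) hx.1 (fun s hs =>
        hmax ⟨hs.1, hs.2.trans hx.2⟩)
      have h4 : K x - K r ≤ 1 / 2 := by
        have := hδK x (hsub hx) r hrmem (by
          rw [Real.dist_eq, abs_of_nonneg (by linarith [hx.1])]
          push_cast at htn
          linarith [hx.2])
        rw [Real.dist_eq] at this
        exact (le_abs_self _).trans this.le
      have h5 := hKmono r hrmem T ⟨hT, le_rfl⟩ hrmem.2
      have h6 : (K x - K r) * u x ≤ 1 / 2 * u x := by gcongr
      have h7 : (K r - K 0) * (C * a) ≤ K T * (C * a) := by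
        rw [hK0, sub_zero]; gcongr
      nlinarith
  obtain ⟨n, hn⟩ := exists_nat_ge (T / (δ / 2))
  obtain ⟨C, hC, hCu⟩ := hstep n
  refine ⟨C, hC, fun a u ha hu hle t ht => hCu a u ha hu hle t ht (ht.2.trans ?_)⟩
  rwa [div_le_iff₀ (by positivity)] at hn

end EnergyIdentity

/-! ### Arzelà–Ascoli selection and Carathéodory's existence theorem. -/

section Caratheodory

/-- Countably many pointwise bounded and equicontinuous sequences of functions on a set of reals
converge pointwise along a common subsequence. -/
theorem exists_subseq_tendsto_of_equicontinuous {J X : Type*} [Countable J] [PseudoMetricSpace X]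
    [ProperSpace X] {S : Set ℝ} {u : ℕ → ℝ → J → X}
    (hb : ∀ j, ∀ t ∈ S, ∃ c R, ∀ n, u n t j ∈ Metric.closedBall c R)
    (heq : ∀ j, ∀ ε > 0, ∃ δ > 0, ∃ N, ∀ n ≥ N, ∀ s ∈ S, ∀ t ∈ S, |s - t| < δ →
      dist (u n s j) (u n t j) < ε) :
    ∃ φ : ℕ → ℕ, StrictMono φ ∧ ∀ j, ∀ t ∈ S, ∃ l, Tendsto (fun n => u (φ n) t j) atTop (𝓝 l) := by
  obtain ⟨D, hDS, hDc, hSD⟩ := TopologicalSpace.IsSeparable.exists_countable_dense_subset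
    (TopologicalSpace.IsSeparable.of_separableSpace S)
  have : Countable D := hDc.to_subtype
  have hb' : ∀ i : J × D, ∃ p : X × ℝ, ∀ n, u n i.2 i.1 ∈ Metric.closedBall p.1 p.2 := fun i => by
    obtain ⟨c, R, h⟩ := hb i.1 i.2 (hDS i.2.2)
    exact ⟨⟨c, R⟩, h⟩
  choose p hp using hb'
  -- The diagonal argument, as sequential compactness of a countable product of balls, over `J` and
  -- a countable dense set of times. Equicontinuity carries the convergence to the remaining times.
  have hcpt : IsCompact (Set.univ.pi fun i => Metric.closedBall (p i).1 (p i).2) :=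
    isCompact_univ_pi fun i => isCompact_closedBall _ _
  obtain ⟨l, -, φ, hφ, hlim⟩ := hcpt.tendsto_subseq (x := fun n i => u n i.2 i.1)
    (fun n i _ => hp i n)
  refine ⟨φ, hφ, fun j t ht => cauchySeq_tendsto_of_complete ?_⟩
  refine Metric.cauchySeq_iff'.2 fun ε hε => ?_
  obtain ⟨δ, hδ, N, hN⟩ := heq j (ε / 3) (by positivity)
  obtain ⟨d, hd, htd⟩ := Metric.mem_closure_iff.1 (hSD ht) δ hδ
  have h1 : Tendsto (fun n => u (φ n) d j) atTop (𝓝 (l (j, ⟨d, hd⟩))) :=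
    (tendsto_pi_nhds.1 hlim) (j, ⟨d, hd⟩)
  obtain ⟨N', hN'⟩ := Metric.cauchySeq_iff.1 h1.cauchySeq (ε / 3) (by positivity)
  refine ⟨max N N', fun n hn => ?_⟩
  rw [Real.dist_eq] at htd
  have a1 := hN (φ n) ((le_max_left _ _).trans (hn.trans (hφ.le_apply))) t ht d (hDS hd) htd
  have a2 := hN (φ (max N N')) ((le_max_left _ _).trans (hφ.le_apply)) t ht d (hDS hd) htd
  have a3 := hN' n ((le_max_right _ _).trans hn) (max N N') (le_max_right _ _)
  have a4 := dist_triangle4 (u (φ n) t j) (u (φ n) d j) (u (φ (max N N')) d j)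
    (u (φ (max N N')) t j)
  rw [dist_comm] at a2
  linarith

variable {E : Type*} [NormedAddCommGroup E] [NormedSpace ℝ E]

/-- The delayed time `(t ∧ T - δ) ∨ 0`. -/
def delay (T δ t : ℝ) : ℝ := max 0 (min t T - δ)

theorem delay_mem {T δ : ℝ} (hT : 0 ≤ T) (hδ : 0 ≤ δ) (t : ℝ) : delay T δ t ∈ Set.Icc 0 T :=
  ⟨le_max_left _ _, max_le hT (by linarith [min_le_right t T])⟩

theorem continuous_delay (T δ : ℝ) : Continuous (delay T δ) := by
  unfold delay; fun_prop

theorem abs_delay_sub_le (T δ s t : ℝ) : |delay T δ s - delay T δ t| ≤ |s - t| := by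
  unfold delay
  rw [max_comm 0, max_comm 0]
  refine (abs_max_sub_max_le_abs _ _ _).trans ?_
  rw [sub_sub_sub_cancel_right]
  exact (abs_min_sub_min_le_max s T t T).trans (by simp)

/-- Existence of a solution of the delayed equation. -/
theorem exists_delayed_solution {T δ : ℝ} (hT : 0 < T) (hδ : 0 < δ) {F : ℝ → E → E}
    (hF : ∀ y : ℝ → E, Continuous y → Integrable (fun s => F s (y s)) (timeMeasure T)) (x : E) :
    ∃ y : ℝ → E, Continuous y ∧
      ∀ t ∈ Set.Icc 0 T, y t = x + ∫ s in (0 : ℝ)..delay T δ t, F s (y s) := by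
  let Φ : (ℝ → E) → ℝ → E := fun y t => x + ∫ s in (0 : ℝ)..delay T δ t, F s (y s)
  have hΦ : ∀ y, Continuous y → Continuous (Φ y) := fun y hy => by
    refine continuous_const.add ?_
    exact (continuousOn_primitive_timeMeasure (hF y hy)).comp_continuous (continuous_delay T δ)
      (delay_mem hT.le hδ.le)
  let w : ℕ → ℝ → E := fun i => Φ^[i] fun _ => x
  have hw : ∀ i, Continuous (w i) := fun i => by
    induction i with
    | zero => exact continuous_const
    | succ i ih =>
      simp only [w, Function.iterate_succ_apply']
      exact hΦ _ ih
  -- Up to time `(i + 1) δ` the delayed integral sees the path only up to `i δ`. Each iteration of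
  -- `Φ` therefore settles one more interval of length `δ`, and finitely many iterations reach `T`.
  have hagree : ∀ i : ℕ, ∀ t ≤ i * δ, Φ (w i) t = w i t := by
    intro i
    induction i with
    | zero =>
      intro t ht
      have : delay T δ t = 0 := max_eq_left (by
        have := min_le_left t T
        simp at ht
        linarith)
      simp [Φ, this, w]
    | succ i ih =>
      intro t ht
      have e : w (i + 1) = Φ (w i) := Function.iterate_succ_apply' _ _ _
      rw [e]
      simp only [Φ]
      congr 1
      refine intervalIntegral.integral_congr fun s hs => ?_
      rw [Set.uIcc_of_le (delay_mem hT.le hδ.le t).1] at hs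
      have hsi : s ≤ i * δ := by
        refine hs.2.trans (max_le (by positivity) ?_)
        push_cast at ht
        linarith [min_le_left t T]
      change F s (Φ (w i) s) = F s (w i s)
      rw [ih s hsi]
  obtain ⟨N, hN⟩ := exists_nat_ge (T / δ)
  rw [div_le_iff₀ hδ] at hN
  exact ⟨w N, hw N, fun t ht => (hagree N t (ht.2.trans hN)).symm⟩

/-- Carathéodory's existence theorem for ordinary differential equations. -/
theorem exists_caratheodory_solution [FiniteDimensional ℝ E] {T : ℝ} (hT : 0 < T) {F : ℝ → E → E}
    {m : ℝ → ℝ} (hm : Integrable m (timeMeasure T))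
    (hFm : ∀ y : ℝ → E, Continuous y → AEStronglyMeasurable (fun s => F s (y s)) (timeMeasure T))
    (hFc : ∀ᵐ s ∂timeMeasure T, Continuous (F s))
    (hFb : ∀ᵐ s ∂timeMeasure T, ∀ y, ‖F s y‖ ≤ m s) (x : E) :
    ∃ y : ℝ → E, Continuous y ∧ ∀ t ∈ Set.Icc 0 T, y t = x + ∫ s in (0 : ℝ)..t, F s (y s) := by
  have : ProperSpace E := FiniteDimensional.proper ℝ E
  have h0 : (0 : ℝ) ∈ Set.Icc 0 T := ⟨le_rfl, hT.le⟩
  have hF : ∀ y : ℝ → E, Continuous y → Integrable (fun s => F s (y s)) (timeMeasure T) :=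
    fun y hy => hm.mono' (hFm y hy) (hFb.mono fun s hs => hs _)
  have hδ : ∀ n : ℕ, 0 < T / ((n : ℝ) + 1) := fun n => by positivity
  choose w hwc hw using fun n : ℕ => exists_delayed_solution hT (hδ n) hF x
  have hdm : ∀ (n : ℕ) t, delay T (T / ((n : ℝ) + 1)) t ∈ Set.Icc 0 T := fun n =>
    delay_mem hT.le (hδ n).le
  let K : ℝ → ℝ := fun t => ∫ s in (0 : ℝ)..t, m s
  have hKc : ContinuousOn K (Set.Icc 0 T) := continuousOn_primitive_timeMeasure hm
  have hmi : ∀ r ∈ Set.Icc 0 T, ∀ t ∈ Set.Icc 0 T, IntervalIntegrable m volume r t :=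
    fun r hr t ht => intervalIntegrable_of_timeMeasure hm hr ht
  have hinc : ∀ n, ∀ r ∈ Set.Icc 0 T, ∀ t ∈ Set.Icc 0 T,
      ‖∫ s in r..t, F s (w n s)‖ ≤ |K t - K r| := by
    intro n r hr t ht
    have e : K t - K r = ∫ s in r..t, m s :=
      intervalIntegral.integral_interval_sub_left (hmi 0 h0 t ht) (hmi 0 h0 r hr)
    rw [e]
    refine intervalIntegral.norm_integral_le_abs_of_norm_le ?_ (hmi r hr t ht)
    refine (ae_restrict_iff' measurableSet_uIoc).2 ?_
    filter_upwards [ae_timeMeasure_iff.1 hFb] with s hs hsr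
    exact hs (Set.uIcc_subset_Icc hr ht (Set.uIoc_subset_uIcc hsr)) _
  have hFi : ∀ n, ∀ r ∈ Set.Icc 0 T, ∀ t ∈ Set.Icc 0 T,
      IntervalIntegrable (fun s => F s (w n s)) volume r t := fun n r hr t ht =>
    intervalIntegrable_of_timeMeasure (hF _ (hwc n)) hr ht
  -- The delay does not increase distances in time, so the modulus of continuity of the primitive of
  -- `m` serves every `n`.
  have hequi : ∀ ε > 0, ∃ δ > 0, ∀ n, ∀ s ∈ Set.Icc 0 T, ∀ t ∈ Set.Icc 0 T, |s - t| < δ →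
      dist (w n s) (w n t) < ε := by
    intro ε hε
    obtain ⟨δ, hδ, hδK⟩ := Metric.uniformContinuousOn_iff.1
      (isCompact_Icc.uniformContinuousOn_of_continuous hKc) ε hε
    refine ⟨δ, hδ, fun n s hs t ht hst => ?_⟩
    rw [dist_eq_norm, hw n s hs, hw n t ht, add_sub_add_left_eq_sub,
      intervalIntegral.integral_interval_sub_left (hFi n 0 h0 _ (hdm n s)) (hFi n 0 h0 _ (hdm n t))]
    refine (hinc n _ (hdm n t) _ (hdm n s)).trans_lt ?_
    rw [← Real.dist_eq]
    refine hδK _ (hdm n s) _ (hdm n t) ?_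
    rw [Real.dist_eq]
    exact (abs_delay_sub_le _ _ _ _).trans_lt hst
  obtain ⟨φ, hφ, hlim⟩ := exists_subseq_tendsto_of_equicontinuous (J := Unit) (S := Set.Icc 0 T)
    (u := fun n t _ => w n t)
    (by
      intro _ t ht
      obtain ⟨R, hR⟩ := isCompact_Icc.exists_bound_of_continuousOn hKc
      refine ⟨x, R, fun n => ?_⟩
      rw [mem_closedBall_iff_norm, hw n t ht, add_sub_cancel_left]
      refine (hinc n 0 h0 _ (hdm n t)).trans ?_
      have : K 0 = 0 := intervalIntegral.integral_same
      rw [this, sub_zero]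
      exact hR _ (hdm n t))
    (by
      intro _ ε hε
      obtain ⟨δ, hδ, h⟩ := hequi ε hε
      exact ⟨δ, hδ, 0, fun n _ => h n⟩)
  have hlim' : ∀ t : Set.Icc 0 T, ∃ l, Tendsto (fun n => w (φ n) t) atTop (𝓝 l) := fun t =>
    hlim () t t.2
  choose l hl using hlim'
  have hlc : Continuous l := by
    rw [Metric.continuous_iff]
    intro t ε hε
    obtain ⟨δ, hδ, h⟩ := hequi (ε / 2) (by positivity)
    refine ⟨δ, hδ, fun s hst => ?_⟩
    have h1 : dist (l s) (l t) ≤ ε / 2 := by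
      refine le_of_tendsto' ((hl s).dist (hl t)) fun n => (h (φ n) s s.2 t t.2 ?_).le
      rwa [Subtype.dist_eq, Real.dist_eq] at hst
    linarith
  let y : ℝ → E := Set.IccExtend hT.le l
  have hy : Continuous y := hlc.Icc_extend'
  have hyl : ∀ t ∈ Set.Icc 0 T, Tendsto (fun n => w (φ n) t) atTop (𝓝 (y t)) := fun t ht => by
    have : y t = l ⟨t, ht⟩ := Set.IccExtend_of_mem hT.le l ht
    rw [this]
    exact hl ⟨t, ht⟩
  refine ⟨y, hy, fun t ht => ?_⟩
  have hdel : Tendsto (fun n : ℕ => delay T (T / ((φ n : ℝ) + 1)) t) atTop (𝓝 t) := by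
    have h1 : Tendsto (fun n : ℕ => T / ((φ n : ℝ) + 1)) atTop (𝓝 0) :=
      (tendsto_step_size T).comp hφ.tendsto_atTop
    have h2 : Tendsto (fun n : ℕ => max 0 (min t T - T / ((φ n : ℝ) + 1))) atTop
        (𝓝 (max 0 (min t T - 0))) := tendsto_const_nhds.max (tendsto_const_nhds.sub h1)
    simpa only [delay, sub_zero, min_eq_left ht.2, max_eq_right ht.1] using h2
  -- The upper limit moves with `n`; an indicator puts all integrals on the fixed interval, where
  -- dominated convergence applies.
  have hintegral : ∀ (g : ℝ → E), ∀ r ∈ Set.Icc 0 T,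
      ∫ s in (0 : ℝ)..r, g s = ∫ s, (Set.Ioc 0 r).indicator g s ∂timeMeasure T := by
    intro g r hr
    rw [intervalIntegral.integral_of_le hr.1, timeMeasure, integral_indicator measurableSet_Ioc,
      Measure.restrict_restrict measurableSet_Ioc, Set.inter_eq_left.2]
    exact fun s hs => ⟨hs.1.le, hs.2.trans hr.2⟩
  have hconv : Tendsto (fun n => ∫ s in (0 : ℝ)..delay T (T / ((φ n : ℝ) + 1)) t,
      F s (w (φ n) s)) atTop (𝓝 (∫ s in (0 : ℝ)..t, F s (y s))) := by
    simp only [fun n => hintegral (fun s => F s (w (φ n) s)) _ (hdm (φ n) t), hintegral _ t ht]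
    refine tendsto_integral_of_dominated_convergence m ?_ hm ?_ ?_
    · exact fun n => (hFm _ (hwc _)).indicator measurableSet_Ioc
    · intro n
      filter_upwards [hFb] with s hs
      exact (norm_indicator_le_norm_self _ _).trans (hs _)
    · have hne : ∀ᵐ s ∂timeMeasure T, s ≠ t :=
        ae_restrict_of_ae (by simp [ae_iff])
      filter_upwards [hFc, hne, ae_restrict_mem measurableSet_Icc] with s hs hst hsT
      rcases lt_or_gt_of_ne hst with h | h
      · have h1 : Tendsto (fun n => F s (w (φ n) s)) atTop (𝓝 (F s (y s))) :=
          (hs.tendsto _).comp (hyl s hsT)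
        rcases hsT.1.eq_or_lt with h0 | h0
        · simp [← h0]
        rw [Set.indicator_of_mem (show s ∈ Set.Ioc 0 t from ⟨h0, h.le⟩)]
        refine h1.congr' ?_
        filter_upwards [hdel.eventually (lt_mem_nhds h)] with n hn
        rw [Set.indicator_of_mem (show s ∈ Set.Ioc 0 _ from ⟨h0, hn.le⟩)]
      · rw [Set.indicator_of_notMem (fun hh => absurd hh.2 (not_le.2 h))]
        refine tendsto_const_nhds.congr' ?_
        filter_upwards [hdel.eventually (gt_mem_nhds h)] with n hn
        rw [Set.indicator_of_notMem (fun hh => absurd hh.2 (not_le.2 hn))]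
  refine tendsto_nhds_unique (hyl t ht) ?_
  have h3 := hconv.const_add x
  exact h3.congr fun n => (hw (φ n) t ht).symm

end Caratheodory

/-! ### Minty's argument and one-sided bounds at a fixed time. -/

section Pointwise

variable {V H : Type*} [NormedAddCommGroup V] [NormedSpace ℝ V]
  [NormedAddCommGroup H] [InnerProductSpace ℝ H]

/-- Minty's argument for a hemicontinuous, locally monotone operator. -/
theorem tendsto_apply_of_minty {ι : V →L[ℝ] H} {a : V → StrongDual ℝ V} {K : ℕ → ℝ}
    (hemi : ∀ u v x : V, Continuous fun r : ℝ => a (u + r • v) x)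
    (mono : ∀ (R : ℕ) (u v : V), ‖u‖ ≤ R → ‖v‖ ≤ R →
      (a u - a v) (u - v) ≤ K R * ‖ι (u - v)‖ ^ 2)
    {w : ℕ → V} {u : V} {M : ℝ} (hM : ∀ᶠ n in atTop, ‖w n‖ ≤ M)
    (hw : Tendsto (fun n => ι (w n)) atTop (𝓝 (ι u)))
    (hweak : ∀ ξ : StrongDual ℝ V, Tendsto (fun n => ξ (w n)) atTop (𝓝 (ξ u)))
    (hlim : Tendsto (fun n => a (w n) (w n - u)) atTop (𝓝 0)) (z : V) :
    Tendsto (fun n => a (w n) z) atTop (𝓝 (a u z)) := by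
  -- A lower bound for all `z` suffices, since applying it to `-z` gives the upper bound.
  have key : ∀ z : V, ∀ ε > 0, ∀ᶠ n in atTop, a u z - ε < a (w n) z := by
    intro z ε hε
    -- This radius contains eventually all `w n` and every test point `u + l • z` with `0 ≤ l ≤ 1`,
    -- so a single monotonicity constant is used as `l` shrinks.
    obtain ⟨R, hR⟩ := exists_nat_ge (max M (‖u‖ + ‖z‖))
    have hc : Continuous fun r : ℝ => a (u + r • z) z - K R * r * ‖ι z‖ ^ 2 :=
      (hemi u z z).sub (by fun_prop)
    have h0 := hc.tendsto 0
    simp only [zero_smul, add_zero, mul_zero, zero_mul, sub_zero] at h0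
    obtain ⟨ρ, hρ, hball⟩ := Metric.eventually_nhds_iff.1
      (h0.eventually (lt_mem_nhds (show a u z - ε / 2 < a u z by linarith)))
    set l := min (ρ / 2) 1 with hl
    have hl0 : 0 < l := lt_min (by positivity) one_pos
    have hl1 : l ≤ 1 := min_le_right _ _
    have h1 := hball (y := l) (by
      rw [dist_zero_right, Real.norm_of_nonneg hl0.le]
      exact (min_le_left _ _).trans_lt (by linarith))
    set v := u + l • z with hv
    have hvR : ‖v‖ ≤ R := by
      refine le_trans ?_ ((le_max_right _ _).trans hR)
      refine (norm_add_le _ _).trans ?_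
      rw [norm_smul, Real.norm_of_nonneg hl0.le]
      have := mul_le_mul_of_nonneg_right hl1 (norm_nonneg z)
      linarith
    -- Monotonicity between `w n` and `v = u + l • z` bounds `l * a (w n) z` from below by this
    -- expression. Its limit is `l * a v z` minus a term quadratic in `l`, harmless after division
    -- by `l`.
    have hrhs : Tendsto (fun n => a (w n) (w n - u) - a v (w n - v) - K R * ‖ι (w n) - ι v‖ ^ 2)
        atTop (𝓝 (0 - a v (u - v) - K R * ‖ι u - ι v‖ ^ 2)) := by
      refine (hlim.sub ?_).sub ?_
      · simp only [map_sub]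
        exact (hweak (a v)).sub tendsto_const_nhds
      · exact ((hw.sub tendsto_const_nhds).norm.pow 2).const_mul _
    have e1 : u - v = -(l • z) := by rw [hv]; abel
    have e2 : ι u - ι v = -(l • ι z) := by rw [← map_sub, e1, map_neg, map_smul]
    rw [e1, e2, norm_neg, norm_smul, Real.norm_of_nonneg hl0.le, map_neg, map_smul,
      smul_eq_mul] at hrhs
    have hlt : l * (a u z - ε) < 0 - -(l * a v z) - K R * (l * ‖ι z‖) ^ 2 := by
      have := mul_lt_mul_of_pos_left h1 hl0
      have h2 : 0 < l * ε := by positivity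
      nlinarith
    filter_upwards [hM, hrhs.eventually (lt_mem_nhds hlt)] with n hn hn'
    have h2 := mono R (w n) v (hn.trans ((le_max_left _ _).trans hR)) hvR
    rw [sub_apply] at h2
    have e3 : a (w n) (w n - v) = a (w n) (w n - u) - l * a (w n) z := by
      rw [hv, ← sub_sub, map_sub, map_smul, smul_eq_mul]
    rw [e3, map_sub ι] at h2
    refine lt_of_mul_lt_mul_left ?_ hl0.le
    linarith
  rw [Metric.tendsto_atTop']
  intro ε hε
  obtain ⟨N, hN⟩ := eventually_atTop.1 ((key z ε hε).and (key (-z) ε hε))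
  refine ⟨N, fun n hn => ?_⟩
  obtain ⟨h1, h2⟩ := hN n hn.le
  simp only [map_neg] at h2
  rw [Real.dist_eq, abs_lt]
  constructor <;> linarith

/-- Local monotonicity and coercivity bound the limit of the pairings from above. -/
theorem eventually_apply_sub_le (hV : IsReflexive V) {ι : V →L[ℝ] H} (hι : Function.Injective ι)
    {a : V → StrongDual ℝ V} {K : ℕ → ℝ}
    (mono : ∀ (R : ℕ) (u v : V), ‖u‖ ≤ R → ‖v‖ ≤ R →
      (a u - a v) (u - v) ≤ K R * ‖ι (u - v)‖ ^ 2)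
    {w : ℕ → V} {u : V} (hw : Tendsto (fun n => ι (w n)) atTop (𝓝 (ι u)))
    {α c G : ℝ} (hα : 0 < α) (hc : 0 < c)
    (hG : ∀ n, a (w n) (w n - u) ≤ G - c * ‖w n‖ ^ α) {ε : ℝ} (hε : 0 < ε) :
    ∀ᶠ n in atTop, a (w n) (w n - u) ≤ ε := by
  -- Outside the ball of radius `R` the coercive bound `G - c ‖w n‖ ^ α` is already nonpositive;
  -- inside it, the constant `K R` is available.
  obtain ⟨R, hR⟩ := exists_nat_ge (max ((|G| / c) ^ (1 / α)) ‖u‖)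
  -- The sequence need not be bounded in `V`, so weak convergence is replaced by this estimate,
  -- valid for each index with `w n` in the ball.
  obtain ⟨y, hy⟩ := exists_abs_apply_le hV hι (a u) (M := R + ‖u‖) (ε := ε / 3) (by positivity)
    (by positivity)
  have hd := tendsto_iff_norm_sub_tendsto_zero.1 hw
  have h1 : Tendsto (fun n => ‖y‖ * ‖ι (w n) - ι u‖) atTop (𝓝 0) := by
    simpa using hd.const_mul ‖y‖
  have h2 : Tendsto (fun n => K R * ‖ι (w n) - ι u‖ ^ 2) atTop (𝓝 0) := by
    simpa using (hd.pow 2).const_mul (K R)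
  filter_upwards [h1.eventually (gt_mem_nhds (show (0 : ℝ) < ε / 3 by positivity)),
    h2.eventually (gt_mem_nhds (show (0 : ℝ) < ε / 3 by positivity))] with n hn1 hn2
  rcases le_or_gt ‖w n‖ R with hn | hn
  · have h3 := mono R (w n) u hn ((le_max_right _ _).trans hR)
    rw [sub_apply, map_sub ι] at h3
    have h4 := hy (w n - u) ((norm_sub_le _ _).trans (by gcongr))
    rw [map_sub ι] at h4
    have h5 := le_abs_self (a u (w n - u))
    linarith
  · have h3 : |G| / c ≤ ‖w n‖ ^ α := by
      have h4 : (|G| / c) ^ (1 / α) ≤ ‖w n‖ := ((le_max_left _ _).trans hR).trans hn.le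
      have h5 := Real.rpow_le_rpow (by positivity) h4 hα.le
      rwa [← Real.rpow_mul (by positivity), one_div_mul_cancel hα.ne', Real.rpow_one] at h5
    rw [div_le_iff₀ hc] at h3
    have h6 := hG n
    have h7 := le_abs_self G
    linarith

/-- Young's inequality with a small parameter. -/
theorem exists_young {α q : ℝ} (hq : q.HolderConjugate α) {η : ℝ} (hη : 0 < η) :
    ∃ C : ℝ, 0 ≤ C ∧ ∀ x y : ℝ, 0 ≤ x → 0 ≤ y → x * y ≤ η * x ^ q + C * y ^ α := by
  let s : ℝ := η ^ (1 / q)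
  have hs : 0 < s := Real.rpow_pos_of_pos hη _
  refine ⟨(s⁻¹) ^ α, by positivity, fun x y hx hy => ?_⟩
  have h1 := Real.young_inequality_of_nonneg (mul_nonneg hs.le hx)
    (mul_nonneg (inv_nonneg.2 hs.le) hy) hq
  have e1 : s * x * (s⁻¹ * y) = x * y := by field_simp
  have e2 : (s * x) ^ q = η * x ^ q := by
    rw [Real.mul_rpow hs.le hx, ← Real.rpow_mul hη.le, one_div_mul_cancel hq.ne_zero, Real.rpow_one]
  have e3 : (s⁻¹ * y) ^ α = s⁻¹ ^ α * y ^ α := Real.mul_rpow (inv_nonneg.2 hs.le) hy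
  rw [e1, e2, e3] at h1
  have h2 : η * x ^ q / q ≤ η * x ^ q := div_le_self (by positivity) hq.lt.le
  have h3 : s⁻¹ ^ α * y ^ α / α ≤ s⁻¹ ^ α * y ^ α := div_le_self (by positivity) hq.symm.lt.le
  linarith

end Pointwise

/-! ### Direct consequences of the assumptions. -/

section Assumptions

set_option linter.unusedSectionVars false

variable {V H U : Type*} [NormedAddCommGroup V] [NormedSpace ℝ V] [CompleteSpace V]
  [MeasurableSpace V] [BorelSpace V]
  [NormedAddCommGroup H] [InnerProductSpace ℝ H] [CompleteSpace H]
  [TopologicalSpace.SeparableSpace H]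
  [NormedAddCommGroup U] [InnerProductSpace ℝ U] [CompleteSpace U]
  [TopologicalSpace.SeparableSpace U]

/-- The assumptions of the existence theorem. -/
structure Assumptions (ι : V →L[ℝ] H) (T α : ℝ) (f : ℝ → ℝ) (A : ℝ → V → StrongDual ℝ V)
    (B : ℝ → V → HilbertSchmidt U H) : Prop where
  reflexive : IsReflexive V
  embedding : IsCompactDenseEmbedding ι
  time_pos : 0 < T
  one_lt : 1 < α
  isL1Nonneg : IsL1Nonneg T f
  measurable_drift : Measurable fun p : Set.Icc (0 : ℝ) T × V => A p.1 p.2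
  measurable_diffusion : Measurable fun p : Set.Icc (0 : ℝ) T × V => B p.1 p.2
  hemicontinuity : Hemicontinuity T A
  monotonicity : GeneralizedLocalMonotonicity ι T A
  coercivity : Coercivity ι T α f A B
  growth : Growth ι T α f A
  diffusionContinuity : DiffusionContinuity ι T B

variable {ι : V →L[ℝ] H} {T α : ℝ} {f : ℝ → ℝ} {A : ℝ → V → StrongDual ℝ V}
  {B : ℝ → V → HilbertSchmidt U H}

theorem holderConjugate_of_one_lt (hα : 1 < α) : (α / (α - 1)).HolderConjugate α :=
  (Real.HolderConjugate.conjExponent hα).symm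

namespace Assumptions

/-- Integer radii leave a single exceptional null set for all of them, so the radius may be chosen
after the time. -/
theorem exists_monotonicity (hyp : Assumptions ι T α f A B)
    : ∃ K : ℕ → ℝ → ℝ, ∀ᵐ t ∂timeMeasure T, ∀ (R : ℕ) (u v : V),
    ‖u‖ ≤ R → ‖v‖ ≤ R → (A t u - A t v) (u - v) ≤ K R t * ‖ι (u - v)‖ ^ 2 := by
  choose K hK1 hK using fun R : ℕ => hyp.monotonicity (R + 1) (by positivity)
  refine ⟨K, ?_⟩
  rw [ae_all_iff]
  intro R
  filter_upwards [hK R] with t ht u v hu hv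
  exact ht u v (max_le (by linarith) (by linarith))

/-- The growth condition on sets that are bounded in `H`. -/
theorem exists_growth (hyp : Assumptions ι T α f A B)
    (M : ℝ) : ∃ D : ℝ, 0 ≤ D ∧ ∀ᵐ t ∂timeMeasure T, ∀ v : V, ‖ι v‖ ≤ M →
    ‖A t v‖ ^ (α / (α - 1)) ≤ D * (f t + ‖v‖ ^ α) := by
  obtain ⟨β, C, hβ, hC, h⟩ := hyp.growth
  refine ⟨(1 + C) * (1 + |M| ^ β), by positivity, ?_⟩
  filter_upwards [h, hyp.isL1Nonneg.2] with t ht hft v hv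
  refine (ht v).trans ?_
  have h1 : ‖ι v‖ ^ β ≤ |M| ^ β :=
    Real.rpow_le_rpow (norm_nonneg _) (hv.trans (le_abs_self M)) hβ
  have h2 : 0 ≤ ‖v‖ ^ α := by positivity
  calc (f t + C * ‖v‖ ^ α) * (1 + ‖ι v‖ ^ β)
      ≤ ((1 + C) * (f t + ‖v‖ ^ α)) * (1 + |M| ^ β) := by
        gcongr
        nlinarith
    _ = (1 + C) * (1 + |M| ^ β) * (f t + ‖v‖ ^ α) := by ring

/-- The diffusion term is dominated on sets that are bounded in `H`. -/
theorem exists_diffusion_bound (hyp : Assumptions ι T α f A B)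
    {h : ℝ → U} (hh : MemLp h 2 (timeMeasure T)) (M : ℝ) :
    ∃ G : ℝ → ℝ, Integrable G (timeMeasure T) ∧ ∀ᵐ t ∂timeMeasure T, ∀ v : V, ‖ι v‖ ≤ M →
      ‖(B t v).toCLM (h t)‖ ≤ G t := by
  obtain ⟨-, g, hg, h5⟩ := hyp.diffusionContinuity
  refine ⟨fun t => g t * (1 + M ^ 2) + ‖h t‖ ^ 2,
    (hg.1.mul_const _).add (hh.integrable_norm_pow two_ne_zero), ?_⟩
  filter_upwards [h5, hg.2] with t ht hgt v hv
  have h1 := (B t v).norm_toCLM_apply_le (h t)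
  have h2 : ‖B t v‖ ^ 2 ≤ g t * (1 + M ^ 2) := (ht v).trans (by gcongr)
  have h3 := two_mul_le_add_sq ‖B t v‖ ‖h t‖
  nlinarith [sq_nonneg ‖B t v‖, sq_nonneg ‖h t‖]

theorem separableSpace (hyp : Assumptions ι T α f A B) : TopologicalSpace.SeparableSpace V :=
  separableSpace_of_denseRange_of_isReflexive hyp.reflexive hyp.embedding.injective

theorem aestronglyMeasurable_drift (hyp : Assumptions ι T α f A B)
    {Z : ℝ → V} (hZ : AEStronglyMeasurable Z (timeMeasure T)) :
    AEStronglyMeasurable (fun s => A s (Z s)) (timeMeasure T) := by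
  have := separableSpace_dual hyp.reflexive hyp.embedding.injective
  have : SecondCountableTopology (StrongDual ℝ V) := UniformSpace.secondCountable_of_separable _
  exact (aemeasurable_comp_path hyp.time_pos hyp.measurable_drift hZ.aemeasurable).aestronglyMeasurable

theorem aestronglyMeasurable_diffusion (hyp : Assumptions ι T α f A B)
    {h : ℝ → U} (hh : MemLp h 2 (timeMeasure T)) {Z : ℝ → V}
    (hZ : AEStronglyMeasurable Z (timeMeasure T)) :
    AEStronglyMeasurable (fun s => (B s (Z s)).toCLM (h s)) (timeMeasure T) :=
  aestronglyMeasurable_hilbertSchmidt_apply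
    (aemeasurable_comp_path hyp.time_pos hyp.measurable_diffusion hZ.aemeasurable) hh.1

theorem integrable_diffusion (hyp : Assumptions ι T α f A B)
    {h : ℝ → U} (hh : MemLp h 2 (timeMeasure T)) {Z : ℝ → V}
    (hZ : AEStronglyMeasurable Z (timeMeasure T)) {M : ℝ}
    (hM : ∀ᵐ t ∂timeMeasure T, ‖ι (Z t)‖ ≤ M) :
    Integrable (fun s => (B s (Z s)).toCLM (h s)) (timeMeasure T) := by
  obtain ⟨G, hG, hGb⟩ := hyp.exists_diffusion_bound hh M
  refine hG.mono' (hyp.aestronglyMeasurable_diffusion hh hZ) ?_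
  filter_upwards [hM, hGb] with s h1 h2
  exact h2 _ h1

theorem exists_drift_bound (hyp : Assumptions ι T α f A B) (M : ℝ) : ∃ D : ℝ, 0 ≤ D ∧ ∀ Z : ℝ → V,
    MemLp Z (ENNReal.ofReal α) (timeMeasure T) → (∀ᵐ t ∂timeMeasure T, ‖ι (Z t)‖ ≤ M) →
    ∫⁻ s, ‖A s (Z s)‖ₑ ^ (α / (α - 1)) ∂timeMeasure T ≤
      ENNReal.ofReal (D * ((∫ s, f s ∂timeMeasure T) + ∫ s, ‖Z s‖ ^ α ∂timeMeasure T)) := by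
  obtain ⟨D, hD, hDb⟩ := hyp.exists_growth M
  refine ⟨D, hD, fun Z hZ hM => ?_⟩
  have hα0 : 0 < α := one_pos.trans hyp.one_lt
  have hq : 0 < α / (α - 1) := (holderConjugate_of_one_lt hyp.one_lt).pos
  have hZi : Integrable (fun s => ‖Z s‖ ^ α) (timeMeasure T) := by
    have := hZ.integrable_norm_rpow (by simpa using hα0) ENNReal.ofReal_ne_top
    rwa [ENNReal.toReal_ofReal hα0.le] at this
  have hi : Integrable (fun s => D * (f s + ‖Z s‖ ^ α)) (timeMeasure T) :=
    (hyp.isL1Nonneg.1.add hZi).const_mul D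
  rw [← integral_add hyp.isL1Nonneg.1 hZi, ← integral_const_mul,
    ofReal_integral_eq_lintegral_ofReal hi]
  · refine lintegral_mono_ae ?_
    filter_upwards [hDb, hM] with s h1 h2
    rw [← ofReal_norm, ENNReal.ofReal_rpow_of_nonneg (norm_nonneg _) hq.le]
    exact ENNReal.ofReal_le_ofReal (h1 _ h2)
  · filter_upwards [hyp.isL1Nonneg.2] with s hs
    positivity

/-- The coercivity estimate for the pairing with `v - u`, on sets that are bounded in `H`. -/
theorem exists_coercive_bound (hyp : Assumptions ι T α f A B)
    (M : ℝ) : ∃ c C : ℝ, 0 < c ∧ 0 ≤ C ∧ ∀ᵐ t ∂timeMeasure T, ∀ u v : V,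
    ‖ι v‖ ≤ M → A t v (v - u) ≤ C * (f t + ‖u‖ ^ α) - c * ‖v‖ ^ α := by
  obtain ⟨c, hc, h3⟩ := hyp.coercivity
  obtain ⟨D, hD, hDb⟩ := hyp.exists_growth M
  have hq := holderConjugate_of_one_lt hyp.one_lt
  -- With this parameter the growth condition turns Young's term `‖A t v‖ ^ q` into at most `c/4 (f
  -- t + ‖v‖ ^ α)`. Half of the coercivity constant is available, so `c/4` remains.
  obtain ⟨C, hC, hy⟩ := exists_young hq (η := c / (4 * (D + 1))) (by positivity)
  refine ⟨c / 4, C + (1 + M ^ 2) + c, by positivity, by positivity, ?_⟩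
  filter_upwards [h3, hDb, hyp.isL1Nonneg.2] with t ht1 ht2 hft u v hv
  have h1 := ht1 v
  have h2 := hy ‖A t v‖ ‖u‖ (norm_nonneg _) (norm_nonneg _)
  have h3 : c / (4 * (D + 1)) * ‖A t v‖ ^ (α / (α - 1)) ≤ c / 4 * (f t + ‖v‖ ^ α) := by
    calc c / (4 * (D + 1)) * ‖A t v‖ ^ (α / (α - 1))
        ≤ c / (4 * (D + 1)) * (D * (f t + ‖v‖ ^ α)) := by gcongr; exact ht2 v hv
      _ = c / 4 * (f t + ‖v‖ ^ α) * (D / (D + 1)) := by field_simp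
      _ ≤ c / 4 * (f t + ‖v‖ ^ α) * 1 := by
          gcongr
          rw [div_le_one (by positivity)]; linarith
      _ = _ := mul_one _
  have h4 : -(A t v u) ≤ ‖A t v‖ * ‖u‖ := (neg_le_abs _).trans ((A t v).le_opNorm u)
  have h5 : ‖ι v‖ ^ 2 ≤ M ^ 2 := by gcongr
  have h6 : f t * (1 + ‖ι v‖ ^ 2) ≤ f t * (1 + M ^ 2) := by gcongr
  have h7 : 0 ≤ ‖u‖ ^ α := by positivity
  have h8 : 0 ≤ ‖v‖ ^ α := by positivity
  have h9 : 0 ≤ (1 + M ^ 2 + c) * ‖u‖ ^ α := by positivity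
  have h10 : 0 ≤ C * f t := by positivity
  have h11 : 0 ≤ c * f t := by positivity
  have h12 : 0 ≤ f t * (1 + M ^ 2) := by positivity
  rw [map_sub]
  nlinarith [sq_nonneg ‖B t v‖]

end Assumptions
end Assumptions

/-! ### The Galerkin vector fields: continuity, measurability, bounds. -/

section Galerkin

set_option linter.unusedSectionVars false

theorem continuous_of_forall_inner {X G : Type*} [TopologicalSpace X] [NormedAddCommGroup G]
    [InnerProductSpace ℝ G] [FiniteDimensional ℝ G] {F : X → G}
    (hF : ∀ w, Continuous fun x => inner ℝ (F x) w) : Continuous F := by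
  let b := stdOrthonormalBasis ℝ G
  have h : F = fun x => ∑ i, (inner ℝ (F x) (b i)) • b i := by
    ext1 x
    exact (b.sum_repr' (F x)).symm.trans (Finset.sum_congr rfl fun i _ => by rw [real_inner_comm])
  rw [h]
  exact continuous_finsetSum _ fun i _ => (hF _).smul continuous_const

theorem aestronglyMeasurable_of_forall_inner {G : Type*} [NormedAddCommGroup G]
    [InnerProductSpace ℝ G] [FiniteDimensional ℝ G] {μ : Measure ℝ} {F : ℝ → G}
    (hF : ∀ w, AEStronglyMeasurable (fun x => inner ℝ (F x) w) μ) : AEStronglyMeasurable F μ := by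
  let b := stdOrthonormalBasis ℝ G
  have h : F = fun x => ∑ i, (inner ℝ (F x) (b i)) • b i := by
    ext1 x
    exact (b.sum_repr' (F x)).symm.trans (Finset.sum_congr rfl fun i _ => by rw [real_inner_comm])
  rw [h]
  exact Finset.aestronglyMeasurable_fun_sum _ fun i _ => (hF _).smul_const _

/-- The energy identity for an ordinary differential equation. -/
theorem norm_sq_eq_of_integral_eq {G : Type*} [NormedAddCommGroup G] [InnerProductSpace ℝ G]
    [CompleteSpace G] {T : ℝ} {y b : ℝ → G} (hy : Continuous y)
    (hb : Integrable b (timeMeasure T)) {x : G}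
    (heq : ∀ t ∈ Set.Icc 0 T, y t = x + ∫ s in (0 : ℝ)..t, b s) {t : ℝ} (ht : t ∈ Set.Icc 0 T) :
    ‖y t‖ ^ 2 = ‖x‖ ^ 2 + 2 * ∫ s in (0 : ℝ)..t, inner ℝ (b s) (y s) := by
  have h0 : (0 : ℝ) ∈ Set.Icc 0 T := ⟨le_rfl, ht.1.trans ht.2⟩
  have hy0 : y 0 = x := by simpa using heq 0 h0
  obtain ⟨M, hM⟩ := isCompact_Icc.exists_bound_of_continuousOn (hy.continuousOn (s := Set.Icc 0 T))
  have hfin : IsFiniteMeasure (timeMeasure T) := by unfold timeMeasure; infer_instance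
  have hyL : MemLp y (ENNReal.ofReal 2) (timeMeasure T) :=
    MemLp.of_bound hy.aestronglyMeasurable M
      (ae_timeMeasure_iff.2 (Eventually.of_forall fun s hs => hM s hs))
  have hq : (2 : ℝ).HolderConjugate 2 := by
    rw [Real.holderConjugate_iff]; norm_num
  -- The trivial triple with `V = H = G`, all of the derivative being placed in `b`.
  have h1 := (energy_identity (ι := ContinuousLinearMap.id ℝ G) (T := T) (α := 2) (q := 2)
    (X := y) (Z := y) (a := fun _ => 0) (b := b) Function.surjective_id.denseRange hq hyL
    (Eventually.of_forall fun s => rfl) hM hb aestronglyMeasurable_const (by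
      have h0 : ‖(0 : StrongDual ℝ G)‖ₑ = 0 := by
        rw [← ofReal_norm, norm_zero, ENNReal.ofReal_zero]
      simp [h0]) (by
      intro v s hs
      rw [heq s hs, hy0, inner_add_left]
      simp only [zero_apply, intervalIntegral.integral_zero, add_zero, ContinuousLinearMap.id_apply]
      congr 1
      have h2 := (innerSL ℝ v).intervalIntegral_comp_comm
        (intervalIntegrable_of_timeMeasure hb h0 hs)
      simp only [innerSL_apply_apply] at h2
      rw [real_inner_comm, ← h2]
      simp only [real_inner_comm])).2 t ht
  simpa [hy0] using h1

variable {V H U : Type*} [NormedAddCommGroup V] [NormedSpace ℝ V] [CompleteSpace V]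
  [MeasurableSpace V] [BorelSpace V]
  [NormedAddCommGroup H] [InnerProductSpace ℝ H] [CompleteSpace H]
  [TopologicalSpace.SeparableSpace H]
  [NormedAddCommGroup U] [InnerProductSpace ℝ U] [CompleteSpace U]
  [TopologicalSpace.SeparableSpace U]
  {ι : V →L[ℝ] H} {T α : ℝ} {f : ℝ → ℝ} {A : ℝ → V → StrongDual ℝ V}
  {B : ℝ → V → HilbertSchmidt U H}

/-- The vector field of the Galerkin equation in the subspace `G`, with `l : G → V` a right inverse
of the embedding. -/
def galerkinField (A : ℝ → V → StrongDual ℝ V) (B : ℝ → V → HilbertSchmidt U H) (h : ℝ → U)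
    {G : Submodule ℝ H} [CompleteSpace G] (l : G →L[ℝ] V) (t : ℝ) (y : G) : G :=
  (InnerProductSpace.toDual ℝ G).symm
    ((A t (l y)).comp l + (innerSL ℝ ((B t (l y)).toCLM (h t))).comp G.subtypeL)

theorem inner_galerkinField (h : ℝ → U) {G : Submodule ℝ H} [CompleteSpace G] (l : G →L[ℝ] V)
    (t : ℝ) (y w : G) : inner ℝ (galerkinField A B h l t y) w =
      A t (l y) (l w) + inner ℝ ((B t (l y)).toCLM (h t)) (w : H) := by
  rw [galerkinField, InnerProductSpace.toDual_symm_apply]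
  rfl

theorem norm_galerkinField_le (h : ℝ → U) {G : Submodule ℝ H} [CompleteSpace G] (l : G →L[ℝ] V)
    (t : ℝ) (y : G) : ‖galerkinField A B h l t y‖ ≤
      ‖A t (l y)‖ * ‖l‖ + ‖(B t (l y)).toCLM (h t)‖ := by
  rw [galerkinField, LinearIsometryEquiv.norm_map]
  refine (norm_add_le _ _).trans (add_le_add (ContinuousLinearMap.opNorm_comp_le _ _) ?_)
  refine ContinuousLinearMap.opNorm_le_bound _ (norm_nonneg _) fun w => ?_
  exact norm_inner_le_norm _ _

/-- A continuous cutoff at the level `R`. -/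
def cutoff (R r : ℝ) : ℝ := max 0 (min 1 (R + 1 - r))

theorem cutoff_nonneg (R r : ℝ) : 0 ≤ cutoff R r := le_max_left _ _

theorem cutoff_le_one (R r : ℝ) : cutoff R r ≤ 1 := max_le zero_le_one (min_le_left _ _)

theorem cutoff_eq_one {R r : ℝ} (h : r ≤ R) : cutoff R r = 1 := by
  rw [cutoff, min_eq_left (by linarith), max_eq_right zero_le_one]

theorem cutoff_eq_zero {R r : ℝ} (h : R + 1 ≤ r) : cutoff R r = 0 :=
  max_eq_left ((min_le_right _ _).trans (by linarith))

theorem continuous_cutoff (R : ℝ) : Continuous (cutoff R) := by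
  unfold cutoff; fun_prop

namespace Assumptions

/-- Hemicontinuity is continuity along lines only. Local monotonicity upgrades it by Minty's
argument: along a convergent sequence in the finite-dimensional space the growth condition bounds
the drifts, so their pairings with the errors tend to zero. The diffusion part is continuous already
for the norm of `H`. -/
theorem ae_continuous_galerkinField (hyp : Assumptions ι T α f A B)
    (h : ℝ → U) {G : Submodule ℝ H} [FiniteDimensional ℝ G]
    [CompleteSpace G] (l : G →L[ℝ] V) :
    ∀ᵐ t ∂timeMeasure T, Continuous (galerkinField A B h l t) := by
  obtain ⟨K, hK⟩ := hyp.exists_monotonicity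
  obtain ⟨β, C, hβ, hC, hgr⟩ := hyp.growth
  have hq := holderConjugate_of_one_lt hyp.one_lt
  filter_upwards [hK, hyp.hemicontinuity, hgr, hyp.diffusionContinuity.1, hyp.isL1Nonneg.2]
    with t hKt hemi hgt h5 hft
  refine continuous_of_forall_inner fun w => ?_
  simp only [inner_galerkinField]
  refine continuous_iff_seqContinuous.2 fun y y₀ hy => ?_
  have hly : Tendsto (fun n => l (y n)) atTop (𝓝 (l y₀)) := (l.continuous.tendsto _).comp hy
  have hιy : Tendsto (fun n => ι (l (y n))) atTop (𝓝 (ι (l y₀))) :=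
    (ι.continuous.tendsto _).comp hly
  refine Tendsto.add ?_ ?_
  · have hbd : ∀ᶠ n in atTop, ‖l (y n)‖ ≤ ‖l y₀‖ + 1 :=
      (hly.norm.eventually (gt_mem_nhds (lt_add_one _))).mono fun _ h => h.le
    have hbd' : ∀ᶠ n in atTop, ‖ι (l (y n))‖ ≤ ‖ι (l y₀)‖ + 1 :=
      (hιy.norm.eventually (gt_mem_nhds (lt_add_one _))).mono fun _ h => h.le
    refine tendsto_apply_of_minty (ι := ι) (fun u v x => hemi u v x) hKt hbd hιy
      (fun ξ => (ξ.continuous.tendsto _).comp hly) ?_ (l w)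
    set S : ℝ := 1 + (f t + C * (‖l y₀‖ + 1) ^ α) * (1 + (‖ι (l y₀)‖ + 1) ^ β) with hS
    have hα0 : 0 ≤ α := (one_pos.trans hyp.one_lt).le
    have hAb : ∀ᶠ n in atTop, ‖A t (l (y n))‖ ≤ S := by
      filter_upwards [hbd, hbd'] with n h1 h2
      have h3 : ‖A t (l (y n))‖ ^ (α / (α - 1)) ≤
          (f t + C * (‖l y₀‖ + 1) ^ α) * (1 + (‖ι (l y₀)‖ + 1) ^ β) := by
        refine (hgt _).trans ?_
        gcongr
      have h4 : ‖A t (l (y n))‖ ≤ 1 + ‖A t (l (y n))‖ ^ (α / (α - 1)) := by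
        rcases le_total ‖A t (l (y n))‖ 1 with h | h
        · have : 0 ≤ ‖A t (l (y n))‖ ^ (α / (α - 1)) := by positivity
          linarith
        · have := Real.self_le_rpow_of_one_le h hq.lt.le
          linarith
      linarith
    have h0 : Tendsto (fun n => S * ‖l (y n) - l y₀‖) atTop (𝓝 0) := by
      simpa using (tendsto_iff_norm_sub_tendsto_zero.1 hly).const_mul S
    refine squeeze_zero_norm' ?_ h0
    filter_upwards [hAb] with n hn
    exact ((A t (l (y n))).le_opNorm _).trans (by gcongr)
  · have h1 := h5 (fun n => l (y n)) (l y₀) hιy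
    have h2 : Tendsto (fun n => (B t (l (y n))).toCLM (h t)) atTop
        (𝓝 ((B t (l y₀)).toCLM (h t))) := by
      rw [tendsto_iff_norm_sub_tendsto_zero]
      refine squeeze_zero (fun _ => norm_nonneg _) (fun n => ?_)
        (by simpa using h1.mul_const ‖h t‖)
      have e : (B t (l (y n))).toCLM (h t) - (B t (l y₀)).toCLM (h t) =
          (B t (l (y n)) - B t (l y₀)).toCLM (h t) := by
        rw [map_sub, sub_apply]
      rw [e]
      exact HilbertSchmidt.norm_toCLM_apply_le _ _
    exact h2.inner tendsto_const_nhds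

theorem aestronglyMeasurable_galerkinField (hyp : Assumptions ι T α f A B)
    {h : ℝ → U} (hh : MemLp h 2 (timeMeasure T))
    {G : Submodule ℝ H} [FiniteDimensional ℝ G] [CompleteSpace G] (l : G →L[ℝ] V) {y : ℝ → G}
    (hy : Continuous y) :
    AEStronglyMeasurable (fun s => galerkinField A B h l s (y s)) (timeMeasure T) := by
  refine aestronglyMeasurable_of_forall_inner fun w => ?_
  simp only [inner_galerkinField]
  have hZ : AEStronglyMeasurable (fun s => l (y s)) (timeMeasure T) :=
    (l.continuous.comp hy).aestronglyMeasurable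
  exact (aestronglyMeasurable_dual_apply (hyp.aestronglyMeasurable_drift hZ)
    aestronglyMeasurable_const).add
    ((hyp.aestronglyMeasurable_diffusion hh hZ).inner aestronglyMeasurable_const)

/-- The cutoff vanishes for `‖y‖ ≥ R + 1`, and on the remaining ball growth and diffusion bounds
give the majorant required by Carathéodory's theorem. It depends on the subspace through `‖l‖`,
which does not enter the final estimates. -/
theorem exists_galerkinField_bound (hyp : Assumptions ι T α f A B)
    {h : ℝ → U} (hh : MemLp h 2 (timeMeasure T))
    {G : Submodule ℝ H} [CompleteSpace G] {l : G →L[ℝ] V} (hl : ∀ y, ι (l y) = y) {R : ℝ}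
    (hR : 0 ≤ R) : ∃ m : ℝ → ℝ, Integrable m (timeMeasure T) ∧ ∀ᵐ t ∂timeMeasure T, ∀ y,
      ‖cutoff R ‖y‖ • galerkinField A B h l t y‖ ≤ m t := by
  obtain ⟨D, hD, hDb⟩ := hyp.exists_growth (R + 1)
  obtain ⟨g, hg, hgb⟩ := hyp.exists_diffusion_bound hh (R + 1)
  have hq := holderConjugate_of_one_lt hyp.one_lt
  have hα0 : 0 ≤ α := (one_pos.trans hyp.one_lt).le
  have hfin : IsFiniteMeasure (timeMeasure T) := by unfold timeMeasure; infer_instance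
  refine ⟨fun t => (1 + D * (f t + (‖l‖ * (R + 1)) ^ α)) * ‖l‖ + g t, ?_, ?_⟩
  · exact (((integrable_const 1).add
      ((hyp.isL1Nonneg.1.add (integrable_const _)).const_mul D)).mul_const _).add hg
  filter_upwards [hDb, hgb, hyp.isL1Nonneg.2] with t h1 h2 hft y
  have hg0 : 0 ≤ g t := (norm_nonneg _).trans (h2 0 (by simpa using by linarith))
  rcases le_or_gt (R + 1) ‖y‖ with hy | hy
  · rw [cutoff_eq_zero hy, zero_smul, norm_zero]
    positivity
  have hιy : ‖ι (l y)‖ ≤ R + 1 := by rw [hl]; exact hy.le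
  have hly : ‖l y‖ ≤ ‖l‖ * (R + 1) := (l.le_opNorm y).trans (by gcongr)
  rw [norm_smul, Real.norm_of_nonneg (cutoff_nonneg _ _)]
  have h3 : ‖A t (l y)‖ ≤ 1 + D * (f t + (‖l‖ * (R + 1)) ^ α) := by
    have h4 : ‖A t (l y)‖ ^ (α / (α - 1)) ≤ D * (f t + (‖l‖ * (R + 1)) ^ α) := by
      refine (h1 _ hιy).trans ?_
      gcongr
    rcases le_total ‖A t (l y)‖ 1 with h | h
    · have : 0 ≤ ‖A t (l y)‖ ^ (α / (α - 1)) := by positivity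
      linarith
    · have := Real.self_le_rpow_of_one_le h hq.lt.le
      linarith
  calc cutoff R ‖y‖ * ‖galerkinField A B h l t y‖
      ≤ 1 * (‖A t (l y)‖ * ‖l‖ + ‖(B t (l y)).toCLM (h t)‖) :=
        mul_le_mul (cutoff_le_one _ _) (norm_galerkinField_le h l t y) (norm_nonneg _) zero_le_one
    _ ≤ _ := by
        rw [one_mul]
        gcongr
        exact h2 _ hιy

/-- The energy estimate for the pairing of the drift and the diffusion with the solution. -/
theorem exists_energy_bound (hyp : Assumptions ι T α f A B)
    (h : ℝ → U) : ∃ c : ℝ, 0 < c ∧ ∀ᵐ t ∂timeMeasure T, ∀ v : V,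
    2 * (A t v v + inner ℝ ((B t v).toCLM (h t)) (ι v)) ≤
      (f t + ‖h t‖ ^ 2) * (1 + ‖ι v‖ ^ 2) - c * ‖v‖ ^ α := by
  obtain ⟨c, hc, h3⟩ := hyp.coercivity
  refine ⟨c, hc, ?_⟩
  filter_upwards [h3] with t ht v
  have h1 := ht v
  have h2 : inner ℝ ((B t v).toCLM (h t)) (ι v) ≤ ‖B t v‖ * (‖h t‖ * ‖ι v‖) := by
    refine (real_inner_le_norm _ _).trans ?_
    rw [← mul_assoc]
    exact mul_le_mul_of_nonneg_right ((B t v).norm_toCLM_apply_le _) (norm_nonneg _)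
  have h4 := two_mul_le_add_sq ‖B t v‖ (‖h t‖ * ‖ι v‖)
  nlinarith [sq_nonneg ‖h t‖]

theorem isL1Nonneg_coeff (hyp : Assumptions ι T α f A B)
    {h : ℝ → U} (hh : MemLp h 2 (timeMeasure T)) :
    IsL1Nonneg T fun t => f t + ‖h t‖ ^ 2 := by
  refine ⟨hyp.isL1Nonneg.1.add (hh.integrable_norm_pow two_ne_zero), ?_⟩
  filter_upwards [hyp.isL1Nonneg.2] with t ht
  positivity

end Assumptions
end Galerkin

/-! ### Solution of the Galerkin equations with uniform bounds. -/

section GalerkinSolution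

set_option linter.unusedSectionVars false

/-- The energy estimate needs an equation in a Hilbert space, so `E` is replaced by its image in
`H`; finite dimension makes the inverse of the embedding continuous there. -/
theorem exists_rightInverse_of_finiteDimensional {V H : Type*} [NormedAddCommGroup V]
    [NormedSpace ℝ V] [NormedAddCommGroup H] [InnerProductSpace ℝ H] {ι : V →L[ℝ] H}
    (hι : Function.Injective ι) (E : Submodule ℝ V) [FiniteDimensional ℝ E] :
    ∃ G : Submodule ℝ H, FiniteDimensional ℝ G ∧ (∀ v ∈ E, ι v ∈ G) ∧
      ∃ l : G →L[ℝ] V, (∀ y, ι (l y) = y) ∧ ∀ v (hv : ι v ∈ G), v ∈ E → l ⟨ι v, hv⟩ = v := by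
  let G := E.map (ι : V →ₗ[ℝ] H)
  let e : E ≃ₗ[ℝ] G := Submodule.equivMapOfInjective (ι : V →ₗ[ℝ] H) hι E
  have hfin : FiniteDimensional ℝ G := inferInstance
  have he : ∀ v : E, (e v : H) = ι v := fun v => rfl
  let l : G →L[ℝ] V := LinearMap.toContinuousLinearMap (E.subtype ∘ₗ e.symm.toLinearMap)
  have hl : ∀ y, ι (l y) = y := fun y => by
    change ι (e.symm y : V) = y
    rw [← he, e.apply_symm_apply]
  refine ⟨G, hfin, fun v hv => ⟨v, hv, rfl⟩, l, hl, fun v hv hvE => hι ?_⟩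
  rw [hl]

variable {V H U : Type*} [NormedAddCommGroup V] [NormedSpace ℝ V] [CompleteSpace V]
  [MeasurableSpace V] [BorelSpace V]
  [NormedAddCommGroup H] [InnerProductSpace ℝ H] [CompleteSpace H]
  [TopologicalSpace.SeparableSpace H]
  [NormedAddCommGroup U] [InnerProductSpace ℝ U] [CompleteSpace U]
  [TopologicalSpace.SeparableSpace U]
  {ι : V →L[ℝ] H} {T α : ℝ} {f : ℝ → ℝ} {A : ℝ → V → StrongDual ℝ V}
  {B : ℝ → V → HilbertSchmidt U H}

namespace Assumptions

theorem memLp_of_continuous (hyp : Assumptions ι T α f A B)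
    {Z : ℝ → V} (hZ : Continuous Z) (p : ℝ≥0∞) :
    MemLp Z p (timeMeasure T) := by
  have hfin : IsFiniteMeasure (timeMeasure T) := by unfold timeMeasure; infer_instance
  have := hyp.separableSpace
  have : SecondCountableTopology V := UniformSpace.secondCountable_of_separable V
  obtain ⟨M, hM⟩ := isCompact_Icc.exists_bound_of_continuousOn (hZ.continuousOn (s := Set.Icc 0 T))
  exact MemLp.of_bound hZ.aestronglyMeasurable M
    (ae_timeMeasure_iff.2 (Eventually.of_forall fun s hs => hM s hs))

theorem integrable_drift_apply (hyp : Assumptions ι T α f A B)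
    {Z W : ℝ → V} (hZ : MemLp Z (ENNReal.ofReal α) (timeMeasure T))
    {M : ℝ} (hM : ∀ᵐ t ∂timeMeasure T, ‖ι (Z t)‖ ≤ M)
    (hW : MemLp W (ENNReal.ofReal α) (timeMeasure T)) :
    Integrable (fun s => A s (Z s) (W s)) (timeMeasure T) := by
  obtain ⟨D, -, hD⟩ := hyp.exists_drift_bound M
  exact integrable_dual_apply (holderConjugate_of_one_lt hyp.one_lt)
    (hyp.aestronglyMeasurable_drift hZ.1) ((hD Z hZ hM).trans_lt ENNReal.ofReal_lt_top) hW

/-- Solutions of the Galerkin equations, with bounds that do not depend on the subspace. -/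
theorem exists_galerkin (hyp : Assumptions ι T α f A B)
    {h : ℝ → U} (hh : MemLp h 2 (timeMeasure T)) (x : H) :
    ∃ M C : ℝ, 0 ≤ M ∧ ∀ E : Submodule ℝ V, FiniteDimensional ℝ E → ∃ Z : ℝ → V,
      Continuous Z ∧ (∀ t ∈ Set.Icc 0 T, ‖ι (Z t)‖ ≤ M) ∧
      ∫ s, ‖Z s‖ ^ α ∂timeMeasure T ≤ C ∧
      (∀ v ∈ E, ∀ t ∈ Set.Icc 0 T, inner ℝ (ι (Z t)) (ι v) = inner ℝ x (ι v) +
        (∫ s in (0 : ℝ)..t, A s (Z s) v) +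
          ∫ s in (0 : ℝ)..t, inner ℝ ((B s (Z s)).toCLM (h s)) (ι v)) ∧
      ‖ι (Z T)‖ ^ 2 ≤ ‖x‖ ^ 2 + 2 * (∫ s in (0 : ℝ)..T, A s (Z s) (Z s)) +
        2 * ∫ s in (0 : ℝ)..T, inner ℝ ((B s (Z s)).toCLM (h s)) (ι (Z s)) := by
  have hT := hyp.time_pos
  have hα0 : 0 < α := one_pos.trans hyp.one_lt
  have h0T : (0 : ℝ) ∈ Set.Icc 0 T := ⟨le_rfl, hT.le⟩
  have hTT : T ∈ Set.Icc 0 T := ⟨hT.le, le_rfl⟩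
  have hk := hyp.isL1Nonneg_coeff hh
  set k : ℝ → ℝ := fun t => f t + ‖h t‖ ^ 2 with hkdef
  obtain ⟨c, hc, hen⟩ := hyp.exists_energy_bound h
  obtain ⟨CG, hCG, hgron⟩ := gronwall_integrable hk
  -- The Grönwall constant depends only on `k`, so this level is fixed before the subspace is given
  -- and can serve as the level of the cutoff.
  set M := √(CG * (1 + ‖x‖ ^ 2)) with hMdef
  have hM0 : 0 ≤ M := Real.sqrt_nonneg _
  have hM2 : M ^ 2 = CG * (1 + ‖x‖ ^ 2) := Real.sq_sqrt (by positivity)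
  set κ := ∫ s, k s ∂timeMeasure T with hκ
  refine ⟨M, (‖x‖ ^ 2 + κ * (1 + M ^ 2)) / c, hM0, fun E hE => ?_⟩
  obtain ⟨G, hG, hEG, l, hl, hlE⟩ := exists_rightInverse_of_finiteDimensional
    hyp.embedding.injective E
  have hGc : CompleteSpace G := FiniteDimensional.complete ℝ G
  obtain ⟨m, hm, hmb⟩ := hyp.exists_galerkinField_bound hh hl hM0
  -- The truncated field has an integrable majorant. Its solution turns out to stay in the ball of
  -- radius `M`, where the cutoff equals `1`, so it solves the original equation.
  let F : ℝ → G → G := fun t y => cutoff M ‖y‖ • galerkinField A B h l t y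
  have hFm : ∀ y : ℝ → G, Continuous y →
      AEStronglyMeasurable (fun s => F s (y s)) (timeMeasure T) := fun y hy =>
    ((continuous_cutoff M).comp hy.norm).aestronglyMeasurable.smul
      (hyp.aestronglyMeasurable_galerkinField hh l hy)
  obtain ⟨x₀, hx₀, hx₀n⟩ : ∃ x₀ : G, (∀ w : G, inner ℝ x₀ w = inner ℝ x (w : H)) ∧ ‖x₀‖ ≤ ‖x‖ :=
    ⟨G.orthogonalProjectionOnto x, fun w => by
      rw [Submodule.coe_inner]
      exact Submodule.inner_orthogonalProjectionOnto_eq_of_mem_right w x,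
      G.norm_orthogonalProjectionOnto_apply_le x⟩
  obtain ⟨y, hyc, hy⟩ := exists_caratheodory_solution hT hm hFm
    ((hyp.ae_continuous_galerkinField h l).mono fun t ht =>
      ((continuous_cutoff M).comp continuous_norm).smul ht) hmb x₀
  have hbi : Integrable (fun s => F s (y s)) (timeMeasure T) :=
    hm.mono' (hFm y hyc) (hmb.mono fun s hs => hs _)
  have hyn : ContinuousOn (fun t => 1 + ‖y t‖ ^ 2) (Set.Icc 0 T) := by fun_prop
  have hku : Integrable (fun s => k s * (1 + ‖y s‖ ^ 2)) (timeMeasure T) :=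
    integrable_mul_continuousOn hk.1 hyn
  have hby : Integrable (fun s => 2 * inner ℝ (F s (y s)) (y s)) (timeMeasure T) := by
    obtain ⟨S, hS⟩ := isCompact_Icc.exists_bound_of_continuousOn
      (hyc.continuousOn (s := Set.Icc 0 T))
    refine Integrable.const_mul ?_ 2
    refine (hbi.norm.mul_const S).mono' (hbi.1.inner hyc.aestronglyMeasurable) ?_
    refine ae_timeMeasure_iff.2 (Eventually.of_forall fun s hs => ?_)
    exact (norm_inner_le_norm _ _).trans (by gcongr; exact hS s hs)
  -- The cutoff may be dropped from the nonnegative term with `k`. The coercive term keeps it: that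
  -- term is discarded for the bound in `H`, and used for the bound in `V` once the cutoff is known
  -- to be `1`.
  have hpt : ∀ᵐ s ∂timeMeasure T, 2 * inner ℝ (F s (y s)) (y s) ≤
      k s * (1 + ‖y s‖ ^ 2) - cutoff M ‖y s‖ * (c * ‖l (y s)‖ ^ α) := by
    filter_upwards [hen, hk.2] with s h1 h2
    have h3 := h1 (l (y s))
    rw [hl] at h3
    have h4 : inner ℝ (F s (y s)) (y s) = cutoff M ‖y s‖ *
        (A s (l (y s)) (l (y s)) + inner ℝ ((B s (l (y s))).toCLM (h s)) (y s : H)) := by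
      simp only [F]
      rw [real_inner_smul_left, inner_galerkinField]
    rw [h4]
    have h5 := mul_le_mul_of_nonneg_left h3 (cutoff_nonneg M ‖y s‖)
    have h6 : cutoff M ‖y s‖ * (k s * (1 + ‖y s‖ ^ 2)) ≤ 1 * (k s * (1 + ‖y s‖ ^ 2)) :=
      mul_le_mul_of_nonneg_right (cutoff_le_one _ _) (by positivity)
    simp only [Submodule.coe_norm] at h6 ⊢ h5
    simp only [hkdef] at h6 ⊢
    nlinarith
  have henergy : ∀ t ∈ Set.Icc 0 T, ‖y t‖ ^ 2 =
      ‖x₀‖ ^ 2 + ∫ s in (0 : ℝ)..t, 2 * inner ℝ (F s (y s)) (y s) := fun t ht => by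
    rw [norm_sq_eq_of_integral_eq hyc hbi hy ht, intervalIntegral.integral_const_mul]
  have hx2 : ‖x₀‖ ^ 2 ≤ ‖x‖ ^ 2 := by gcongr
  have hyM : ∀ t ∈ Set.Icc 0 T, ‖y t‖ ≤ M := by
    intro t ht
    have h1 := hgron (1 + ‖x‖ ^ 2) (fun t => 1 + ‖y t‖ ^ 2) (by positivity) hyn (by
      intro t ht
      have h2 : ∫ s in (0 : ℝ)..t, 2 * inner ℝ (F s (y s)) (y s) ≤
          ∫ s in (0 : ℝ)..t, k s * (1 + ‖y s‖ ^ 2) := by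
        refine intervalIntegral.integral_mono_ae_restrict ht.1
          (intervalIntegrable_of_timeMeasure hby h0T ht)
          (intervalIntegrable_of_timeMeasure hku h0T ht) ?_
        refine ae_mono (timeMeasure_mono ht.2) ?_
        filter_upwards [hpt] with s hs
        have : 0 ≤ cutoff M ‖y s‖ * (c * ‖l (y s)‖ ^ α) :=
          mul_nonneg (cutoff_nonneg _ _) (by positivity)
        linarith
      rw [henergy t ht]
      linarith) t ht
    rw [← hM2] at h1
    refine le_of_sq_le_sq ?_ hM0
    linarith
  have hFy : ∀ s ∈ Set.Icc 0 T, F s (y s) = galerkinField A B h l s (y s) := fun s hs => by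
    simp only [F]
    rw [cutoff_eq_one (hyM s hs), one_smul]
  let Z : ℝ → V := fun t => l (y t)
  have hZc : Continuous Z := l.continuous.comp hyc
  have hZL : MemLp Z (ENNReal.ofReal α) (timeMeasure T) := hyp.memLp_of_continuous hZc _
  have hιZ : ∀ t, ι (Z t) = y t := fun t => hl _
  have hZM : ∀ t ∈ Set.Icc 0 T, ‖ι (Z t)‖ ≤ M := fun t ht => by
    rw [hιZ]; exact hyM t ht
  have hZM' : ∀ᵐ t ∂timeMeasure T, ‖ι (Z t)‖ ≤ M :=
    ae_timeMeasure_iff.2 (Eventually.of_forall hZM)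
  have hBi := hyp.integrable_diffusion hh hZL.1 hZM'
  have hfin : IsFiniteMeasure (timeMeasure T) := by unfold timeMeasure; infer_instance
  refine ⟨Z, hZc, hZM, ?_, ?_, ?_⟩
  · rw [le_div_iff₀ hc]
    have hZi : Integrable (fun s => ‖Z s‖ ^ α) (timeMeasure T) := by
      have := hZL.integrable_norm_rpow (by simpa using hα0) ENNReal.ofReal_ne_top
      rwa [ENNReal.toReal_ofReal hα0.le] at this
    have h1 := henergy T hTT
    rw [← integral_timeMeasure hT.le] at h1
    have h2 : ∫ s, 2 * inner ℝ (F s (y s)) (y s) ∂timeMeasure T ≤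
        ∫ s, (k s * (1 + M ^ 2) - c * ‖Z s‖ ^ α) ∂timeMeasure T := by
      refine integral_mono_ae hby ((hk.1.mul_const _).sub (hZi.const_mul c)) ?_
      filter_upwards [hpt, hk.2, ae_restrict_mem measurableSet_Icc] with s h3 h4 hs
      rw [cutoff_eq_one (hyM s hs), one_mul] at h3
      have h5 : k s * (1 + ‖y s‖ ^ 2) ≤ k s * (1 + M ^ 2) := by
        gcongr
        exact hyM s hs
      exact h3.trans (by linarith)
    rw [integral_sub (hk.1.mul_const _) (hZi.const_mul c), integral_mul_const,
      integral_const_mul c] at h2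
    have h6 := sq_nonneg ‖y T‖
    linarith
  · intro v hv t ht
    have h1 : inner ℝ (y t) (⟨ι v, hEG v hv⟩ : G) = inner ℝ x₀ (⟨ι v, hEG v hv⟩ : G) +
        ∫ s in (0 : ℝ)..t, inner ℝ (F s (y s)) (⟨ι v, hEG v hv⟩ : G) := by
      rw [hy t ht, inner_add_left]
      congr 1
      have h2 := (innerSL ℝ (⟨ι v, hEG v hv⟩ : G)).intervalIntegral_comp_comm
        (intervalIntegrable_of_timeMeasure hbi h0T ht)
      simp only [innerSL_apply_apply] at h2
      rw [real_inner_comm, ← h2]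
      simp only [real_inner_comm]
    rw [hx₀, Submodule.coe_inner, ← hιZ] at h1
    have h2 : ∫ s in (0 : ℝ)..t, inner ℝ (F s (y s)) (⟨ι v, hEG v hv⟩ : G) =
        ∫ s in (0 : ℝ)..t, (A s (Z s) v + inner ℝ ((B s (Z s)).toCLM (h s)) (ι v)) := by
      refine intervalIntegral.integral_congr fun s hs => ?_
      rw [Set.uIcc_of_le ht.1] at hs
      rw [hFy s ⟨hs.1, hs.2.trans ht.2⟩, inner_galerkinField, hlE v _ hv]
    rw [h2, intervalIntegral.integral_add] at h1
    · linarith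
    · exact intervalIntegrable_of_timeMeasure
        (hyp.integrable_drift_apply hZL hZM' (memLp_const v)) h0T ht
    · exact intervalIntegrable_of_timeMeasure (hBi.inner_const (ι v)) h0T ht
  · have h1 := henergy T hTT
    have h2 : ∫ s in (0 : ℝ)..T, 2 * inner ℝ (F s (y s)) (y s) =
        ∫ s in (0 : ℝ)..T, 2 * (A s (Z s) (Z s) +
          inner ℝ ((B s (Z s)).toCLM (h s)) (ι (Z s))) := by
      refine intervalIntegral.integral_congr fun s hs => ?_
      rw [Set.uIcc_of_le hT.le] at hs
      rw [hFy s hs, inner_galerkinField, hιZ]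
    rw [h2, intervalIntegral.integral_const_mul, intervalIntegral.integral_add] at h1
    · rw [hιZ, ← Submodule.coe_norm]
      linarith
    · exact intervalIntegrable_of_timeMeasure (hyp.integrable_drift_apply hZL hZM' hZL) h0T hTT
    · refine intervalIntegrable_of_timeMeasure ((hBi.norm.mul_const M).mono'
        (hBi.1.inner (ι.continuous.comp_aestronglyMeasurable hZL.1)) ?_) h0T hTT
      filter_upwards [hZM'] with s hs
      exact (norm_inner_le_norm _ _).trans (by gcongr)

end Assumptions
end GalerkinSolution

/-! ### Equicontinuity and weak limits of Galerkin solutions. -/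

section GalerkinSequence

set_option linter.unusedSectionVars false

variable {V H U : Type*} [NormedAddCommGroup V] [NormedSpace ℝ V] [CompleteSpace V]
  [MeasurableSpace V] [BorelSpace V]
  [NormedAddCommGroup H] [InnerProductSpace ℝ H] [CompleteSpace H]
  [TopologicalSpace.SeparableSpace H]
  [NormedAddCommGroup U] [InnerProductSpace ℝ U] [CompleteSpace U]
  [TopologicalSpace.SeparableSpace U]
  {ι : V →L[ℝ] H} {T α : ℝ} {f : ℝ → ℝ} {A : ℝ → V → StrongDual ℝ V}
  {B : ℝ → V → HilbertSchmidt U H}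

/-- A sequence of Galerkin solutions for the spans of the first elements of the sequence `d`. -/
structure GalerkinSeq (ι : V →L[ℝ] H) (T α : ℝ) (A : ℝ → V → StrongDual ℝ V)
    (B : ℝ → V → HilbertSchmidt U H) (h : ℝ → U) (x : H) (d : ℕ → V) (M C : ℝ)
    (Z : ℕ → ℝ → V) : Prop where
  continuous : ∀ n, Continuous (Z n)
  norm_le : ∀ n, ∀ t ∈ Set.Icc 0 T, ‖ι (Z n t)‖ ≤ M
  integral_le : ∀ n, ∫ s, ‖Z n s‖ ^ α ∂timeMeasure T ≤ C
  weak_eq : ∀ j, ∀ n ≥ j, ∀ t ∈ Set.Icc 0 T, inner ℝ (ι (Z n t)) (ι (d j)) =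
    inner ℝ x (ι (d j)) + (∫ s in (0 : ℝ)..t, A s (Z n s) (d j)) +
      ∫ s in (0 : ℝ)..t, inner ℝ ((B s (Z n s)).toCLM (h s)) (ι (d j))
  energy : ∀ n, ‖ι (Z n T)‖ ^ 2 ≤ ‖x‖ ^ 2 + 2 * (∫ s in (0 : ℝ)..T, A s (Z n s) (Z n s)) +
    2 * ∫ s in (0 : ℝ)..T, inner ℝ ((B s (Z n s)).toCLM (h s)) (ι (Z n s))

theorem GalerkinSeq.comp {h : ℝ → U} {x : H} {d : ℕ → V} {M C : ℝ} {Z : ℕ → ℝ → V}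
    (hZ : GalerkinSeq ι T α A B h x d M C Z) {φ : ℕ → ℕ} (hφ : StrictMono φ) :
    GalerkinSeq ι T α A B h x d M C fun n => Z (φ n) where
  continuous _ := hZ.continuous _
  norm_le _ := hZ.norm_le _
  integral_le _ := hZ.integral_le _
  weak_eq j _ hn := hZ.weak_eq j _ (hn.le.trans hφ.le_apply)
  energy _ := hZ.energy _

theorem GalerkinSeq.ae_norm_le {h : ℝ → U} {x : H} {d : ℕ → V} {M C : ℝ} {Z : ℕ → ℝ → V}
    (hZ : GalerkinSeq ι T α A B h x d M C Z) :
    ∀ᵐ t ∂timeMeasure T, ∀ n, ‖ι (Z n t)‖ ≤ M :=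
  ae_timeMeasure_iff.2 (Eventually.of_forall fun t ht n => hZ.norm_le n t ht)

theorem integrable_norm_rpow_of_memLp {μ : Measure ℝ} {E : Type*} [NormedAddCommGroup E]
    {Z : ℝ → E} (hα : 0 < α) (hZ : MemLp Z (ENNReal.ofReal α) μ) :
    Integrable (fun s => ‖Z s‖ ^ α) μ := by
  have := hZ.integrable_norm_rpow (by simpa using hα) ENNReal.ofReal_ne_top
  rwa [ENNReal.toReal_ofReal hα.le] at this

theorem le_one_add_rpow {r p : ℝ} (hr : 0 ≤ r) (hp : 1 ≤ p) : r ≤ 1 + r ^ p := by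
  rcases le_total r 1 with h | h
  · have : 0 ≤ r ^ p := by positivity
    linarith
  · have := Real.self_le_rpow_of_one_le h hp
    linarith

namespace Assumptions

theorem exists_galerkinSeq (hyp : Assumptions ι T α f A B)
    {h : ℝ → U} (hh : MemLp h 2 (timeMeasure T)) (x : H) :
    ∃ (d : ℕ → V) (M C : ℝ) (Z : ℕ → ℝ → V), DenseRange d ∧ 0 ≤ M ∧
      GalerkinSeq ι T α A B h x d M C Z := by
  have := hyp.separableSpace
  obtain ⟨M, C, hM, hex⟩ := hyp.exists_galerkin hh x
  let d : ℕ → V := TopologicalSpace.denseSeq V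
  let E : ℕ → Submodule ℝ V := fun n => Submodule.span ℝ (d '' Set.Iic n)
  have hE : ∀ n, FiniteDimensional ℝ (E n) := fun n =>
    FiniteDimensional.span_of_finite ℝ ((Set.finite_Iic n).image d)
  choose Z h1 h2 h3 h4 h5 using fun n => hex (E n) (hE n)
  exact ⟨d, M, C, Z, TopologicalSpace.denseRange_denseSeq V, hM,
    ⟨h1, h2, h3, fun j n hn => h4 n _ (Submodule.subset_span ⟨j, hn, rfl⟩), h5⟩⟩

variable {h : ℝ → U} {x : H} {d : ℕ → V} {M C : ℝ} {Z : ℕ → ℝ → V}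

/-- The drifts of the Galerkin solutions are bounded in `L^q(0, T; V*)`. -/
theorem exists_galerkin_drift_bound (hyp : Assumptions ι T α f A B)
    (hZ : GalerkinSeq ι T α A B h x d M C Z) :
    ∃ Q : ℝ, 0 ≤ Q ∧ ∀ n,
      ∫⁻ s, ‖A s (Z n s)‖ₑ ^ (α / (α - 1)) ∂timeMeasure T ≤ ENNReal.ofReal Q := by
  obtain ⟨D, hD, hDb⟩ := hyp.exists_drift_bound M
  refine ⟨max 0 (D * ((∫ s, f s ∂timeMeasure T) + C)), le_max_left _ _, fun n => ?_⟩
  refine (hDb (Z n) (hyp.memLp_of_continuous (hZ.continuous n) _)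
    (hZ.ae_norm_le.mono fun t ht => ht n)).trans (ENNReal.ofReal_le_ofReal ?_)
  refine le_trans ?_ (le_max_right _ _)
  gcongr
  exact hZ.integral_le n

theorem integrable_drift_rpow (hyp : Assumptions ι T α f A B)
    {W : ℝ → V} (hW : MemLp W (ENNReal.ofReal α) (timeMeasure T))
    (hM : ∀ᵐ t ∂timeMeasure T, ‖ι (W t)‖ ≤ M) :
    Integrable (fun s => ‖A s (W s)‖ ^ (α / (α - 1))) (timeMeasure T) := by
  obtain ⟨D, hD, hDb⟩ := hyp.exists_growth M
  have hα0 : 0 < α := one_pos.trans hyp.one_lt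
  refine ((hyp.isL1Nonneg.1.add (integrable_norm_rpow_of_memLp hα0 hW)).const_mul D).mono' ?_ ?_
  · exact ((hyp.aestronglyMeasurable_drift hW.1).norm.aemeasurable.pow_const _).aestronglyMeasurable
  · filter_upwards [hDb, hM] with s h1 h2
    rw [Real.norm_of_nonneg (by positivity)]
    exact h1 _ h2

theorem integrable_drift (hyp : Assumptions ι T α f A B)
    {W : ℝ → V} (hW : MemLp W (ENNReal.ofReal α) (timeMeasure T))
    (hM : ∀ᵐ t ∂timeMeasure T, ‖ι (W t)‖ ≤ M) :
    Integrable (fun s => A s (W s)) (timeMeasure T) := by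
  have hfin : IsFiniteMeasure (timeMeasure T) := by unfold timeMeasure; infer_instance
  refine ((integrable_const (1 : ℝ)).add (hyp.integrable_drift_rpow hW hM)).mono'
    (hyp.aestronglyMeasurable_drift hW.1) (Eventually.of_forall fun s => ?_)
  exact le_one_add_rpow (norm_nonneg _) (holderConjugate_of_one_lt hyp.one_lt).lt.le

/-- Young's inequality bounds the drift term by a small multiple of `‖A r (Z n r)‖ ^ q`, whose
integral is at most `Q` for all `n`, plus a constant times the length of the time interval. The
diffusion term is controlled by the primitive of its common majorant. The condition `n ≥ j` ensures
that `d j` is an admissible test vector. -/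
theorem galerkin_equicontinuous (hyp : Assumptions ι T α f A B) (hh : MemLp h 2 (timeMeasure T))
    (hZ : GalerkinSeq ι T α A B h x d M C Z) (j : ℕ) {ε : ℝ} (hε : 0 < ε) :
    ∃ δ > 0, ∀ n ≥ j, ∀ s ∈ Set.Icc 0 T, ∀ t ∈ Set.Icc 0 T, |s - t| < δ →
      |inner ℝ (ι (d j)) (ι (Z n s)) - inner ℝ (ι (d j)) (ι (Z n t))| < ε := by
  have hT := hyp.time_pos
  have h0T : (0 : ℝ) ∈ Set.Icc 0 T := ⟨le_rfl, hT.le⟩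
  have hα0 : 0 < α := one_pos.trans hyp.one_lt
  have hq := holderConjugate_of_one_lt hyp.one_lt
  obtain ⟨D, hD, hDb⟩ := hyp.exists_growth M
  obtain ⟨g, hg, hgb⟩ := hyp.exists_diffusion_bound hh M
  set Q := |D * ((∫ s, f s ∂timeMeasure T) + C)| with hQ
  set b := ‖d j‖ + 1 with hb
  have hbpos : 0 < b := by positivity
  set b' := ‖ι (d j)‖ + 1 with hb'
  have hb'pos : 0 < b' := by positivity
  obtain ⟨Cy, hCy, hy⟩ := exists_young hq (η := ε / (4 * b * (Q + 1))) (by positivity)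
  let K : ℝ → ℝ := fun t => ∫ s in (0 : ℝ)..t, g s
  have hKc : ContinuousOn K (Set.Icc 0 T) := continuousOn_primitive_timeMeasure hg
  obtain ⟨δ, hδ, hδK⟩ := Metric.uniformContinuousOn_iff.1
    (isCompact_Icc.uniformContinuousOn_of_continuous hKc) (ε / (4 * b')) (by positivity)
  have hmain : ∀ n ≥ j, ∀ s ∈ Set.Icc 0 T, ∀ t ∈ Set.Icc 0 T, s ≤ t →
      |s - t| < min δ (ε / (4 * b * (Cy + 1))) →
      |inner ℝ (ι (d j)) (ι (Z n s)) - inner ℝ (ι (d j)) (ι (Z n t))| < ε := by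
    intro n hn s hs t ht hst hlt
    have hMn : ∀ᵐ t ∂timeMeasure T, ‖ι (Z n t)‖ ≤ M := hZ.ae_norm_le.mono fun t ht => ht n
    have hZL := hyp.memLp_of_continuous (hZ.continuous n) (ENNReal.ofReal α)
    have hfin : IsFiniteMeasure (timeMeasure T) := by unfold timeMeasure; infer_instance
    have hAi := hyp.integrable_drift_apply hZL hMn (memLp_const (d j))
    have hBi := (hyp.integrable_diffusion hh hZL.1 hMn).inner_const (𝕜 := ℝ) (ι (d j))
    have hAr := hyp.integrable_drift_rpow hZL hMn
    have e : inner ℝ (ι (d j)) (ι (Z n s)) - inner ℝ (ι (d j)) (ι (Z n t)) =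
        -((∫ r in s..t, A r (Z n r) (d j)) +
          ∫ r in s..t, inner ℝ ((B r (Z n r)).toCLM (h r)) (ι (d j))) := by
      rw [real_inner_comm, real_inner_comm (ι (Z n t)), hZ.weak_eq j n hn s hs,
        hZ.weak_eq j n hn t ht,
        ← intervalIntegral.integral_add_adjacent_intervals
          (intervalIntegrable_of_timeMeasure hAi h0T hs)
          (intervalIntegrable_of_timeMeasure hAi hs ht),
        ← intervalIntegral.integral_add_adjacent_intervals
          (intervalIntegrable_of_timeMeasure hBi h0T hs)
          (intervalIntegrable_of_timeMeasure hBi hs ht)]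
      ring
    have hArQ : ∫ r in s..t, ‖A r (Z n r)‖ ^ (α / (α - 1)) ≤ Q := by
      have h1 : ∫ r in s..t, ‖A r (Z n r)‖ ^ (α / (α - 1)) ≤
          ∫ r, ‖A r (Z n r)‖ ^ (α / (α - 1)) ∂timeMeasure T := by
        rw [intervalIntegral.integral_of_le hst]
        refine setIntegral_mono_set hAr (Eventually.of_forall fun r => by positivity) ?_
        exact (Set.Ioc_subset_Icc_self.trans (Set.Icc_subset_Icc hs.1 ht.2)).eventuallyLE
      have hZi := integrable_norm_rpow_of_memLp hα0 hZL
      have h2 : ∫ r, ‖A r (Z n r)‖ ^ (α / (α - 1)) ∂timeMeasure T ≤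
          ∫ r, D * (f r + ‖Z n r‖ ^ α) ∂timeMeasure T := by
        refine integral_mono_ae hAr ((hyp.isL1Nonneg.1.add hZi).const_mul D) ?_
        filter_upwards [hDb, hMn] with r h3 h4
        exact h3 _ h4
      rw [integral_const_mul, integral_add hyp.isL1Nonneg.1 hZi] at h2
      have h3 : D * ((∫ r, f r ∂timeMeasure T) + ∫ r, ‖Z n r‖ ^ α ∂timeMeasure T) ≤
          D * ((∫ s, f s ∂timeMeasure T) + C) := by
        gcongr
        exact hZ.integral_le n
      exact h1.trans (h2.trans (h3.trans (le_abs_self _)))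
    have hA : |∫ r in s..t, A r (Z n r) (d j)| ≤ ε / 2 := by
      have h1 : |∫ r in s..t, A r (Z n r) (d j)| ≤
          ∫ r in s..t, b * (ε / (4 * b * (Q + 1)) * ‖A r (Z n r)‖ ^ (α / (α - 1)) + Cy) := by
        rw [← Real.norm_eq_abs]
        refine intervalIntegral.norm_integral_le_of_norm_le hst
          (Eventually.of_forall fun r _ => ?_) ?_
        · have h2 := hy ‖A r (Z n r)‖ 1 (norm_nonneg _) zero_le_one
          rw [Real.one_rpow, mul_one, mul_one] at h2
          calc ‖A r (Z n r) (d j)‖ ≤ ‖A r (Z n r)‖ * ‖d j‖ := (A r (Z n r)).le_opNorm _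
            _ ≤ ‖A r (Z n r)‖ * b := by gcongr; linarith
            _ ≤ (ε / (4 * b * (Q + 1)) * ‖A r (Z n r)‖ ^ (α / (α - 1)) + Cy) * b := by gcongr
            _ = _ := mul_comm _ _
        · exact (((intervalIntegrable_of_timeMeasure hAr hs ht).const_mul _).add
            intervalIntegrable_const).const_mul _
      rw [intervalIntegral.integral_const_mul, intervalIntegral.integral_add
        ((intervalIntegrable_of_timeMeasure hAr hs ht).const_mul _) intervalIntegrable_const,
        intervalIntegral.integral_const_mul, intervalIntegral.integral_const, smul_eq_mul] at h1
      have h3 : ε / (4 * b * (Q + 1)) * ∫ r in s..t, ‖A r (Z n r)‖ ^ (α / (α - 1)) ≤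
          ε / (4 * b) := by
        have hQ1 : Q + 1 ≠ 0 := by positivity
        calc _ ≤ ε / (4 * b * (Q + 1)) * (Q + 1) := by gcongr; linarith
          _ = ε / (4 * b) := by field_simp
      have h4 : (t - s) * Cy ≤ ε / (4 * b) := by
        have h5 : t - s ≤ ε / (4 * b * (Cy + 1)) := by
          have := hlt.trans_le (min_le_right _ _)
          rw [abs_sub_comm] at this
          exact (le_abs_self _).trans this.le
        calc (t - s) * Cy ≤ ε / (4 * b * (Cy + 1)) * (Cy + 1) := by gcongr; linarith
          _ = ε / (4 * b) := by field_simp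
      calc _ ≤ _ := h1
        _ ≤ b * (ε / (4 * b) + ε / (4 * b)) := by gcongr
        _ = ε / 2 := by field_simp; norm_num
    have hB : |∫ r in s..t, inner ℝ ((B r (Z n r)).toCLM (h r)) (ι (d j))| ≤ ε / 4 := by
      have h1 : |∫ r in s..t, inner ℝ ((B r (Z n r)).toCLM (h r)) (ι (d j))| ≤
          ∫ r in s..t, g r * ‖ι (d j)‖ := by
        rw [← Real.norm_eq_abs]
        refine intervalIntegral.norm_integral_le_of_norm_le hst ?_
          ((intervalIntegrable_of_timeMeasure hg hs ht).mul_const _)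
        filter_upwards [ae_timeMeasure_iff.1 hgb] with r hr hrs
        have hrT : r ∈ Set.Icc 0 T := ⟨hs.1.trans hrs.1.le, hrs.2.trans ht.2⟩
        exact (norm_inner_le_norm _ _).trans (by
          gcongr
          exact hr hrT _ (hZ.norm_le n r hrT))
      have h2 := hδK s hs t ht (by
        rw [Real.dist_eq]; exact hlt.trans_le (min_le_left _ _))
      have h3 : ∫ r in s..t, g r = K t - K s :=
        (intervalIntegral.integral_interval_sub_left
          (intervalIntegrable_of_timeMeasure hg h0T ht)
          (intervalIntegrable_of_timeMeasure hg h0T hs)).symm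
      rw [intervalIntegral.integral_mul_const, h3] at h1
      rw [Real.dist_eq, abs_sub_comm] at h2
      calc _ ≤ _ := h1
        _ ≤ ε / (4 * b') * b' := by
          refine mul_le_mul ((le_abs_self _).trans h2.le) (by linarith) (norm_nonneg _)
            (by positivity)
        _ = ε / 4 := by field_simp
    rw [e, abs_neg]
    refine (abs_add_le _ _).trans_lt ?_
    linarith
  refine ⟨min δ (ε / (4 * b * (Cy + 1))), lt_min hδ (by positivity), fun n hn s hs t ht hst => ?_⟩
  rcases le_total s t with hle | hle
  · exact hmain n hn s hs t ht hle hst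
  · rw [abs_sub_comm]
    refine hmain n hn t ht s hs hle ?_
    rwa [abs_sub_comm]

/-- A subsequence of the Galerkin solutions converges weakly in `H` at every time, to a weakly
continuous function. -/
theorem exists_galerkin_weak_limit (hyp : Assumptions ι T α f A B)
    (hh : MemLp h 2 (timeMeasure T)) (hd : DenseRange d)
    (hM : 0 ≤ M) (hZ : GalerkinSeq ι T α A B h x d M C Z) :
    ∃ (φ : ℕ → ℕ) (Y : ℝ → H), StrictMono φ ∧
      (∀ t ∈ Set.Icc 0 T, ∀ z, Tendsto (fun n => inner ℝ z (ι (Z (φ n) t))) atTop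
        (𝓝 (inner ℝ z (Y t)))) ∧
      (∀ t ∈ Set.Icc 0 T, ‖Y t‖ ≤ M) ∧
      (∀ z, ContinuousOn (fun t => inner ℝ z (Y t)) (Set.Icc 0 T)) ∧ Y 0 = x := by
  have hdH : DenseRange fun j => ι (d j) := hyp.embedding.denseRange.comp hd ι.continuous
  have h0T : (0 : ℝ) ∈ Set.Icc 0 T := ⟨le_rfl, hyp.time_pos.le⟩
  obtain ⟨φ, hφ, hlim⟩ := exists_subseq_tendsto_of_equicontinuous (S := Set.Icc 0 T)
    (u := fun n t (j : ℕ) => inner ℝ (ι (d j)) (ι (Z n t)))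
    (by
      intro j t ht
      refine ⟨0, ‖ι (d j)‖ * M, fun n => ?_⟩
      rw [mem_closedBall_zero_iff]
      exact (norm_inner_le_norm _ _).trans (by gcongr; exact hZ.norm_le n t ht))
    (by
      intro j ε hε
      obtain ⟨δ, hδ, h1⟩ := hyp.galerkin_equicontinuous hh hZ j hε
      exact ⟨δ, hδ, j, h1⟩)
  have hw : ∀ t, ∃ w : H, t ∈ Set.Icc 0 T → ∀ z,
      Tendsto (fun n => inner ℝ z (ι (Z (φ n) t))) atTop (𝓝 (inner ℝ z w)) := by
    intro t
    by_cases ht : t ∈ Set.Icc 0 T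
    · obtain ⟨w, hw⟩ := exists_weak_limit hdH (y := fun n => ι (Z (φ n) t))
        (fun n => hZ.norm_le _ t ht) (fun j => hlim j t ht)
      exact ⟨w, fun _ => hw⟩
    · exact ⟨0, fun h => absurd h ht⟩
  choose Y hY using hw
  have hYM : ∀ t ∈ Set.Icc 0 T, ‖Y t‖ ≤ M := fun t ht =>
    norm_le_of_weak_limit (Eventually.frequently (Eventually.of_forall fun n =>
      hZ.norm_le (φ n) t ht)) hM (hY t ht)
  refine ⟨φ, Y, hφ, hY, hYM, ?_, ?_⟩
  · refine continuousOn_inner_of_denseRange hdH hYM fun j => ?_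
    rw [Metric.continuousOn_iff]
    intro t ht ε hε
    obtain ⟨δ, hδ, h1⟩ := hyp.galerkin_equicontinuous hh hZ j (half_pos hε)
    refine ⟨δ, hδ, fun s hs hst => ?_⟩
    have h2 : |inner ℝ (ι (d j)) (Y s) - inner ℝ (ι (d j)) (Y t)| ≤ ε / 2 := by
      refine le_of_tendsto ((hY s hs _).sub (hY t ht _)).abs ?_
      filter_upwards [hφ.tendsto_atTop.eventually_ge_atTop j] with n hn
      exact (h1 (φ n) hn s hs t ht (by rwa [Real.dist_eq] at hst)).le
    rw [Real.dist_eq]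
    linarith
  · refine hdH.eq_of_inner_right ℝ fun j => ?_
    refine tendsto_nhds_unique (hY 0 h0T (ι (d j))) ?_
    refine tendsto_const_nhds.congr' ?_
    filter_upwards [hφ.tendsto_atTop.eventually_ge_atTop j] with n hn
    have := hZ.weak_eq j (φ n) hn 0 h0T
    rw [intervalIntegral.integral_same, intervalIntegral.integral_same, add_zero, add_zero] at this
    rw [real_inner_comm, ← this, real_inner_comm]

end Assumptions
end GalerkinSequence

/-! ### Regularity of the weak limit and strong convergence in `H`. -/

section StrongLimit

set_option linter.unusedSectionVars false

/-- A sequence that tends to zero in `L¹` has a subsequence that tends to zero almost everywhere and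
is dominated by an integrable function. -/
theorem exists_subseq_dominated {μ : Measure ℝ} {g : ℕ → ℝ → ℝ} (hg : ∀ n, Integrable (g n) μ)
    (h0 : ∀ n s, 0 ≤ g n s) (hlim : Tendsto (fun n => ∫ s, g n s ∂μ) atTop (𝓝 0)) :
    ∃ (ψ : ℕ → ℕ) (Γ : ℝ → ℝ), StrictMono ψ ∧ Integrable Γ μ ∧
      ∀ᵐ s ∂μ, (∀ n, g (ψ n) s ≤ Γ s) ∧ Tendsto (fun n => g (ψ n) s) atTop (𝓝 0) := by
  -- With integrals at most `2⁻ⁿ`, the sum of the subsequence is integrable: it dominates every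
  -- term, and its convergence forces the terms to zero.
  obtain ⟨ψ, hψ, hψb⟩ := extraction_forall_of_eventually'
    (P := fun n k => ∫ s, g k s ∂μ ≤ (1 / 2) ^ n) (fun n => by
      obtain ⟨N, hN⟩ := eventually_atTop.1
        (hlim.eventually (gt_mem_nhds (show (0 : ℝ) < (1 / 2) ^ n by positivity)))
      exact ⟨N, fun k hk => (hN k hk).le⟩)
  let S : ℝ → ℝ≥0∞ := fun s => ∑' n, ENNReal.ofReal (g (ψ n) s)
  have hSm : AEMeasurable S μ := AEMeasurable.tsum fun n => (hg _).1.aemeasurable.ennreal_ofReal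
  have hS : ∫⁻ s, S s ∂μ ≠ ∞ := by
    rw [lintegral_tsum fun n => (hg _).1.aemeasurable.ennreal_ofReal]
    have h1 : ∑' n, ∫⁻ s, ENNReal.ofReal (g (ψ n) s) ∂μ ≤ ∑' n : ℕ, ENNReal.ofReal ((1 / 2) ^ n) := by
      refine ENNReal.tsum_le_tsum fun n => ?_
      rw [← ofReal_integral_eq_lintegral_ofReal (hg _) (Eventually.of_forall (h0 _))]
      exact ENNReal.ofReal_le_ofReal (hψb n)
    refine ne_top_of_le_ne_top ?_ h1
    rw [← ENNReal.ofReal_tsum_of_nonneg (fun n => by positivity) summable_geometric_two]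
    exact ENNReal.ofReal_ne_top
  refine ⟨ψ, fun s => (S s).toReal, hψ, integrable_toReal_of_lintegral_ne_top hSm hS, ?_⟩
  filter_upwards [ae_lt_top' hSm hS] with s hs
  constructor
  · intro n
    rw [← ENNReal.ofReal_le_iff_le_toReal hs.ne]
    exact ENNReal.le_tsum n
  · have h1 := ENNReal.tendsto_atTop_zero_of_tsum_ne_top hs.ne
    have h2 := (ENNReal.tendsto_toReal ENNReal.zero_ne_top).comp h1
    simp only [ENNReal.toReal_zero] at h2
    refine h2.congr fun n => ?_
    exact ENNReal.toReal_ofReal (h0 _ _)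

/-- A measurable function with values in the range of a continuous injection lifts to a measurable
function. -/
theorem exists_aestronglyMeasurable_lift {V H : Type*} [NormedAddCommGroup V] [NormedSpace ℝ V]
    [CompleteSpace V] [TopologicalSpace.SeparableSpace V] [NormedAddCommGroup H]
    [InnerProductSpace ℝ H] {ι : V →L[ℝ] H} (hι : Function.Injective ι)
    {μ : Measure ℝ} {Y : ℝ → H} (hY : AEStronglyMeasurable Y μ) (h : ∀ᵐ t ∂μ, ∃ u, ι u = Y t) :
    ∃ W : ℝ → V, AEStronglyMeasurable W μ ∧ ∀ᵐ t ∂μ, ι (W t) = Y t := by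
  borelize V H
  have : SecondCountableTopology V := UniformSpace.secondCountable_of_separable V
  -- A continuous injection of a Polish space is a measurable embedding (Lusin–Souslin), so `ι` has
  -- a measurable left inverse defined on all of `H`.
  obtain ⟨j, hj, hji⟩ := (ι.continuous.measurableEmbedding hι).exists_measurable_extend
    (f := ι) (g := (id : V → V)) measurable_id (fun _ => inferInstance)
  refine ⟨fun t => j (Y t), (hj.comp_aemeasurable hY.aemeasurable).aestronglyMeasurable, ?_⟩
  filter_upwards [h] with t ⟨u, hu⟩
  rw [← hu]
  exact congrArg ι (congrFun hji u)

variable {V H U : Type*} [NormedAddCommGroup V] [NormedSpace ℝ V] [CompleteSpace V]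
  [MeasurableSpace V] [BorelSpace V]
  [NormedAddCommGroup H] [InnerProductSpace ℝ H] [CompleteSpace H]
  [TopologicalSpace.SeparableSpace H]
  [NormedAddCommGroup U] [InnerProductSpace ℝ U] [CompleteSpace U]
  [TopologicalSpace.SeparableSpace U]
  {ι : V →L[ℝ] H} {T α : ℝ} {f : ℝ → ℝ} {A : ℝ → V → StrongDual ℝ V}
  {B : ℝ → V → HilbertSchmidt U H}

namespace Assumptions

variable {h : ℝ → U} {x : H} {d : ℕ → V} {M C : ℝ} {Z : ℕ → ℝ → V} {Y : ℝ → H}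

/-- The weak limit of the Galerkin solutions lies in `L^α(0, T; V)`. -/
theorem exists_galerkin_limit_memLp (hyp : Assumptions ι T α f A B)
    (hZ : GalerkinSeq ι T α A B h x d M C Z)
    (hY : ∀ t ∈ Set.Icc 0 T, ∀ z, Tendsto (fun n => inner ℝ z (ι (Z n t))) atTop
        (𝓝 (inner ℝ z (Y t)))) :
    ∃ W : ℝ → V, MemLp W (ENNReal.ofReal α) (timeMeasure T) ∧
      ∀ᵐ t ∂timeMeasure T, ι (W t) = Y t := by
  have hfin : IsFiniteMeasure (timeMeasure T) := by unfold timeMeasure; infer_instance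
  have hα0 : 0 < α := one_pos.trans hyp.one_lt
  have := hyp.separableSpace
  have : SecondCountableTopology V := UniformSpace.secondCountable_of_separable V
  have hYae : ∀ᵐ t ∂timeMeasure T, ∀ z, Tendsto (fun n => inner ℝ z (ι (Z n t))) atTop
      (𝓝 (inner ℝ z (Y t))) := ae_timeMeasure_iff.2 (Eventually.of_forall hY)
  have hYm : AEStronglyMeasurable Y (timeMeasure T) := by
    refine aestronglyMeasurable_of_inner fun z => ?_
    refine aestronglyMeasurable_of_tendsto_ae atTop (f := fun n t => inner ℝ z (ι (Z n t)))
      (fun n => ?_) (hYae.mono fun t ht => ht z)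
    have := hZ.continuous n
    exact Continuous.aestronglyMeasurable (by fun_prop)
  -- By Fatou's lemma this lower limit is integrable. Where it is finite, infinitely many `Z n t`
  -- share a bound in `V`, and that places `Y t` in `V`; the added `1` below makes the bound strict.
  let L : ℝ → ℝ≥0∞ := fun s => liminf (fun n => ‖Z n s‖ₑ ^ α) atTop
  have hZm : ∀ n, Measurable fun s => ‖Z n s‖ₑ ^ α := fun n =>
    ((hZ.continuous n).enorm.measurable).pow_const _
  have hLm : Measurable L := Measurable.liminf hZm
  have hL : ∫⁻ s, L s ∂timeMeasure T ≤ ENNReal.ofReal C := by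
    refine (lintegral_liminf_le hZm).trans ?_
    refine liminf_le_of_le (by isBoundedDefault) fun b hb => ?_
    obtain ⟨n, hn⟩ := hb.exists
    refine hn.trans ?_
    have h1 := integrable_norm_rpow_of_memLp hα0
      (hyp.memLp_of_continuous (hZ.continuous n) (ENNReal.ofReal α))
    calc ∫⁻ s, ‖Z n s‖ₑ ^ α ∂timeMeasure T
        = ∫⁻ s, ENNReal.ofReal (‖Z n s‖ ^ α) ∂timeMeasure T := by
          refine lintegral_congr fun s => ?_
          rw [← ofReal_norm, ENNReal.ofReal_rpow_of_nonneg (norm_nonneg _) hα0.le]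
      _ = ENNReal.ofReal (∫ s, ‖Z n s‖ ^ α ∂timeMeasure T) :=
          (ofReal_integral_eq_lintegral_ofReal h1
            (Eventually.of_forall fun s => by positivity)).symm
      _ ≤ ENNReal.ofReal C := ENNReal.ofReal_le_ofReal (hZ.integral_le n)
  have hex : ∀ᵐ t ∂timeMeasure T, ∃ u, ι u = Y t ∧ ‖u‖ₑ ^ α ≤ L t + 1 := by
    filter_upwards [ae_lt_top hLm (hL.trans_lt ENNReal.ofReal_lt_top).ne, hYae] with t ht hYt
    have h1 : ∃ᶠ n in atTop, ‖Z n t‖ₑ ^ α < L t + 1 :=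
      frequently_lt_of_liminf_lt (by isBoundedDefault)
        (ENNReal.lt_add_right ht.ne one_ne_zero)
    obtain ⟨u, hu, hun⟩ := exists_eq_of_weak_limit hyp.reflexive hyp.embedding.denseRange
      (w := fun n => Z n t) (y := Y t) (M := ((L t + 1) ^ α⁻¹).toReal)
      ENNReal.toReal_nonneg (h1.mono fun n hn => by
        have h2 : ‖Z n t‖ₑ ≤ (L t + 1) ^ α⁻¹ := by
          rw [ENNReal.le_rpow_inv_iff hα0]
          exact hn.le
        have h3 := ENNReal.toReal_mono (ENNReal.rpow_ne_top_of_nonneg (by positivity)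
          (ENNReal.add_ne_top.2 ⟨ht.ne, ENNReal.one_ne_top⟩)) h2
        rwa [toReal_enorm] at h3) hYt
    refine ⟨u, hu, ?_⟩
    rw [← ENNReal.le_rpow_inv_iff hα0, ← ofReal_norm]
    exact (ENNReal.ofReal_le_iff_le_toReal (ENNReal.rpow_ne_top_of_nonneg (by positivity)
          (ENNReal.add_ne_top.2 ⟨ht.ne, ENNReal.one_ne_top⟩))).2 hun
  obtain ⟨W, hWm, hW⟩ := exists_aestronglyMeasurable_lift hyp.embedding.injective hYm
    (hex.mono fun t ⟨u, hu, _⟩ => ⟨u, hu⟩)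
  refine ⟨W, ⟨hWm, ?_⟩, hW⟩
  rw [eLpNorm_lt_top_iff_lintegral_rpow_enorm_lt_top (by simpa using hα0) ENNReal.ofReal_ne_top,
    ENNReal.toReal_ofReal hα0.le]
  calc ∫⁻ s, ‖W s‖ₑ ^ α ∂timeMeasure T ≤ ∫⁻ s, (L s + 1) ∂timeMeasure T := by
        refine lintegral_mono_ae ?_
        filter_upwards [hex, hW] with t ⟨u, hu, hun⟩ ht
        rwa [hyp.embedding.injective (ht.trans hu.symm)]
    _ = (∫⁻ s, L s ∂timeMeasure T) + timeMeasure T Set.univ := by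
        rw [lintegral_add_right _ measurable_const, lintegral_one]
    _ < ∞ := ENNReal.add_lt_top.2 ⟨hL.trans_lt ENNReal.ofReal_lt_top, measure_lt_top _ _⟩

/-- The Galerkin solutions converge in `L¹(0, T; H)`. -/
theorem tendsto_integral_galerkin_sub (hyp : Assumptions ι T α f A B) (hd : DenseRange d)
    (hZ : GalerkinSeq ι T α A B h x d M C Z)
    (hY : ∀ t ∈ Set.Icc 0 T, ∀ z, Tendsto (fun n => inner ℝ z (ι (Z n t))) atTop
        (𝓝 (inner ℝ z (Y t)))) (hYM : ∀ t ∈ Set.Icc 0 T, ‖Y t‖ ≤ M) {W : ℝ → V}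
    (hW : MemLp W (ENNReal.ofReal α) (timeMeasure T))
    (hWY : ∀ᵐ t ∂timeMeasure T, ι (W t) = Y t) :
    Tendsto (fun n => ∫ s, ‖ι (Z n s - W s)‖ ∂timeMeasure T) atTop (𝓝 0) := by
  have hfin : IsFiniteMeasure (timeMeasure T) := by unfold timeMeasure; infer_instance
  have hα0 : 0 < α := one_pos.trans hyp.one_lt
  have hdH : DenseRange fun j => ι (d j) := hyp.embedding.denseRange.comp hd ι.continuous
  have hα1 : (1 : ℝ≥0∞) ≤ ENNReal.ofReal α := by
    rw [ENNReal.one_le_ofReal]; exact hyp.one_lt.le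
  have hZi : ∀ n, Integrable (Z n) (timeMeasure T) := fun n =>
    memLp_one_iff_integrable.1 (hyp.memLp_of_continuous (hZ.continuous n) 1)
  have hWi : Integrable W (timeMeasure T) := hW.integrable hα1
  have hi : ∀ n, Integrable (fun s => Z n s - W s) (timeMeasure T) := fun n => (hZi n).sub hWi
  have hιi : ∀ n, Integrable (fun s => ι (Z n s - W s)) (timeMeasure T) := fun n =>
    ι.integrable_comp (hi n)
  set S := (timeMeasure T).real Set.univ + |C| + ∫ s, ‖W s‖ ∂timeMeasure T + 1 with hS
  have hW0 : 0 ≤ ∫ s, ‖W s‖ ∂timeMeasure T := integral_nonneg fun _ => norm_nonneg _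
  have hSpos : 0 < S := by positivity
  have hSb : ∀ n, ∫ s, ‖Z n s - W s‖ ∂timeMeasure T ≤ S := by
    intro n
    have hZα := integrable_norm_rpow_of_memLp hα0
      (hyp.memLp_of_continuous (hZ.continuous n) (ENNReal.ofReal α))
    have h1 : ∫ s, ‖Z n s - W s‖ ∂timeMeasure T ≤
        ∫ s, ((1 + ‖Z n s‖ ^ α) + ‖W s‖) ∂timeMeasure T := by
      refine integral_mono (hi n).norm (((integrable_const _).add hZα).add hWi.norm) fun s => ?_
      refine (norm_sub_le _ _).trans ?_
      gcongr
      exact le_one_add_rpow (norm_nonneg _) hyp.one_lt.le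
    have hZα' : Integrable (fun s => 1 + ‖Z n s‖ ^ α) (timeMeasure T) :=
      (integrable_const _).add hZα
    rw [integral_add hZα' hWi.norm, integral_add (integrable_const _) hZα,
      integral_const, smul_eq_mul, mul_one] at h1
    have h2 := (hZ.integral_le n).trans (le_abs_self C)
    linarith
  have hlim : ∀ j, Tendsto (fun n => ∫ s, |inner ℝ (ι (d j)) (ι (Z n s - W s))| ∂timeMeasure T)
      atTop (𝓝 0) := by
    intro j
    have h1 : Tendsto (fun n => ∫ s, |inner ℝ (ι (d j)) (ι (Z n s - W s))| ∂timeMeasure T)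
        atTop (𝓝 (∫ _, (0 : ℝ) ∂timeMeasure T)) := by
      refine tendsto_integral_of_dominated_convergence (fun _ => ‖ι (d j)‖ * (M + M))
        (fun n => ((hιi n).const_inner (𝕜 := ℝ) (ι (d j))).abs.1) (integrable_const _)
        (fun n => ?_) ?_
      · filter_upwards [hWY, hZ.ae_norm_le,
          ae_timeMeasure_iff.2 (Eventually.of_forall hYM)] with t h1 h2 h3
        rw [Real.norm_eq_abs, abs_abs]
        refine (abs_real_inner_le_norm _ _).trans ?_
        gcongr
        rw [map_sub, h1]
        exact (norm_sub_le _ _).trans (add_le_add (h2 n) h3)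
      · filter_upwards [hWY, ae_timeMeasure_iff.2 (Eventually.of_forall hY)] with t h1 h2
        have h3 := ((h2 (ι (d j))).sub_const (inner ℝ (ι (d j)) (Y t))).abs
        rw [sub_self, abs_zero] at h3
        refine h3.congr fun n => ?_
        rw [map_sub, h1, inner_sub_right]
    simpa using h1
  rw [Metric.tendsto_atTop']
  intro ε hε
  -- `S` bounds the errors in `L¹(0, T; V)`, so the first term of Ehrling's inequality contributes
  -- at most `ε / 2`; the finitely many inner products tend to zero by weak convergence.
  obtain ⟨N, hN⟩ := ehrling hyp.embedding.compact hdH (ε := ε / (2 * S)) (by positivity)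
  have hsum : Tendsto (fun n => (N : ℝ) * ∑ j ∈ Finset.range N,
      ∫ s, |inner ℝ (ι (d j)) (ι (Z n s - W s))| ∂timeMeasure T) atTop (𝓝 0) := by
    have := (tendsto_finsetSum (Finset.range N) fun j _ => hlim j).const_mul (N : ℝ)
    simpa using this
  obtain ⟨n₀, hn₀⟩ := eventually_atTop.1
    (hsum.eventually (gt_mem_nhds (show (0 : ℝ) < ε / 2 by positivity)))
  refine ⟨n₀, fun n hn => ?_⟩
  have hai : ∀ j, Integrable (fun s => |inner ℝ (ι (d j)) (ι (Z n s - W s))|) (timeMeasure T) :=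
    fun j => ((hιi n).const_inner (𝕜 := ℝ) (ι (d j))).abs
  rw [Real.dist_eq, sub_zero, abs_of_nonneg (integral_nonneg fun _ => norm_nonneg _)]
  have h1 : ∫ s, ‖ι (Z n s - W s)‖ ∂timeMeasure T ≤ ∫ s, (ε / (2 * S) * ‖Z n s - W s‖ +
      N * ∑ j ∈ Finset.range N, |inner ℝ (ι (d j)) (ι (Z n s - W s))|) ∂timeMeasure T :=
    integral_mono (hιi n).norm (((hi n).norm.const_mul _).add
      ((integrable_finsetSum _ fun j _ => hai j).const_mul _)) fun s => hN _
  rw [integral_add ((hi n).norm.const_mul _)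
      ((integrable_finsetSum _ fun j _ => hai j).const_mul _), integral_const_mul,
    integral_const_mul, integral_finsetSum _ fun j _ => hai j] at h1
  have h2 : ε / (2 * S) * ∫ s, ‖Z n s - W s‖ ∂timeMeasure T ≤ ε / 2 := by
    calc _ ≤ ε / (2 * S) * S := by gcongr; exact hSb n
      _ = ε / 2 := by field_simp
  have h3 := hn₀ n hn.le
  linarith

end Assumptions
end StrongLimit

/-! ### Passage to the limit in the equation. -/

section GalerkinLimit

set_option linter.unusedSectionVars false

variable {V H U : Type*} [NormedAddCommGroup V] [NormedSpace ℝ V] [CompleteSpace V]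
  [MeasurableSpace V] [BorelSpace V]
  [NormedAddCommGroup H] [InnerProductSpace ℝ H] [CompleteSpace H]
  [TopologicalSpace.SeparableSpace H]
  [NormedAddCommGroup U] [InnerProductSpace ℝ U] [CompleteSpace U]
  [TopologicalSpace.SeparableSpace U]
  {ι : V →L[ℝ] H} {T α : ℝ} {f : ℝ → ℝ} {A : ℝ → V → StrongDual ℝ V}
  {B : ℝ → V → HilbertSchmidt U H}

/-- Bounded functionals that converge on a dense sequence converge everywhere. -/
theorem tendsto_apply_of_denseRange {d : ℕ → V} (hd : DenseRange d) {F : ℕ → StrongDual ℝ V}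
    {l : StrongDual ℝ V} {S : ℝ} (hS : ∀ n, ‖F n‖ ≤ S)
    (hF : ∀ j, Tendsto (fun n => F n (d j)) atTop (𝓝 (l (d j)))) (v : V) :
    Tendsto (fun n => F n v) atTop (𝓝 (l v)) := by
  have hS0 : 0 ≤ S := (norm_nonneg _).trans (hS 0)
  rw [Metric.tendsto_atTop']
  intro ε hε
  set K := S + ‖l‖ + 1 with hK
  have hKpos : 0 < K := by positivity
  obtain ⟨j, hj⟩ := hd.exists_dist_lt v (ε := ε / (2 * K)) (by positivity)
  obtain ⟨N, hN⟩ := (Metric.tendsto_atTop'.1 (hF j)) (ε / 2) (by positivity)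
  refine ⟨N, fun n hn => ?_⟩
  have h1 := hN n hn
  rw [Real.dist_eq] at h1 ⊢
  rw [dist_eq_norm] at hj
  have e : F n v - l v = (F n (d j) - l (d j)) + (F n - l) (v - d j) := by
    simp only [map_sub, sub_apply]; ring
  have h2 : |(F n - l) (v - d j)| ≤ K * ‖v - d j‖ := by
    refine ((F n - l).le_opNorm _).trans ?_
    gcongr
    exact (norm_sub_le _ _).trans (by linarith [hS n])
  have h3 : K * ‖v - d j‖ < ε / 2 := by
    calc K * ‖v - d j‖ < K * (ε / (2 * K)) := by gcongr
      _ = ε / 2 := by field_simp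
  rw [e]
  linarith [abs_add_le (F n (d j) - l (d j)) ((F n - l) (v - d j))]

/-- A sequence of Galerkin solutions together with its limit `Y`, and a `V`-valued version `W`
of the limit. -/
structure GalerkinLimit (ι : V →L[ℝ] H) (T α : ℝ) (A : ℝ → V → StrongDual ℝ V)
    (B : ℝ → V → HilbertSchmidt U H) (h : ℝ → U) (x : H) (d : ℕ → V) (M C : ℝ)
    (Z : ℕ → ℝ → V) (Y : ℝ → H) (W : ℝ → V) : Prop where
  dense : DenseRange d
  seq : GalerkinSeq ι T α A B h x d M C Z
  weak : ∀ t ∈ Set.Icc 0 T, ∀ z, Tendsto (fun n => inner ℝ z (ι (Z n t))) atTop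
    (𝓝 (inner ℝ z (Y t)))
  norm_le : ∀ t ∈ Set.Icc 0 T, ‖Y t‖ ≤ M
  weakly_continuous : ∀ z, ContinuousOn (fun t => inner ℝ z (Y t)) (Set.Icc 0 T)
  initial : Y 0 = x
  memLp : MemLp W (ENNReal.ofReal α) (timeMeasure T)
  ae_eq : ∀ᵐ t ∂timeMeasure T, ι (W t) = Y t
  strong : ∀ᵐ t ∂timeMeasure T, Tendsto (fun n => ι (Z n t)) atTop (𝓝 (ι (W t)))

variable {h : ℝ → U} {x : H} {d : ℕ → V} {M C : ℝ} {Z : ℕ → ℝ → V} {Y : ℝ → H} {W : ℝ → V}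

theorem GalerkinLimit.ae_norm_le (hL : GalerkinLimit ι T α A B h x d M C Z Y W) :
    ∀ᵐ t ∂timeMeasure T, ‖ι (W t)‖ ≤ M := by
  filter_upwards [hL.ae_eq, ae_timeMeasure_iff.2 (Eventually.of_forall hL.norm_le)] with t h1 h2
  rwa [h1]

namespace Assumptions

theorem exists_galerkinLimit (hyp : Assumptions ι T α f A B)
    (hh : MemLp h 2 (timeMeasure T)) (x : H) :
    ∃ d M C Z Y W, GalerkinLimit ι T α A B h x d M C Z Y W := by
  obtain ⟨d, M, C, Z, hd, hM, hZ⟩ := hyp.exists_galerkinSeq hh x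
  obtain ⟨φ, Y, hφ, hY, hYM, hYc, hY0⟩ := hyp.exists_galerkin_weak_limit hh hd hM hZ
  have hZφ := hZ.comp hφ
  obtain ⟨W, hW, hWY⟩ := hyp.exists_galerkin_limit_memLp hZφ hY
  have hα1 : (1 : ℝ≥0∞) ≤ ENNReal.ofReal α := by
    rw [ENNReal.one_le_ofReal]; exact hyp.one_lt.le
  have hfin : IsFiniteMeasure (timeMeasure T) := by unfold timeMeasure; infer_instance
  obtain ⟨ψ, Γ, hψ, -, hlim⟩ := exists_subseq_dominated
    (fun n => (ι.integrable_comp ((memLp_one_iff_integrable.1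
      (hyp.memLp_of_continuous (hZφ.continuous n) 1)).sub (hW.integrable hα1))).norm)
    (fun _ _ => norm_nonneg _) (hyp.tendsto_integral_galerkin_sub hd hZφ hY hYM hW hWY)
  refine ⟨d, M, C, fun n => Z (φ (ψ n)), Y, W, hd, hZφ.comp hψ, fun t ht z =>
    (hY t ht z).comp hψ.tendsto_atTop, hYM, hYc, hY0, hW, hWY, ?_⟩
  filter_upwards [hlim] with t ht
  rw [tendsto_iff_norm_sub_tendsto_zero]
  simpa using ht.2

theorem ae_tendsto_diffusion (hyp : Assumptions ι T α f A B)
    (hL : GalerkinLimit ι T α A B h x d M C Z Y W) :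
    ∀ᵐ t ∂timeMeasure T, Tendsto (fun n => (B t (Z n t)).toCLM (h t)) atTop
      (𝓝 ((B t (W t)).toCLM (h t))) := by
  filter_upwards [hyp.diffusionContinuity.1, hL.strong] with t h1 h2
  rw [tendsto_iff_norm_sub_tendsto_zero]
  refine squeeze_zero (fun _ => norm_nonneg _) (fun n => ?_)
    (by simpa using (h1 _ _ h2).mul_const ‖h t‖)
  have := (B t (Z n t) - B t (W t)).norm_toCLM_apply_le (h t)
  rwa [map_sub, sub_apply] at this

theorem tendsto_integral_diffusion (hyp : Assumptions ι T α f A B) (hh : MemLp h 2 (timeMeasure T))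
    (hL : GalerkinLimit ι T α A B h x d M C Z Y W) (z : H) {r t : ℝ} (hr : r ∈ Set.Icc 0 T)
    (ht : t ∈ Set.Icc 0 T) (hrt : r ≤ t) :
    Tendsto (fun n => ∫ s in r..t, inner ℝ ((B s (Z n s)).toCLM (h s)) z) atTop
      (𝓝 (∫ s in r..t, inner ℝ ((B s (W s)).toCLM (h s)) z)) := by
  obtain ⟨G, hG, hGb⟩ := hyp.exists_diffusion_bound hh M
  have hsub : Set.uIoc r t ⊆ Set.Icc 0 T := by
    rw [Set.uIoc_of_le hrt]
    exact Set.Ioc_subset_Icc_self.trans (Set.Icc_subset_Icc hr.1 ht.2)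
  refine intervalIntegral.tendsto_integral_filter_of_dominated_convergence
    (fun s => G s * ‖z‖) (Eventually.of_forall fun n => ?_) (Eventually.of_forall fun n => ?_)
    ((intervalIntegrable_of_timeMeasure hG hr ht).mul_const _) ?_
  · have hZn := hyp.memLp_of_continuous (hL.seq.continuous n) 1
    exact ((hyp.integrable_diffusion hh hZn.1
      (hL.seq.ae_norm_le.mono fun t ht => ht n)).inner_const (𝕜 := ℝ) z).1.mono_measure
      (Measure.restrict_mono hsub le_rfl)
  · filter_upwards [ae_timeMeasure_iff.1 hGb] with s hs hst
    refine (norm_inner_le_norm _ _).trans ?_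
    gcongr
    exact hs (hsub hst) _ (hL.seq.norm_le n s (hsub hst))
  · filter_upwards [ae_timeMeasure_iff.1 (hyp.ae_tendsto_diffusion hL)] with s hs hst
    exact (hs (hsub hst)).inner tendsto_const_nhds

theorem tendsto_integral_diffusion_self (hyp : Assumptions ι T α f A B)
    (hh : MemLp h 2 (timeMeasure T))
    (hL : GalerkinLimit ι T α A B h x d M C Z Y W) :
    Tendsto (fun n => ∫ s in (0 : ℝ)..T, inner ℝ ((B s (Z n s)).toCLM (h s)) (ι (Z n s))) atTop
      (𝓝 (∫ s in (0 : ℝ)..T, inner ℝ ((B s (W s)).toCLM (h s)) (Y s))) := by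
  obtain ⟨G, hG, hGb⟩ := hyp.exists_diffusion_bound hh M
  simp only [← integral_timeMeasure hyp.time_pos.le]
  refine tendsto_integral_of_dominated_convergence (fun s => G s * M) (fun n => ?_)
    (hG.mul_const _) (fun n => ?_) ?_
  · have hZn := hyp.memLp_of_continuous (hL.seq.continuous n) 1
    exact (hyp.aestronglyMeasurable_diffusion hh hZn.1).inner (𝕜 := ℝ)
      (ι.continuous.comp_aestronglyMeasurable hZn.1)
  · filter_upwards [hGb, hL.seq.ae_norm_le] with s h1 h2
    refine (norm_inner_le_norm _ _).trans ?_
    have h3 := h1 _ (h2 n)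
    exact mul_le_mul h3 (h2 n) (norm_nonneg _) ((norm_nonneg _).trans h3)
  · filter_upwards [hyp.ae_tendsto_diffusion hL, hL.strong, hL.ae_eq] with s h1 h2 h3
    rw [← h3]
    exact h1.inner h2

/-- Convergence of the integrated drifts. -/
theorem tendsto_integral_drift (hyp : Assumptions ι T α f A B) (hh : MemLp h 2 (timeMeasure T))
    (hL : GalerkinLimit ι T α A B h x d M C Z Y W) (v : V) {r t : ℝ} (hr : r ∈ Set.Icc 0 T)
    (ht : t ∈ Set.Icc 0 T) (hrt : r ≤ t) :
    Tendsto (fun n => ∫ s in r..t, A s (Z n s) v) atTop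
      (𝓝 (inner ℝ (Y t - Y r) (ι v) -
        ∫ s in r..t, inner ℝ ((B s (W s)).toCLM (h s)) (ι v))) := by
  have hfin : IsFiniteMeasure (timeMeasure T) := by unfold timeMeasure; infer_instance
  have h0T : (0 : ℝ) ∈ Set.Icc 0 T := ⟨le_rfl, hyp.time_pos.le⟩
  have hZL := fun n => hyp.memLp_of_continuous (hL.seq.continuous n) (ENNReal.ofReal α)
  have hZM : ∀ n, ∀ᵐ t ∂timeMeasure T, ‖ι (Z n t)‖ ≤ M := fun n =>
    hL.seq.ae_norm_le.mono fun t ht => ht n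
  have hAi := fun n => hyp.integrable_drift (hZL n) (hZM n)
  have hBi := fun n => hyp.integrable_diffusion hh (hZL n).1 (hZM n)
  have hbi := hyp.integrable_diffusion hh hL.memLp.1 hL.ae_norm_le
  obtain ⟨Q, hQ, hQb⟩ := hyp.exists_galerkin_drift_bound hL.seq
  have hdj : ∀ j, Tendsto (fun n => ∫ s in r..t, A s (Z n s) (d j)) atTop
      (𝓝 (inner ℝ (Y t - Y r) (ι (d j)) -
        ∫ s in r..t, inner ℝ ((B s (W s)).toCLM (h s)) (ι (d j)))) := by
    intro j
    have h1 := ((hL.weak t ht (ι (d j))).sub (hL.weak r hr (ι (d j)))).sub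
      (hyp.tendsto_integral_diffusion hh hL (ι (d j)) hr ht hrt)
    rw [← inner_sub_right, real_inner_comm] at h1
    refine h1.congr' ?_
    filter_upwards [eventually_ge_atTop j] with n hn
    have hA := (hAi n).apply_continuousLinearMap (d j)
    have hB := (hBi n).inner_const (𝕜 := ℝ) (ι (d j))
    rw [real_inner_comm, real_inner_comm (ι (Z n r)), hL.seq.weak_eq j n hn t ht,
      hL.seq.weak_eq j n hn r hr,
      ← intervalIntegral.integral_add_adjacent_intervals
        (intervalIntegrable_of_timeMeasure hA h0T hr)
        (intervalIntegrable_of_timeMeasure hA hr ht),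
      ← intervalIntegral.integral_add_adjacent_intervals
        (intervalIntegrable_of_timeMeasure hB h0T hr)
        (intervalIntegrable_of_timeMeasure hB hr ht)]
    ring
  have hD : Integrable (fun s => toDual ι ((B s (W s)).toCLM (h s))) (timeMeasure T) :=
    (toDualCLM ι).integrable_comp hbi
  -- The Galerkin equation gives convergence only against the vectors `d j`, and from `n = j` on;
  -- the uniform bound of the integrated drifts in `V*` extends it to all of `V`.
  have key := tendsto_apply_of_denseRange hL.dense (F := fun n => ∫ s in r..t, A s (Z n s))
    (l := toDual ι (Y t - Y r) - ∫ s in r..t, toDual ι ((B s (W s)).toCLM (h s)))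
    (S := (timeMeasure T).real Set.univ + Q) (fun n => ?_) (fun j => ?_) v
  · simpa only [sub_apply, toDual_apply,
      ContinuousLinearMap.intervalIntegral_apply (intervalIntegrable_of_timeMeasure (hAi _) hr ht),
      ContinuousLinearMap.intervalIntegral_apply (intervalIntegrable_of_timeMeasure hD hr ht)]
      using key
  · have hAr := hyp.integrable_drift_rpow (hZL n) (hZM n)
    have hq := holderConjugate_of_one_lt hyp.one_lt
    have h1 : ∫ s, ‖A s (Z n s)‖ ^ (α / (α - 1)) ∂timeMeasure T ≤ Q := by
      rw [← ENNReal.ofReal_le_ofReal_iff hQ, ofReal_integral_eq_lintegral_ofReal hAr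
        (Eventually.of_forall fun s => by positivity)]
      refine le_trans (le_of_eq (lintegral_congr fun s => ?_)) (hQb n)
      rw [← ofReal_norm, ENNReal.ofReal_rpow_of_nonneg (norm_nonneg _) hq.nonneg]
    calc ‖∫ s in r..t, A s (Z n s)‖ ≤ ∫ s in r..t, ‖A s (Z n s)‖ :=
          intervalIntegral.norm_integral_le_integral_norm hrt
      _ ≤ ∫ s, ‖A s (Z n s)‖ ∂timeMeasure T := by
          rw [intervalIntegral.integral_of_le hrt]
          refine setIntegral_mono_set (hAi n).norm (Eventually.of_forall fun r => norm_nonneg _) ?_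
          exact (Set.Ioc_subset_Icc_self.trans (Set.Icc_subset_Icc hr.1 ht.2)).eventuallyLE
      _ ≤ ∫ s, (1 + ‖A s (Z n s)‖ ^ (α / (α - 1))) ∂timeMeasure T :=
          integral_mono (hAi n).norm ((integrable_const _).add hAr) fun s =>
            le_one_add_rpow (norm_nonneg _) hq.lt.le
      _ ≤ (timeMeasure T).real Set.univ + Q := by
          rw [integral_add (integrable_const _) hAr, integral_const, smul_eq_mul, mul_one]
          linarith
  · simpa only [sub_apply, toDual_apply,
      ContinuousLinearMap.intervalIntegral_apply (intervalIntegrable_of_timeMeasure (hAi _) hr ht),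
      ContinuousLinearMap.intervalIntegral_apply (intervalIntegrable_of_timeMeasure hD hr ht)]
      using hdj j

/-- The pairings of the drifts with the errors are asymptotically nonnegative in the mean. -/
theorem eventually_le_integral_drift_sub (hyp : Assumptions ι T α f A B)
    (hh : MemLp h 2 (timeMeasure T))
    (hL : GalerkinLimit ι T α A B h x d M C Z Y W) {ε : ℝ} (hε : 0 < ε) :
    ∀ᶠ n in atTop, -ε ≤ ∫ s, A s (Z n s) (Z n s - W s) ∂timeMeasure T := by
  have hT := hyp.time_pos
  have hTT : T ∈ Set.Icc 0 T := ⟨hT.le, le_rfl⟩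
  have hZL := fun n => hyp.memLp_of_continuous (hL.seq.continuous n) (ENNReal.ofReal α)
  have hZM : ∀ n, ∀ᵐ t ∂timeMeasure T, ‖ι (Z n t)‖ ≤ M := fun n =>
    hL.seq.ae_norm_le.mono fun t ht => ht n
  obtain ⟨Q, hQ, hQb⟩ := hyp.exists_galerkin_drift_bound hL.seq
  -- `W` does not lie in the Galerkin subspaces and cannot be used as a test function; this bound
  -- for its pairing with the drifts takes the place of testing.
  have h1 := eventually_integral_apply_le hT (holderConjugate_of_one_lt hyp.one_lt) hL.memLp
    hL.ae_eq hL.norm_le hL.weakly_continuous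
    (hyp.integrable_diffusion hh hL.memLp.1 hL.ae_norm_le)
    (fun n => hyp.aestronglyMeasurable_drift (hZL n).1) ENNReal.ofReal_ne_top hQb
    (fun v r hr t ht hrt => hyp.tendsto_integral_drift hh hL v hr ht hrt) (half_pos hε)
  have h2 : Tendsto (fun n => inner ℝ (Y T) (ι (Z n T)) -
      (∫ s in (0 : ℝ)..T, inner ℝ ((B s (Z n s)).toCLM (h s)) (ι (Z n s)))) atTop
      (𝓝 (inner ℝ (Y T) (Y T) - ∫ s in (0 : ℝ)..T, inner ℝ ((B s (W s)).toCLM (h s)) (Y s))) :=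
    (hL.weak T hTT (Y T)).sub (hyp.tendsto_integral_diffusion_self hh hL)
  filter_upwards [h1, h2.eventually (lt_mem_nhds (sub_lt_self _ (half_pos hε)))] with n hn1 hn2
  have e : ∫ s, A s (Z n s) (Z n s - W s) ∂timeMeasure T =
      (∫ s in (0 : ℝ)..T, A s (Z n s) (Z n s)) - ∫ s in (0 : ℝ)..T, A s (Z n s) (W s) := by
    simp only [map_sub, ← integral_timeMeasure hT.le]
    exact integral_sub (hyp.integrable_drift_apply (hZL n) (hZM n) (hZL n))
      (hyp.integrable_drift_apply (hZL n) (hZM n) hL.memLp)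
  have h3 := hL.seq.energy n
  -- With the weak convergence at time `T`, this is weak lower semicontinuity of the norm.
  have h4 : 2 * inner ℝ (Y T) (ι (Z n T)) ≤ ‖Y T‖ ^ 2 + ‖ι (Z n T)‖ ^ 2 := by
    have := real_inner_le_norm (Y T) (ι (Z n T))
    nlinarith [sq_nonneg (‖Y T‖ - ‖ι (Z n T)‖)]
  rw [real_inner_self_eq_norm_sq] at hn2
  rw [hL.initial] at hn1
  rw [e]
  linarith

/-- The positive parts tend to zero pointwise, by monotonicity and coercivity, and are dominated by
`G (f + ‖W‖ ^ α)`, so their integrals tend to zero. Since `|φ| = 2 φ⁺ - φ` and the integrals of `φ`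
are asymptotically nonnegative, the integrals of `|φ|` follow. -/
theorem tendsto_integral_abs_drift_sub (hyp : Assumptions ι T α f A B)
    (hh : MemLp h 2 (timeMeasure T))
    (hL : GalerkinLimit ι T α A B h x d M C Z Y W) :
    Tendsto (fun n => ∫ s, |A s (Z n s) (Z n s - W s)| ∂timeMeasure T) atTop (𝓝 0) := by
  have hα0 : 0 < α := one_pos.trans hyp.one_lt
  have hZL := fun n => hyp.memLp_of_continuous (hL.seq.continuous n) (ENNReal.ofReal α)
  have hZM : ∀ n, ∀ᵐ t ∂timeMeasure T, ‖ι (Z n t)‖ ≤ M := fun n =>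
    hL.seq.ae_norm_le.mono fun t ht => ht n
  have hφ : ∀ n, Integrable (fun s => A s (Z n s) (Z n s - W s)) (timeMeasure T) := fun n =>
    hyp.integrable_drift_apply (hZL n) (hZM n) ((hZL n).sub hL.memLp)
  obtain ⟨c, G, hc, hG, hcG⟩ := hyp.exists_coercive_bound M
  obtain ⟨K, hK⟩ := hyp.exists_monotonicity
  have hpos : Tendsto (fun n => ∫ s, max (A s (Z n s) (Z n s - W s)) 0 ∂timeMeasure T) atTop
      (𝓝 (∫ _, (0 : ℝ) ∂timeMeasure T)) := by
    refine tendsto_integral_of_dominated_convergence (fun s => G * (f s + ‖W s‖ ^ α))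
      (fun n => (hφ n).pos_part.1)
      ((hyp.isL1Nonneg.1.add (integrable_norm_rpow_of_memLp hα0 hL.memLp)).const_mul G)
      (fun n => ?_) ?_
    · filter_upwards [hcG, hZM n, hyp.isL1Nonneg.2] with s h1 h2 h3
      rw [Real.norm_of_nonneg (le_max_right _ _)]
      have h4 : 0 ≤ c * ‖Z n s‖ ^ α := by positivity
      refine max_le ((h1 (W s) (Z n s) h2).trans (by linarith)) (by positivity)
    · filter_upwards [hcG, hL.seq.ae_norm_le, hK, hL.strong] with s h1 h2 h3 h4
      rw [Metric.tendsto_atTop]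
      intro ε hε
      obtain ⟨N, hN⟩ := eventually_atTop.1 (eventually_apply_sub_le hyp.reflexive
        hyp.embedding.injective h3 h4 hα0 hc (fun n => h1 (W s) (Z n s) (h2 n)) (half_pos hε))
      refine ⟨N, fun n hn => ?_⟩
      rw [Real.dist_eq, sub_zero, abs_of_nonneg (le_max_right _ _)]
      exact max_lt ((hN n hn).trans_lt (half_lt_self hε)) hε
  rw [integral_zero] at hpos
  rw [Metric.tendsto_atTop']
  intro ε hε
  obtain ⟨N, hN⟩ := eventually_atTop.1
    ((hpos.eventually (gt_mem_nhds (show (0 : ℝ) < ε / 4 by positivity))).and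
      (hyp.eventually_le_integral_drift_sub hh hL (show (0 : ℝ) < ε / 4 by positivity)))
  refine ⟨N, fun n hn => ?_⟩
  obtain ⟨h1, h2⟩ := hN n hn.le
  rw [Real.dist_eq, sub_zero, abs_of_nonneg (integral_nonneg fun _ => abs_nonneg _)]
  have e : ∫ s, |A s (Z n s) (Z n s - W s)| ∂timeMeasure T =
      2 * (∫ s, max (A s (Z n s) (Z n s - W s)) 0 ∂timeMeasure T) -
        ∫ s, A s (Z n s) (Z n s - W s) ∂timeMeasure T := by
    rw [← integral_const_mul, ← integral_sub ((hφ n).pos_part.const_mul 2) (hφ n)]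
    refine integral_congr_ae (Eventually.of_forall fun s => ?_)
    rcases le_total 0 (A s (Z n s) (Z n s - W s)) with h | h
    · simp only [abs_of_nonneg h, max_eq_left h]; ring
    · simp only [abs_of_nonpos h, max_eq_right h]; ring
  rw [e]
  linarith

/-- The limit of the Galerkin solutions solves the equation in the weak sense. -/
theorem galerkinLimit_weak_eq (hyp : Assumptions ι T α f A B) (hh : MemLp h 2 (timeMeasure T))
    (hL : GalerkinLimit ι T α A B h x d M C Z Y W) (v : V) {t : ℝ} (ht : t ∈ Set.Icc 0 T) :
    inner ℝ (Y t) (ι v) = inner ℝ (Y 0) (ι v) + (∫ s in (0 : ℝ)..t, A s (W s) v) +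
      ∫ s in (0 : ℝ)..t, inner ℝ ((B s (W s)).toCLM (h s)) (ι v) := by
  have hfin : IsFiniteMeasure (timeMeasure T) := by unfold timeMeasure; infer_instance
  have hα0 : 0 < α := one_pos.trans hyp.one_lt
  have hq := holderConjugate_of_one_lt hyp.one_lt
  have h0T : (0 : ℝ) ∈ Set.Icc 0 T := ⟨le_rfl, hyp.time_pos.le⟩
  have hZL := fun n => hyp.memLp_of_continuous (hL.seq.continuous n) (ENNReal.ofReal α)
  have hZM : ∀ n, ∀ᵐ t ∂timeMeasure T, ‖ι (Z n t)‖ ≤ M := fun n =>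
    hL.seq.ae_norm_le.mono fun t ht => ht n
  obtain ⟨ψ, Γ, hψ, hΓ, hΓlim⟩ := exists_subseq_dominated
    (fun n => (hyp.integrable_drift_apply (hZL n) (hZM n) ((hZL n).sub hL.memLp)).abs)
    (fun _ _ => abs_nonneg _) (hyp.tendsto_integral_abs_drift_sub hh hL)
  obtain ⟨c, G, hc, hG, hcG⟩ := hyp.exists_coercive_bound M
  obtain ⟨K, hK⟩ := hyp.exists_monotonicity
  obtain ⟨D, hD, hDb⟩ := hyp.exists_growth M
  set P : ℝ → ℝ := fun s => (G * (f s + ‖W s‖ ^ α) + Γ s) / c with hP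
  have hPi : Integrable P (timeMeasure T) :=
    (((hyp.isL1Nonneg.1.add (integrable_norm_rpow_of_memLp hα0 hL.memLp)).const_mul G).add
      hΓ).div_const c
  -- The coercive bound read backwards: a lower bound `-Γ s` for the pairings bounds the norms in
  -- `V` at a.e. fixed time, uniformly in `n`. This makes Minty's argument possible at that time.
  have hZP : ∀ᵐ s ∂timeMeasure T, ∀ n, ‖Z (ψ n) s‖ ^ α ≤ P s := by
    filter_upwards [hcG, hL.seq.ae_norm_le, hΓlim] with s h1 h2 h3 n
    rw [hP, le_div_iff₀ hc]
    have h4 := h1 (W s) (Z (ψ n) s) (h2 _)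
    have h5 : |A s (Z (ψ n) s) (Z (ψ n) s - W s)| ≤ Γ s := h3.1 n
    have h6 := neg_abs_le (A s (Z (ψ n) s) (Z (ψ n) s - W s))
    linarith
  have hpt : ∀ᵐ s ∂timeMeasure T,
      Tendsto (fun n => A s (Z (ψ n) s) v) atTop (𝓝 (A s (W s) v)) := by
    filter_upwards [hZP, hΓlim, hK, hyp.hemicontinuity, hL.strong] with s h1 h2 h3 h4 h5
    have hb : ∀ n, ‖Z (ψ n) s‖ ≤ 1 + P s := fun n =>
      (le_one_add_rpow (norm_nonneg _) hyp.one_lt.le).trans (by gcongr; exact h1 n)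
    have hw := h5.comp hψ.tendsto_atTop
    refine tendsto_apply_of_minty h4 h3 (Eventually.of_forall hb) hw
      (fun ξ => tendsto_apply_of_tendsto_of_bounded hyp.reflexive hyp.embedding.injective
        (Eventually.of_forall hb) hw ξ) ?_ v
    exact (tendsto_zero_iff_abs_tendsto_zero _).2 h2.2
  have hsub : Set.uIoc 0 t ⊆ Set.Icc 0 T := by
    rw [Set.uIoc_of_le ht.1]
    exact Set.Ioc_subset_Icc_self.trans (Set.Icc_subset_Icc le_rfl ht.2)
  have hlim : Tendsto (fun n => ∫ s in (0 : ℝ)..t, A s (Z (ψ n) s) v) atTop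
      (𝓝 (∫ s in (0 : ℝ)..t, A s (W s) v)) := by
    have hbi : Integrable (fun s => (1 + D * (f s + P s)) * ‖v‖) (timeMeasure T) :=
      ((integrable_const _).add ((hyp.isL1Nonneg.1.add hPi).const_mul D)).mul_const _
    refine intervalIntegral.tendsto_integral_filter_of_dominated_convergence _
      (Eventually.of_forall fun n => ?_) (Eventually.of_forall fun n => ?_)
      (intervalIntegrable_of_timeMeasure hbi h0T ht) ?_
    · exact ((hyp.integrable_drift (hZL _) (hZM _)).apply_continuousLinearMap v).1.mono_measure
        (Measure.restrict_mono hsub le_rfl)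
    · filter_upwards [ae_timeMeasure_iff.1 hZP, ae_timeMeasure_iff.1 hDb] with s h1 h2 hs
      refine ((A s (Z (ψ n) s)).le_opNorm v).trans ?_
      gcongr
      refine (le_one_add_rpow (norm_nonneg _) hq.lt.le).trans ?_
      gcongr
      refine (h2 (hsub hs) _ (hL.seq.norm_le _ s (hsub hs))).trans ?_
      gcongr
      exact h1 (hsub hs) n
    · filter_upwards [ae_timeMeasure_iff.1 hpt] with s h1 hs
      exact h1 (hsub hs)
  -- The integrated drifts have two limits: one from Minty's argument, the other from the Galerkin
  -- equation.
  have h1 := tendsto_nhds_unique hlim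
    ((hyp.tendsto_integral_drift hh hL v h0T ht ht.1).comp hψ.tendsto_atTop)
  rw [h1, inner_sub_left]
  ring

end Assumptions
end GalerkinLimit

/-! ### Existence and uniqueness. -/

section WellPosedness

set_option linter.unusedSectionVars false

variable {V H U : Type*} [NormedAddCommGroup V] [NormedSpace ℝ V] [CompleteSpace V]
  [MeasurableSpace V] [BorelSpace V]
  [NormedAddCommGroup H] [InnerProductSpace ℝ H] [CompleteSpace H]
  [TopologicalSpace.SeparableSpace H]
  [NormedAddCommGroup U] [InnerProductSpace ℝ U] [CompleteSpace U]
  [TopologicalSpace.SeparableSpace U]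
  {ι : V →L[ℝ] H} {T α : ℝ} {f : ℝ → ℝ} {A : ℝ → V → StrongDual ℝ V}
  {B : ℝ → V → HilbertSchmidt U H} {h : ℝ → U} {x : H}

/-- A weakly continuous function with continuous norm is continuous. -/
theorem continuousOn_of_weak_of_norm {Y : ℝ → H} {S : Set ℝ}
    (hw : ∀ z, ContinuousOn (fun t => inner ℝ z (Y t)) S)
    (hn : ContinuousOn (fun t => ‖Y t‖ ^ 2) S) : ContinuousOn Y S := by
  intro t ht
  have h1 : Tendsto (fun s => ‖Y s‖ ^ 2 - 2 * inner ℝ (Y t) (Y s) + ‖Y t‖ ^ 2) (𝓝[S] t)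
      (𝓝 (‖Y t‖ ^ 2 - 2 * inner ℝ (Y t) (Y t) + ‖Y t‖ ^ 2)) :=
    ((hn t ht).tendsto.sub ((hw (Y t) t ht).tendsto.const_mul 2)).add_const _
  have e : ‖Y t‖ ^ 2 - 2 * inner ℝ (Y t) (Y t) + ‖Y t‖ ^ 2 = 0 := by
    rw [real_inner_self_eq_norm_sq]; ring
  rw [e] at h1
  have h2 : Tendsto (fun s => ‖Y s - Y t‖ ^ 2) (𝓝[S] t) (𝓝 0) := h1.congr fun s => by
    rw [norm_sub_sq_real, real_inner_comm]
  have h3 := h2.sqrt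
  simp only [Real.sqrt_sq (norm_nonneg _), Real.sqrt_zero] at h3
  exact tendsto_iff_norm_sub_tendsto_zero.2 h3

namespace Assumptions

theorem memLp_drift (hyp : Assumptions ι T α f A B)
    {W : ℝ → V} {M : ℝ} (hW : MemLp W (ENNReal.ofReal α) (timeMeasure T))
    (hM : ∀ᵐ t ∂timeMeasure T, ‖ι (W t)‖ ≤ M) :
    MemLp (fun s => A s (W s)) (ENNReal.ofReal (α / (α - 1))) (timeMeasure T) := by
  have hq := (holderConjugate_of_one_lt hyp.one_lt).pos
  rw [← integrable_norm_rpow_iff (hyp.aestronglyMeasurable_drift hW.1) (by simpa using hq)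
    ENNReal.ofReal_ne_top, ENNReal.toReal_ofReal hq.le]
  exact hyp.integrable_drift_rpow hW hM

/-- The Galerkin limit is only weakly continuous. The energy identity writes `‖Y t‖²` as a constant
plus primitives of integrable functions, so the norm is continuous as well, and the two together
give continuity in `H`. -/
theorem exists_isSolution (hyp : Assumptions ι T α f A B) (hh : MemLp h 2 (timeMeasure T)) (x : H) :
    ∃ Y : ℝ → H, IsSolution ι T α A B h x Y := by
  obtain ⟨d, M, C, Z, Y, W, hL⟩ := hyp.exists_galerkinLimit hh x
  have hq := holderConjugate_of_one_lt hyp.one_lt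
  have h0T : (0 : ℝ) ∈ Set.Icc 0 T := ⟨le_rfl, hyp.time_pos.le⟩
  have hA := hyp.integrable_drift hL.memLp hL.ae_norm_le
  have hB := hyp.integrable_diffusion hh hL.memLp.1 hL.ae_norm_le
  have hD : Integrable (fun s => toDual ι ((B s (W s)).toCLM (h s))) (timeMeasure T) :=
    (toDualCLM ι).integrable_comp hB
  have hAW := hyp.integrable_drift_apply hL.memLp hL.ae_norm_le hL.memLp
  have hBY : Integrable (fun s => inner ℝ ((B s (W s)).toCLM (h s)) (Y s)) (timeMeasure T) := by
    have hYm : AEStronglyMeasurable Y (timeMeasure T) :=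
      (ι.continuous.comp_aestronglyMeasurable hL.memLp.1).congr hL.ae_eq
    refine (hB.norm.mul_const M).mono' (hB.1.inner hYm) ?_
    filter_upwards [ae_timeMeasure_iff.2 (Eventually.of_forall hL.norm_le)] with s hs
    exact (norm_inner_le_norm _ _).trans (by gcongr)
  obtain ⟨hw, hE⟩ := energy_identity hyp.embedding.denseRange hq hL.memLp hL.ae_eq hL.norm_le hB
    hA.1 (lintegral_rpow_lt_top_of_memLp hq.pos (hyp.memLp_drift hL.memLp hL.ae_norm_le))
    (fun v t ht => hyp.galerkinLimit_weak_eq hh hL v ht)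
  refine ⟨Y, continuousOn_of_weak_of_norm hw ?_, W, hL.memLp, hL.ae_eq, hA, hD, fun t ht => ?_⟩
  · refine ContinuousOn.congr ?_ hE
    exact (continuousOn_const.add ((continuousOn_primitive_timeMeasure hAW).const_mul 2)).add
      ((continuousOn_primitive_timeMeasure hBY).const_mul 2)
  · ext v
    rw [add_apply, add_apply, toDual_apply, toDual_apply,
      ContinuousLinearMap.intervalIntegral_apply (intervalIntegrable_of_timeMeasure hA h0T ht),
      ContinuousLinearMap.intervalIntegral_apply (intervalIntegrable_of_timeMeasure hD h0T ht),
      hyp.galerkinLimit_weak_eq hh hL v ht, hL.initial]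
    simp only [toDual_apply]

/-- In the energy identity for the difference `X`, the cross term `2 ‖B(Z₁) - B(Z₂)‖ ‖h‖ ‖X‖` is
absorbed by the diffusion part of the monotonicity condition at the cost of `‖h‖² ‖X‖²`. Grönwall
with zero initial value concludes. -/
theorem eqOn_of_isSolution (hyp : Assumptions ι T α f A B)
    (H2 : LocalMonotonicity ι T α f A B) (hh : MemLp h 2 (timeMeasure T))
    {Y₁ Y₂ : ℝ → H} (h₁ : IsSolution ι T α A B h x Y₁) (h₂ : IsSolution ι T α A B h x Y₂) :
    Set.EqOn Y₁ Y₂ (Set.Icc 0 T) := by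
  obtain ⟨hY₁, Z₁, hZ₁, hZY₁, hA₁, hD₁, he₁⟩ := h₁
  obtain ⟨hY₂, Z₂, hZ₂, hZY₂, hA₂, hD₂, he₂⟩ := h₂
  obtain ⟨γ, C, ρ, η, hγ, hC, hρ, hη, hmono, hρη⟩ := H2
  obtain ⟨M₁, hM₁⟩ := isCompact_Icc.exists_bound_of_continuousOn hY₁
  obtain ⟨M₂, hM₂⟩ := isCompact_Icc.exists_bound_of_continuousOn hY₂
  have hfin : IsFiniteMeasure (timeMeasure T) := by unfold timeMeasure; infer_instance
  have hα0 : 0 < α := one_pos.trans hyp.one_lt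
  have hq := holderConjugate_of_one_lt hyp.one_lt
  have h0T : (0 : ℝ) ∈ Set.Icc 0 T := ⟨le_rfl, hyp.time_pos.le⟩
  have hb₁ : ∀ᵐ t ∂timeMeasure T, ‖ι (Z₁ t)‖ ≤ M₁ := by
    filter_upwards [hZY₁, ae_timeMeasure_iff.2 (Eventually.of_forall hM₁)] with t h1 h2
    rwa [h1]
  have hb₂ : ∀ᵐ t ∂timeMeasure T, ‖ι (Z₂ t)‖ ≤ M₂ := by
    filter_upwards [hZY₂, ae_timeMeasure_iff.2 (Eventually.of_forall hM₂)] with t h1 h2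
    rwa [h1]
  have hB₁ := hyp.integrable_diffusion hh hZ₁.1 hb₁
  have hB₂ := hyp.integrable_diffusion hh hZ₂.1 hb₂
  have hweak : ∀ (Y : ℝ → H) (Z : ℝ → V), Integrable (fun s => A s (Z s)) (timeMeasure T) →
      Integrable (fun s => toDual ι ((B s (Z s)).toCLM (h s))) (timeMeasure T) →
      (∀ t ∈ Set.Icc 0 T, toDual ι (Y t) = toDual ι x + (∫ s in (0 : ℝ)..t, A s (Z s)) +
        ∫ s in (0 : ℝ)..t, toDual ι ((B s (Z s)).toCLM (h s))) →
      ∀ v, ∀ t ∈ Set.Icc 0 T, inner ℝ (Y t) (ι v) = inner ℝ x (ι v) +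
        (∫ s in (0 : ℝ)..t, A s (Z s) v) +
          ∫ s in (0 : ℝ)..t, inner ℝ ((B s (Z s)).toCLM (h s)) (ι v) := by
    intro Y Z hA hD he v t ht
    have h1 := DFunLike.congr_fun (he t ht) v
    rw [add_apply, add_apply, toDual_apply, toDual_apply,
      ContinuousLinearMap.intervalIntegral_apply (intervalIntegrable_of_timeMeasure hA h0T ht),
      ContinuousLinearMap.intervalIntegral_apply
        (intervalIntegrable_of_timeMeasure hD h0T ht)] at h1
    simpa only [toDual_apply] using h1
  have hw₁ := hweak Y₁ Z₁ hA₁ hD₁ he₁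
  have hw₂ := hweak Y₂ Z₂ hA₂ hD₂ he₂
  set X : ℝ → H := fun t => Y₁ t - Y₂ t with hX
  have hXc : ContinuousOn X (Set.Icc 0 T) := hY₁.sub hY₂
  have hXM : ∀ t ∈ Set.Icc 0 T, ‖X t‖ ≤ M₁ + M₂ := fun t ht =>
    (norm_sub_le _ _).trans (add_le_add (hM₁ t ht) (hM₂ t ht))
  have hX0 : X 0 = 0 := by
    refine hyp.embedding.denseRange.eq_zero_of_inner_left ℝ fun v => ?_
    have h1 := hw₁ v 0 h0T
    have h2 := hw₂ v 0 h0T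
    rw [intervalIntegral.integral_same, intervalIntegral.integral_same, add_zero, add_zero] at h1 h2
    rw [hX, inner_sub_left, h1, h2, sub_self]
  have hZX : ∀ᵐ t ∂timeMeasure T, ι (Z₁ t - Z₂ t) = X t := by
    filter_upwards [hZY₁, hZY₂] with t h1 h2
    rw [map_sub, h1, h2]
  have hAq := (hyp.memLp_drift hZ₁ hb₁).sub (hyp.memLp_drift hZ₂ hb₂)
  have hAi := integrable_dual_apply hq hAq.1 (lintegral_rpow_lt_top_of_memLp hq.pos hAq)
    (hZ₁.sub hZ₂)
  have hBi : Integrable (fun s => inner ℝ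
      ((B s (Z₁ s)).toCLM (h s) - (B s (Z₂ s)).toCLM (h s)) (X s)) (timeMeasure T) := by
    refine ((hB₁.sub hB₂).norm.mul_const (M₁ + M₂)).mono' ((hB₁.sub hB₂).1.inner
      (hXc.aestronglyMeasurable measurableSet_Icc)) ?_
    filter_upwards [ae_timeMeasure_iff.2 (Eventually.of_forall hXM)] with s hs
    exact (norm_inner_le_norm _ _).trans (by gcongr; rfl)
  obtain ⟨-, hE⟩ := energy_identity hyp.embedding.denseRange hq (hZ₁.sub hZ₂) hZX hXM
    (hB₁.sub hB₂) hAq.1 (lintegral_rpow_lt_top_of_memLp hq.pos hAq) (fun v t ht => by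
      have i1 := fun t (ht : t ∈ Set.Icc 0 T) =>
        intervalIntegrable_of_timeMeasure (hA₁.apply_continuousLinearMap v) h0T ht
      have i2 := fun t (ht : t ∈ Set.Icc 0 T) =>
        intervalIntegrable_of_timeMeasure (hA₂.apply_continuousLinearMap v) h0T ht
      have i3 := fun t (ht : t ∈ Set.Icc 0 T) =>
        intervalIntegrable_of_timeMeasure (hB₁.inner_const (𝕜 := ℝ) (ι v)) h0T ht
      have i4 := fun t (ht : t ∈ Set.Icc 0 T) =>
        intervalIntegrable_of_timeMeasure (hB₂.inner_const (𝕜 := ℝ) (ι v)) h0T ht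
      simp only [Pi.sub_apply, sub_apply, inner_sub_left]
      rw [hX0, intervalIntegral.integral_sub (i1 t ht) (i2 t ht),
        intervalIntegral.integral_sub (i3 t ht) (i4 t ht), hX, inner_sub_left, hw₁ v t ht,
        hw₂ v t ht, inner_zero_left]
      ring)
  have hbound : ∀ (ζ : V → ℝ) (Z : ℝ → V) (M : ℝ), Measurable ζ →
      MemLp Z (ENNReal.ofReal α) (timeMeasure T) → (∀ᵐ t ∂timeMeasure T, ‖ι (Z t)‖ ≤ M) →
      (∀ u, |ζ u| ≤ C * (1 + ‖u‖ ^ α) * (1 + ‖ι u‖ ^ γ)) →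
      Integrable (fun s => |ζ (Z s)|) (timeMeasure T) := by
    intro ζ Z M hζ hZ hM hb
    refine Integrable.abs ?_
    refine ((((integrable_const (1 : ℝ)).add
      (integrable_norm_rpow_of_memLp hα0 hZ)).const_mul C).mul_const (1 + |M| ^ γ)).mono'
      (hζ.comp_aemeasurable hZ.1.aemeasurable).aestronglyMeasurable ?_
    filter_upwards [hM] with s hs
    refine (hb _).trans ?_
    simp only [Pi.add_apply]
    gcongr
    exact hs.trans (le_abs_self M)
  -- Absolute values make the Grönwall coefficient nonnegative. It is integrable because both
  -- solutions are bounded in `H` and lie in `L^α(0, T; V)`.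
  have hk : IsL1Nonneg T fun s => f s + |ρ (Z₁ s)| + |η (Z₂ s)| + ‖h s‖ ^ 2 := by
    refine ⟨((hyp.isL1Nonneg.1.add (hbound ρ Z₁ M₁ hρ hZ₁ hb₁ fun u => ?_)).add
      (hbound η Z₂ M₂ hη hZ₂ hb₂ fun u => ?_)).add (hh.integrable_norm_pow two_ne_zero), ?_⟩
    · linarith [hρη u, abs_nonneg (η u)]
    · linarith [hρη u, abs_nonneg (ρ u)]
    · filter_upwards [hyp.isL1Nonneg.2] with s hs
      positivity
  have hX2 : ContinuousOn (fun t => ‖X t‖ ^ 2) (Set.Icc 0 T) := hXc.norm.pow 2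
  have hpt : ∀ᵐ s ∂timeMeasure T, 2 * (A s (Z₁ s) - A s (Z₂ s)) (Z₁ s - Z₂ s) +
      2 * inner ℝ ((B s (Z₁ s)).toCLM (h s) - (B s (Z₂ s)).toCLM (h s)) (X s) ≤
      (f s + |ρ (Z₁ s)| + |η (Z₂ s)| + ‖h s‖ ^ 2) * ‖X s‖ ^ 2 := by
    filter_upwards [hmono, hZX] with s h1 h2
    have h3 := h1 (Z₁ s) (Z₂ s)
    rw [h2] at h3
    have h4 : inner ℝ ((B s (Z₁ s)).toCLM (h s) - (B s (Z₂ s)).toCLM (h s)) (X s) ≤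
        ‖B s (Z₁ s) - B s (Z₂ s)‖ * (‖h s‖ * ‖X s‖) := by
      rw [← mul_assoc]
      refine (real_inner_le_norm _ _).trans ?_
      gcongr
      have := (B s (Z₁ s) - B s (Z₂ s)).norm_toCLM_apply_le (h s)
      rwa [map_sub, sub_apply] at this
    have h5 := two_mul_le_add_sq ‖B s (Z₁ s) - B s (Z₂ s)‖ (‖h s‖ * ‖X s‖)
    have h6 : (f s + ρ (Z₁ s) + η (Z₂ s)) * ‖X s‖ ^ 2 ≤
        (f s + |ρ (Z₁ s)| + |η (Z₂ s)|) * ‖X s‖ ^ 2 := by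
      gcongr
      · exact le_abs_self _
      · exact le_abs_self _
    rw [mul_pow] at h5
    linarith
  obtain ⟨K, -, hG⟩ := gronwall_integrable hk
  have hmain := hG 0 (fun t => ‖X t‖ ^ 2) le_rfl hX2 fun t ht => by
    have j1 := intervalIntegrable_of_timeMeasure hAi h0T ht
    have j2 := intervalIntegrable_of_timeMeasure hBi h0T ht
    have j3 := intervalIntegrable_of_timeMeasure (integrable_mul_continuousOn hk.1 hX2) h0T ht
    have h1 := hE t ht
    rw [hX0, norm_zero, zero_pow two_ne_zero, ← intervalIntegral.integral_const_mul,
      ← intervalIntegral.integral_const_mul, add_assoc] at h1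
    refine h1.le.trans ?_
    gcongr
    refine (intervalIntegral.integral_add (j1.const_mul 2) (j2.const_mul 2)).symm.le.trans ?_
    exact intervalIntegral.integral_mono_ae_restrict ht.1 ((j1.const_mul 2).add (j2.const_mul 2))
      j3 (ae_mono (timeMeasure_mono ht.2) hpt)
  intro t ht
  have h1 := hmain t ht
  rw [mul_zero] at h1
  have h2 : ‖X t‖ = 0 := by
    have : ‖X t‖ ^ 2 = 0 := le_antisymm h1 (sq_nonneg _)
    exact pow_eq_zero_iff two_ne_zero |>.1 this
  exact sub_eq_zero.1 (norm_eq_zero.1 h2)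

end Assumptions
end WellPosedness
end Skeleton

theorem proposition3p4
    {V H U : Type*}
    [NormedAddCommGroup V] [NormedSpace ℝ V] [CompleteSpace V]
    [MeasurableSpace V] [BorelSpace V]
    [NormedAddCommGroup H] [InnerProductSpace ℝ H] [CompleteSpace H]
    [TopologicalSpace.SeparableSpace H]
    [NormedAddCommGroup U] [InnerProductSpace ℝ U] [CompleteSpace U]
    [TopologicalSpace.SeparableSpace U]
    (hV : Skeleton.IsReflexive V)
    (ι : V →L[ℝ] H) (hι : Skeleton.IsCompactDenseEmbedding ι)
    (T : ℝ) (hT : 0 < T) (α : ℝ) (hα : 1 < α)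
    (f : ℝ → ℝ) (hf : Skeleton.IsL1Nonneg T f)
    (A : ℝ → V → StrongDual ℝ V)
    (hA : Measurable fun p : Set.Icc (0 : ℝ) T × V => A p.1 p.2)
    (B : ℝ → V → Skeleton.HilbertSchmidt U H)
    (hB : Measurable fun p : Set.Icc (0 : ℝ) T × V => B p.1 p.2)
    (H1 : Skeleton.Hemicontinuity T A)
    (H2' : Skeleton.GeneralizedLocalMonotonicity ι T A)
    (H3 : Skeleton.Coercivity ι T α f A B)
    (H4 : Skeleton.Growth ι T α f A)
    (H5 : Skeleton.DiffusionContinuity ι T B) :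
    (∀ h : ℝ → U, MemLp h 2 (Skeleton.timeMeasure T) → ∀ x : H,
      ∃ Y : ℝ → H, Skeleton.IsSolution ι T α A B h x Y) ∧
    (Skeleton.LocalMonotonicity ι T α f A B →
      ∀ h : ℝ → U, MemLp h 2 (Skeleton.timeMeasure T) → ∀ x : H,
        ∀ Y₁ Y₂ : ℝ → H,
          Skeleton.IsSolution ι T α A B h x Y₁ → Skeleton.IsSolution ι T α A B h x Y₂ →
            Set.EqOn Y₁ Y₂ (Set.Icc 0 T)) := by
  have hyp : Skeleton.Assumptions ι T α f A B :=
    ⟨hV, hι, hT, hα, hf, hA, hB, H1, H2', H3, H4, H5⟩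
  exact ⟨fun h hh x => hyp.exists_isSolution hh x,
    fun H2 h hh x Y₁ Y₂ h₁ h₂ => hyp.eqOn_of_isSolution H2 hh h₁ h₂⟩

end
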